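/- **Conventions.** A *supercategory* over $\Bbbk$ is a $\Bbbk$-linear category whose morphism spaces are $\mathbb Z/2$-graded, with composition additive on parities and identities even. In a *monoidal supercategory* the tensor product of morphisms is bilinear, additive on parities and satisfies $(f'\otimes g')\circ(f\otimes g)=(-1)^{|g'||f|}(f'\circ f)\otimes(g'\circ g)$, and the associativity and unit isomorphisms are even, natural, and satisfy the pentagon and triangle axioms. A *monoidal superfunctor* is a $\Bbbk$-linear parity-preserving functor $G$ with an even natural isomorphism $\mu_{X,Y}:G(X)\otimes G(Y)\cong G(X\otimes Y)$ and an even isomorphism $\varepsilon:\mathbb 1\cong G(\mathbb 1)$ satisfying the usual associativity and unit axioms. Let $\Bbbk$ be a field of characteristic different from $2$ and $n\ge 0$. **The category $\mathfrak p\text{-}\mathbf{Web}$.** It is the strict monoidal $\Bbbk$-linear supercategory with objects the finite sequences of positive integers (tensor product is concatenation; the label $0$ denotes the unit object), generated by the even morphisms *split* $a+b\to (a,b)$ and *merge* $(a,b)\to a+b$ ($a,b\ge 0$) and the odd morphisms *cap* $(1,1)\to\varnothing$ and *cup* $\varnothing\to(1,1)$, modulo the relations below. Strands labelled $0$ are deleted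 (so splits and merges with $a=0$ or $b=0$ are identities), and a diagram with a negatively labelled strand is zero. The *antenna* $2\to\varnothing$ is $\tfrac12\,\mathrm{cap}\circ\mathrm{split}_2^{1,1}$. On two uprights $(a,b)$ put * $E^{(r)}:(a,b)\to(a-r,b+r)$: split $r$ off the right of the first upright and merge it into the left of the second; * $F^{(r)}:(a,b)\to(a+r,b-r)$: split $r$ off the left of the second upright and merge it into the right of the first; * $C:(a,b)\to(a-1,b-1)$: split one strand off the right of the first and one off the left of the second upright and cap them; * $U:(a,b)\to(a+1,b+1)$: create a cup between the uprights and merge its ends into them; * $A_1:(a,b)\to(a-2,b)$ and $A_2:(a,b)\to(a,b-2)$: split a strand labelled $2$ off the right of the first, respectively the left of the second, upright and end it by an antenna. The defining relations, for all labels and thicknesses $r,s\ge0$, are: 1. (associativity) the two iterated splits $a+b+c\to(a,b,c)$ agree, and the two iterated merges $(a,b,c)\to a+b+c$ agree; 2. (rung swap) $F^{(r)}E^{(s)}=\sum_{t\ge0}\binom{a-b+r-s}{t}E^{(s-t)}F^{(r-t)}$ on $(a,b)$; 3. (straightening) $(\mathrm{id}_1\otimes\mathrm{cap})(\mathrm{cup}\otimes\mathrm{id}_1)=\mathrm{id}_1=-(\mathrm{cap}\otimes\mathrm{id}_1)(\mathrm{id}_1\otimes\mathrm{cup})$;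 4. (antenna retraction) $\mathrm{antenna}\circ\mathrm{merge}_{1,1}^2=\mathrm{cap}$; 5. (cap/rung swap) $CE^{(r)}=E^{(r)}C+2E^{(r-1)}A_1$ and $CF^{(r)}=F^{(r)}C+2F^{(r-1)}A_2$; 6. (cup/rung swap) $E^{(r)}U=UE^{(r)}$ and $F^{(r)}U=UF^{(r)}$. **The Lie superalgebra $\mathfrak p(n)$ and its modules.** Let $V_n$ be the superspace with basis $v_i$, $i\in\{1,\dots,n,-1,\dots,-n\}$, with $v_i$ even for $i>0$ and odd for $i<0$; write $\bar i=|v_i|$. Let $(v_i,v_j)=\delta_{i,-j}$, an odd bilinear form, and let $\mathfrak p(n)\subseteq\mathfrak{gl}(V_n)$ be the Lie superalgebra spanned by the homogeneous $f$ with $(f(v),w)+(-1)^{|f||v|}(v,f(w))=0$ for all homogeneous $v,w$, with the supercommutator as bracket. Consider the monoidal supercategory of $\mathfrak p(n)$-supermodules over $\Bbbk$, whose homogeneous morphisms $f:M\to N$ are the linear maps with $f(M_s)\subseteq N_{s+|f|}$ and $f(x.m)=(-1)^{|x||f|}x.f(m)$; here $x.(m\otimes m')=x.m\otimes m'+(-1)^{|x||m|}m\otimes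 x.m'$ and $(f\otimes g)(m\otimes m')=(-1)^{|g||m|}f(m)\otimes g(m')$. Let $S(V_n)=\bigoplus_d S^d(V_n)$ be the symmetric superalgebra (the tensor algebra modulo $vw=(-1)^{|v||w|}wv$), on which $\mathfrak p(n)$ acts by superderivations, with product $\nabla$, coproduct $\Delta$ (the algebra homomorphism with $\Delta(v)=v\otimes1+1\otimes v$ for $v \in V_n$), inclusions $\iota_d:S^d(V_n)\to S(V_n)$ and projections $p_d:S(V_n)\to S^d(V_n)$; $S^0(V_n)=\Bbbk$ is the trivial module and $S^1(V_n)=V_n$. Let $\mathfrak p(n)\text{-mod}_{\mathcal S}$ be the full monoidal subcategory generated by the $S^d(V_n)$, $d\ge0$. Put $$\mathrm{spl}_{a+b}^{a,b}=(p_a\otimes p_b)\circ\Delta\circ\iota_{a+b},\qquad \mathrm{mer}_{a,b}^{a+b}=p_{a+b}\circ\nabla\circ(\iota_a\otimes\iota_b),$$ $$\cap:V_n\otimes V_n\to\Bbbk,\ v\otimes w\mapsto(v,w),\qquad \cup:\Bbbk\to V_n\otimes V_n,\ 1\mapsto\sum_i(-1)^{\bar i}\,v_i\otimes v_{-i}.$$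 **Theorem.** There is a monoidal superfunctor $G:\mathfrak p\text{-}\mathbf{Web}\to\mathfrak p(n)\text{-mod}_{\mathcal S}$ with $G(d)=S^d(V_n)$ for all $d\ge0$ and with $\varepsilon$ the identity of $\Bbbk=S^0(V_n)$, such that, identifying $G(a,b)$ with $S^a(V_n)\otimes S^b(V_n)$ through $\mu$ and $G(\varnothing)$ with $\Bbbk$ through $\varepsilon$, one has for all $a,b\ge0$ $$G(\mathrm{split}_{a+b}^{a,b})=\mathrm{spl}_{a+b}^{a,b},\qquad G(\mathrm{merge}_{a,b}^{a+b})=\mathrm{mer}_{a,b}^{a+b},\qquad G(\mathrm{cap})=\cap,\qquad G(\mathrm{cup})=\cup .$$ In particular these four kinds of maps are $\mathfrak p(n)$-module homomorphisms (the first two even, the last two odd), and they satisfy all the defining relations of $\mathfrak p\text{-}\mathbf{Web}$. -/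

import Mathlib

open CategoryTheory TensorProduct

universe u v w

namespace PWebs

/-! ## Signs -/

/-- The Koszul sign `(-1)^{pq}` of two parities, as an element of `k`. -/
def koszul (k : Type u) [CommRing k] (p q : ZMod 2) : k :=
  if p = 1 ∧ q = 1 then -1 else 1

theorem zmod2_cases (p : ZMod 2) : p = 0 ∨ p = 1 := by
  revert p; decide

section koszul
variable (k : Type u) [CommRing k]

@[simp] theorem koszul_zero_left (q : ZMod 2) : koszul k 0 q = 1 := by simp [koszul]
@[simp] theorem koszul_zero_right (q : ZMod 2) : koszul k q 0 = 1 := by simp [koszul]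
@[simp] theorem koszul_one_one : koszul k 1 1 = -1 := by simp [koszul]

theorem zmod2_one_add_one : (1 + 1 : ZMod 2) = 0 := by decide

theorem koszul_comm (p q : ZMod 2) : koszul k p q = koszul k q p := by
  simp [koszul, and_comm]

theorem koszul_add_right (p q r : ZMod 2) :
    koszul k p (q + r) = koszul k p q * koszul k p r := by
  rcases zmod2_cases p with rfl | rfl <;> rcases zmod2_cases q with rfl | rfl <;>
    rcases zmod2_cases r with rfl | rfl <;> simp [zmod2_one_add_one]

theorem koszul_add_left (p q r : ZMod 2) :
    koszul k (p + q) r = koszul k p r * koszul k q r := by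
  rw [koszul_comm, koszul_add_right, koszul_comm k r p, koszul_comm k r q]

theorem koszul_mul_self (p q : ZMod 2) : koszul k p q * koszul k p q = 1 := by
  rcases zmod2_cases p with rfl | rfl <;> rcases zmod2_cases q with rfl | rfl <;> simp

end koszul

/-! ## Monoidal supercategories and monoidal superfunctors -/

/-- A `k`-linear supercategory: a `k`-linear category whose morphism spaces are
`ℤ/2`-graded, with composition adding parities and with even identities. -/
class Supercategory (k : Type u) [CommRing k] (C : Type v) [Category.{w} C] [Preadditive C]
    [Linear k C] where
  /-- the morphisms of parity `p` -/
  homPart (X Y : C) (p : ZMod 2) : Submodule k (X ⟶ Y)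
  isCompl (X Y : C) : IsCompl (homPart X Y 0) (homPart X Y 1)
  id_mem (X : C) : 𝟙 X ∈ homPart X X 0
  comp_mem {X Y Z : C} {p q : ZMod 2} {f : X ⟶ Y} {g : Y ⟶ Z} :
    f ∈ homPart X Y p → g ∈ homPart Y Z q → f ≫ g ∈ homPart X Z (p + q)

/-- The morphisms of parity `p`, with the ground ring made explicit. -/
abbrev homPart (k : Type u) [CommRing k] {C : Type v} [Category.{w} C] [Preadditive C]
    [Linear k C] [Supercategory k C] (X Y : C) (p : ZMod 2) : Submodule k (X ⟶ Y) :=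
  Supercategory.homPart X Y p

/-- A monoidal supercategory.  The tensor product of morphisms is bilinear, adds parities,
and satisfies the super-interchange law
`(f' ⊗ g') ∘ (f ⊗ g) = (-1)^{|g'||f|} (f' ∘ f) ⊗ (g' ∘ g)`; the associator and the unitors are
even natural isomorphisms satisfying the pentagon and triangle axioms. -/
class MonoidalSupercategory (k : Type u) [CommRing k] (C : Type v) [Category.{w} C]
    [Preadditive C] [Linear k C] [Supercategory k C] where
  tensorObj : C → C → C
  tensorHom {X Y X' Y' : C} : (X ⟶ Y) → (X' ⟶ Y') → (tensorObj X X' ⟶ tensorObj Y Y')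
  add_tensor {X Y X' Y' : C} (f f' : X ⟶ Y) (g : X' ⟶ Y') :
    tensorHom (f + f') g = tensorHom f g + tensorHom f' g
  tensor_add {X Y X' Y' : C} (f : X ⟶ Y) (g g' : X' ⟶ Y') :
    tensorHom f (g + g') = tensorHom f g + tensorHom f g'
  smul_tensor {X Y X' Y' : C} (c : k) (f : X ⟶ Y) (g : X' ⟶ Y') :
    tensorHom (c • f) g = c • tensorHom f g
  tensor_smul {X Y X' Y' : C} (c : k) (f : X ⟶ Y) (g : X' ⟶ Y') :
    tensorHom f (c • g) = c • tensorHom f g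
  tensor_mem {X Y X' Y' : C} {p q : ZMod 2} {f : X ⟶ Y} {g : X' ⟶ Y'} :
    f ∈ homPart k X Y p → g ∈ homPart k X' Y' q →
      tensorHom f g ∈ homPart k (tensorObj X X') (tensorObj Y Y') (p + q)
  tensor_id (X X' : C) : tensorHom (𝟙 X) (𝟙 X') = 𝟙 (tensorObj X X')
  interchange {X Y Z X' Y' Z' : C} {p q : ZMod 2} (f : X ⟶ Y) (f' : Y ⟶ Z) (g : X' ⟶ Y')
    (g' : Y' ⟶ Z') : f ∈ homPart k X Y p → g' ∈ homPart k Y' Z' q →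
      tensorHom f g ≫ tensorHom f' g' = koszul k q p • tensorHom (f ≫ f') (g ≫ g')
  unit : C
  assoc (X Y Z : C) : tensorObj (tensorObj X Y) Z ≅ tensorObj X (tensorObj Y Z)
  leftUnitor (X : C) : tensorObj unit X ≅ X
  rightUnitor (X : C) : tensorObj X unit ≅ X
  assoc_mem (X Y Z : C) : (assoc X Y Z).hom ∈
    homPart k (tensorObj (tensorObj X Y) Z) (tensorObj X (tensorObj Y Z)) 0
  leftUnitor_mem (X : C) : (leftUnitor X).hom ∈ homPart k (tensorObj unit X) X 0
  rightUnitor_mem (X : C) : (rightUnitor X).hom ∈ homPart k (tensorObj X unit) X 0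
  assoc_naturality {X Y X' Y' X'' Y'' : C} (f : X ⟶ Y) (g : X' ⟶ Y') (h : X'' ⟶ Y'') :
    tensorHom (tensorHom f g) h ≫ (assoc Y Y' Y'').hom =
      (assoc X X' X'').hom ≫ tensorHom f (tensorHom g h)
  leftUnitor_naturality {X Y : C} (f : X ⟶ Y) :
    tensorHom (𝟙 unit) f ≫ (leftUnitor Y).hom = (leftUnitor X).hom ≫ f
  rightUnitor_naturality {X Y : C} (f : X ⟶ Y) :
    tensorHom f (𝟙 unit) ≫ (rightUnitor Y).hom = (rightUnitor X).hom ≫ f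
  pentagon (W X Y Z : C) :
    tensorHom (assoc W X Y).hom (𝟙 Z) ≫ (assoc W (tensorObj X Y) Z).hom ≫
        tensorHom (𝟙 W) (assoc X Y Z).hom =
      (assoc (tensorObj W X) Y Z).hom ≫ (assoc W X (tensorObj Y Z)).hom
  triangle (X Y : C) :
    (assoc X unit Y).hom ≫ tensorHom (𝟙 X) (leftUnitor Y).hom =
      tensorHom (rightUnitor X).hom (𝟙 Y)

section
variable (k : Type u) [CommRing k] {C : Type v} [Category.{w} C] [Preadditive C]
  [Linear k C] [Supercategory k C] [MonoidalSupercategory k C]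

/-! The structure maps of a monoidal supercategory, with the ground ring made explicit. -/

abbrev tensorObj (X Y : C) : C := MonoidalSupercategory.tensorObj k X Y
abbrev tensorHom {X Y X' Y' : C} (f : X ⟶ Y) (g : X' ⟶ Y') :
    tensorObj k X X' ⟶ tensorObj k Y Y' := MonoidalSupercategory.tensorHom f g
abbrev unit : C := MonoidalSupercategory.unit k
abbrev assoc (X Y Z : C) : tensorObj k (tensorObj k X Y) Z ≅ tensorObj k X (tensorObj k Y Z) :=
  MonoidalSupercategory.assoc X Y Z
abbrev leftUnitor (X : C) : tensorObj k (unit k) X ≅ X := MonoidalSupercategory.leftUnitor X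
abbrev rightUnitor (X : C) : tensorObj k X (unit k) ≅ X := MonoidalSupercategory.rightUnitor X

end

/-- A (strong) monoidal superfunctor: a `k`-linear, parity preserving functor together with an
even natural isomorphism `G X ⊗ G Y ≅ G (X ⊗ Y)` and an even isomorphism `𝟙 ≅ G 𝟙` satisfying the
associativity and unit axioms. -/
structure MonoidalSuperfunctor (k : Type u) [CommRing k]
    (C : Type*) [Category C] [Preadditive C] [Linear k C] [Supercategory k C]
    [MonoidalSupercategory k C]
    (D : Type*) [Category D] [Preadditive D] [Linear k D] [Supercategory k D]
    [MonoidalSupercategory k D] extends C ⥤ D where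
  map_add' {X Y : C} (f g : X ⟶ Y) : map (f + g) = map f + map g
  map_smul' {X Y : C} (c : k) (f : X ⟶ Y) : map (c • f) = c • map f
  map_mem' {X Y : C} {p : ZMod 2} {f : X ⟶ Y} :
    f ∈ homPart k X Y p → map f ∈ homPart k (obj X) (obj Y) p
  μ (X Y : C) : tensorObj k (obj X) (obj Y) ≅ obj (tensorObj k X Y)
  ε : unit k (C := D) ≅ obj (unit k (C := C))
  μ_mem (X Y : C) : (μ X Y).hom ∈
    homPart k (tensorObj k (obj X) (obj Y)) (obj (tensorObj k X Y)) 0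
  ε_mem : ε.hom ∈ homPart k (unit k (C := D)) (obj (unit k (C := C))) 0
  μ_naturality {X Y X' Y' : C} (f : X ⟶ Y) (g : X' ⟶ Y') :
    tensorHom k (map f) (map g) ≫ (μ Y Y').hom = (μ X X').hom ≫ map (tensorHom k f g)
  associativity (X Y Z : C) :
    tensorHom k (μ X Y).hom (𝟙 (obj Z)) ≫ (μ (tensorObj k X Y) Z).hom ≫
        map (assoc k X Y Z).hom =
      (assoc k (obj X) (obj Y) (obj Z)).hom ≫ tensorHom k (𝟙 (obj X)) (μ Y Z).hom ≫
        (μ X (tensorObj k Y Z)).hom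
  left_unitality (X : C) :
    tensorHom k ε.hom (𝟙 (obj X)) ≫ (μ (unit k) X).hom ≫ map (leftUnitor k X).hom =
      (leftUnitor k (obj X)).hom
  right_unitality (X : C) :
    tensorHom k (𝟙 (obj X)) ε.hom ≫ (μ X (unit k)).hom ≫ map (rightUnitor k X).hom =
      (rightUnitor k (obj X)).hom

/-! ## The web supercategory -/

/-- The object given by one strand of thickness `a`; a strand of thickness `0` is deleted. -/
def st : ℕ → List ℕ+
  | 0 => []
  | a + 1 => [a.succPNat]

/-- Formal `k`-linear web expressions, built from identity strands, splits, merges, caps and cups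
by vertical composition (`comp f g` is `g` on top of `f`), horizontal juxtaposition and linear
combinations.  The source is the sequence of labels at the bottom, the target the one at the top.
The labels of an identity diagram may be given by two (propositionally) equal sequences, which
makes juxtaposition strictly associative and unital. -/
inductive Diag (k : Type u) : List ℕ+ → List ℕ+ → Type u
  | zero (X Y : List ℕ+) : Diag k X Y
  | add {X Y : List ℕ+} (f g : Diag k X Y) : Diag k X Y
  | smul {X Y : List ℕ+} (c : k) (f : Diag k X Y) : Diag k X Y
  | id {X Y : List ℕ+} (h : X = Y) : Diag k X Y
  | comp {X Y Z : List ℕ+} (f : Diag k X Y) (g : Diag k Y Z) : Diag k X Z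
  | tensor {X Y X' Y' : List ℕ+} (f : Diag k X Y) (g : Diag k X' Y') :
      Diag k (X ++ X') (Y ++ Y')
  | split (a b c : ℕ) (h : a + b = c) : Diag k (st c) (st a ++ st b)
  | merge (a b c : ℕ) (h : a + b = c) : Diag k (st a ++ st b) (st c)
  | cap : Diag k (st 1 ++ st 1) []
  | cup : Diag k [] (st 1 ++ st 1)

namespace Diag

/-- `HasParity f p`: the expression `f` is homogeneous of parity `p`, where splits, merges and
identities are even and caps and cups are odd. -/
inductive HasParity {k : Type u} : {X Y : List ℕ+} → Diag k X Y → ZMod 2 → Prop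
  | zero (X Y : List ℕ+) (p : ZMod 2) : HasParity (Diag.zero X Y) p
  | add {X Y : List ℕ+} {f g : Diag k X Y} {p : ZMod 2} :
      HasParity f p → HasParity g p → HasParity (Diag.add f g) p
  | smul {X Y : List ℕ+} (c : k) {f : Diag k X Y} {p : ZMod 2} :
      HasParity f p → HasParity (Diag.smul c f) p
  | id {X Y : List ℕ+} (h : X = Y) : HasParity (Diag.id h) 0
  | comp {X Y Z : List ℕ+} {f : Diag k X Y} {g : Diag k Y Z} {p q : ZMod 2} :
      HasParity f p → HasParity g q → HasParity (Diag.comp f g) (p + q)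
  | tensor {X Y X' Y' : List ℕ+} {f : Diag k X Y} {g : Diag k X' Y'} {p q : ZMod 2} :
      HasParity f p → HasParity g q → HasParity (Diag.tensor f g) (p + q)
  | split (a b c : ℕ) (h : a + b = c) : HasParity (Diag.split a b c h) 0
  | merge (a b c : ℕ) (h : a + b = c) : HasParity (Diag.merge a b c h) 0
  | cap : HasParity Diag.cap 1
  | cup : HasParity Diag.cup 1

/-- `f 0 + f 1 + ⋯ + f N`. -/
def sumUpTo {k : Type u} {X Y : List ℕ+} (f : ℕ → Diag k X Y) : ℕ → Diag k X Y
  | 0 => f 0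
  | N + 1 => add (sumUpTo f N) (f (N + 1))

section ladders
variable {k : Type u}

/-! The building blocks of the defining relations.  Each is a diagram `(a, b) → (a', b')` on two
uprights; it is zero when the labels do not match.  This implements the convention that a diagram
with a negatively labelled strand is zero: the equations force every label to be the
difference of natural numbers that the picture prescribes. -/

/-- A rung of thickness `r` from the left upright to the right one. -/
def rungR (r a b a' b' : ℕ) : Diag k (st a ++ st b) (st a' ++ st b') :=
  if h : a' + r = a ∧ r + b = b' then
    comp (tensor (split a' r a h.1) (id rfl))
      (comp (id (List.append_assoc (st a') (st r) (st b)))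
        (tensor (id rfl) (merge r b b' h.2)))
  else zero _ _

/-- A rung of thickness `r` from the right upright to the left one. -/
def rungL (r a b a' b' : ℕ) : Diag k (st a ++ st b) (st a' ++ st b') :=
  if h : a + r = a' ∧ r + b' = b then
    comp (tensor (id rfl) (split r b' b h.2))
      (comp (id (List.append_assoc (st a) (st r) (st b')).symm)
        (tensor (merge a r a' h.1) (id rfl)))
  else zero _ _

/-- A cap joining a strand of thickness one split off the right of the left upright to one split
off the left of the right upright. -/
def capAt (a b a' b' : ℕ) : Diag k (st a ++ st b) (st a' ++ st b') :=
  if h : a' + 1 = a ∧ 1 + b' = b then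
    comp (tensor (split a' 1 a h.1) (split 1 b' b h.2))
      (comp (id (List.append_assoc (st a') (st 1) (st 1 ++ st b')))
        (tensor (id (rfl : st a' = st a')) (tensor cap (id (rfl : st b' = st b')))))
  else zero _ _

/-- A cup whose ends are merged into the right of the left upright and into the left of the right
upright. -/
def cupAt (a b a' b' : ℕ) : Diag k (st a ++ st b) (st a' ++ st b') :=
  if h : a + 1 = a' ∧ 1 + b = b' then
    comp (tensor (id (rfl : st a = st a)) (tensor cup (id (rfl : st b = st b))))
      (comp (id (List.append_assoc (st a) (st 1) (st 1 ++ st b)).symm)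
        (tensor (merge a 1 a' h.1) (merge 1 b b' h.2)))
  else zero _ _

/-- The antenna: one half of a cap on top of the split `2 → (1, 1)`. -/
def antenna [Field k] : Diag k (st 2) [] :=
  smul (2 : k)⁻¹ (comp (split 1 1 2 rfl) cap)

/-- A strand of thickness two split off the right of the left upright and ended by an antenna. -/
def antR [Field k] (a b a' : ℕ) : Diag k (st a ++ st b) (st a' ++ st b) :=
  if h : a' + 2 = a then
    comp (tensor (split a' 2 a h) (id rfl))
      (comp (id (List.append_assoc (st a') (st 2) (st b)))
        (tensor (id (rfl : st a' = st a')) (tensor antenna (id (rfl : st b = st b)))))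
  else zero _ _

/-- A strand of thickness two split off the left of the right upright and ended by an antenna. -/
def antL [Field k] (a b b' : ℕ) : Diag k (st a ++ st b) (st a ++ st b') :=
  if h : 2 + b' = b then
    comp (tensor (id rfl) (split 2 b' b h))
      (tensor (id (rfl : st a = st a)) (tensor antenna (id (rfl : st b' = st b'))))
  else zero _ _

end ladders

/-- The defining relations of the web supercategory, apart from the axioms of a strict monoidal
`k`-linear supercategory. -/
inductive DefRel {k : Type u} [Field k] : {X Y : List ℕ+} → Diag k X Y → Diag k X Y → Prop
  -- strands labelled by zero are deleted
  | split_zero_left (b c : ℕ) (h : 0 + b = c) :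
      DefRel (split 0 b c h) (id (by subst h; simp [st]))
  | split_zero_right (a c : ℕ) (h : a + 0 = c) :
      DefRel (split a 0 c h) (id (by subst h; simp [st]))
  | merge_zero_left (b c : ℕ) (h : 0 + b = c) :
      DefRel (merge 0 b c h) (id (by subst h; simp [st]))
  | merge_zero_right (a c : ℕ) (h : a + 0 = c) :
      DefRel (merge a 0 c h) (id (by subst h; simp [st]))
  -- web-associativity
  | split_assoc (a b c : ℕ) :
      DefRel
        (comp (comp (split (a + b) c (a + b + c) rfl)
          (tensor (split a b (a + b) rfl) (id (rfl : st c = st c))))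
          (id (List.append_assoc (st a) (st b) (st c))))
        (comp (split a (b + c) (a + b + c) (Nat.add_assoc a b c).symm)
          (tensor (id (rfl : st a = st a)) (split b c (b + c) rfl)))
  | merge_assoc (a b c : ℕ) :
      DefRel
        (comp (tensor (merge a b (a + b) rfl) (id (rfl : st c = st c)))
          (merge (a + b) c (a + b + c) rfl))
        (comp (id (List.append_assoc (st a) (st b) (st c)))
          (comp (tensor (id (rfl : st a = st a)) (merge b c (b + c) rfl))
            (merge a (b + c) (a + b + c) (Nat.add_assoc a b c).symm)))
  -- rung swap; the summands with `t > min r s` have a negative label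
  | rung_swap (a b r s : ℕ) (h₁ : s ≤ a + r) (h₂ : r ≤ b + s) :
      DefRel
        (comp (rungR s a b (a - s) (b + s)) (rungL r (a - s) (b + s) (a + r - s) (b + s - r)))
        (sumUpTo (fun t => smul ((Ring.choose ((a : ℤ) - b + r - s) t : ℤ) : k)
          (comp (rungL (r - t) a b (a + (r - t)) (b - (r - t)))
            (rungR (s - t) (a + (r - t)) (b - (r - t)) (a + r - s) (b + s - r)))) (min r s))
  -- straightening
  | straighten_left :
      DefRel
        (comp (tensor cup (id (rfl : st 1 = st 1)))
          (comp (id (List.append_assoc (st 1) (st 1) (st 1)))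
            (tensor (id (rfl : st 1 = st 1)) cap)))
        (id (List.append_nil (st 1)).symm)
  | straighten_right :
      DefRel
        (comp (tensor (id (rfl : st 1 = st 1)) cup)
          (comp (id (List.append_assoc (st 1) (st 1) (st 1)).symm)
            (tensor cap (id (rfl : st 1 = st 1)))))
        (smul (-1) (id (List.append_nil (st 1))))
  -- antenna retraction
  | antenna_retraction : DefRel (comp (merge 1 1 2 rfl) antenna) cap
  -- cap/rung swaps; when `r = 0` the last summand has a negative label
  | cap_rung_right (a b r : ℕ) (h₁ : r + 1 ≤ a) (h₂ : 1 ≤ b + r) :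
      DefRel
        (comp (rungR r a b (a - r) (b + r)) (capAt (a - r) (b + r) (a - r - 1) (b + r - 1)))
        (add
          (comp (capAt a b (a - 1) (b - 1)) (rungR r (a - 1) (b - 1) (a - r - 1) (b + r - 1)))
          (if r = 0 then zero _ _ else
            smul 2 (comp (antR a b (a - 2)) (rungR (r - 1) (a - 2) b (a - r - 1) (b + r - 1)))))
  | cap_rung_left (a b r : ℕ) (h₁ : r + 1 ≤ b) (h₂ : 1 ≤ a + r) :
      DefRel
        (comp (rungL r a b (a + r) (b - r)) (capAt (a + r) (b - r) (a + r - 1) (b - r - 1)))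
        (add
          (comp (capAt a b (a - 1) (b - 1)) (rungL r (a - 1) (b - 1) (a + r - 1) (b - r - 1)))
          (if r = 0 then zero _ _ else
            smul 2 (comp (antL a b (b - 2)) (rungL (r - 1) a (b - 2) (a + r - 1) (b - r - 1)))))
  -- cup/rung swaps
  | cup_rung_right (a b r : ℕ) (h : r ≤ a + 1) :
      DefRel
        (comp (cupAt a b (a + 1) (b + 1)) (rungR r (a + 1) (b + 1) (a + 1 - r) (b + r + 1)))
        (comp (rungR r a b (a - r) (b + r)) (cupAt (a - r) (b + r) (a + 1 - r) (b + r + 1)))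
  | cup_rung_left (a b r : ℕ) (h : r ≤ b + 1) :
      DefRel
        (comp (cupAt a b (a + 1) (b + 1)) (rungL r (a + 1) (b + 1) (a + r + 1) (b + 1 - r)))
        (comp (rungL r a b (a + r) (b - r)) (cupAt (a + r) (b - r) (a + r + 1) (b + 1 - r)))

/-- The congruence generated by the defining relations and the axioms of a strict monoidal
`k`-linear supercategory (the equivalence closure is taken by the quotient below). -/
inductive Rel {k : Type u} [Field k] : {X Y : List ℕ+} → Diag k X Y → Diag k X Y → Prop
  | of {X Y : List ℕ+} {f g : Diag k X Y} : DefRel f g → Rel f g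
  -- congruence
  | add_congr {X Y : List ℕ+} {f f' : Diag k X Y} (g : Diag k X Y) :
      Rel f f' → Rel (add f g) (add f' g)
  | smul_congr {X Y : List ℕ+} (c : k) {f f' : Diag k X Y} :
      Rel f f' → Rel (smul c f) (smul c f')
  | comp_congr_left {X Y Z : List ℕ+} {f f' : Diag k X Y} (g : Diag k Y Z) :
      Rel f f' → Rel (comp f g) (comp f' g)
  | comp_congr_right {X Y Z : List ℕ+} (f : Diag k X Y) {g g' : Diag k Y Z} :
      Rel g g' → Rel (comp f g) (comp f g')
  | tensor_congr_left {X Y X' Y' : List ℕ+} {f f' : Diag k X Y} (g : Diag k X' Y') :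
      Rel f f' → Rel (tensor f g) (tensor f' g)
  | tensor_congr_right {X Y X' Y' : List ℕ+} (f : Diag k X Y) {g g' : Diag k X' Y'} :
      Rel g g' → Rel (tensor f g) (tensor f g')
  -- morphism spaces are `k`-modules
  | add_assoc {X Y : List ℕ+} (f g h : Diag k X Y) :
      Rel (add (add f g) h) (add f (add g h))
  | add_comm {X Y : List ℕ+} (f g : Diag k X Y) : Rel (add f g) (add g f)
  | zero_add {X Y : List ℕ+} (f : Diag k X Y) : Rel (add (zero X Y) f) f
  | neg_add {X Y : List ℕ+} (f : Diag k X Y) : Rel (add (smul (-1) f) f) (zero X Y)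
  | one_smul {X Y : List ℕ+} (f : Diag k X Y) : Rel (smul 1 f) f
  | mul_smul {X Y : List ℕ+} (c d : k) (f : Diag k X Y) :
      Rel (smul (c * d) f) (smul c (smul d f))
  | smul_add {X Y : List ℕ+} (c : k) (f g : Diag k X Y) :
      Rel (smul c (add f g)) (add (smul c f) (smul c g))
  | add_smul {X Y : List ℕ+} (c d : k) (f : Diag k X Y) :
      Rel (smul (c + d) f) (add (smul c f) (smul d f))
  -- `k`-linear category
  | id_comp {X Y : List ℕ+} (f : Diag k X Y) : Rel (comp (id rfl) f) f
  | comp_id {X Y : List ℕ+} (f : Diag k X Y) : Rel (comp f (id rfl)) f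
  | comp_assoc {W X Y Z : List ℕ+} (f : Diag k W X) (g : Diag k X Y) (h : Diag k Y Z) :
      Rel (comp (comp f g) h) (comp f (comp g h))
  | add_comp {X Y Z : List ℕ+} (f f' : Diag k X Y) (g : Diag k Y Z) :
      Rel (comp (add f f') g) (add (comp f g) (comp f' g))
  | comp_add {X Y Z : List ℕ+} (f : Diag k X Y) (g g' : Diag k Y Z) :
      Rel (comp f (add g g')) (add (comp f g) (comp f g'))
  | smul_comp {X Y Z : List ℕ+} (c : k) (f : Diag k X Y) (g : Diag k Y Z) :
      Rel (comp (smul c f) g) (smul c (comp f g))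
  | comp_smul {X Y Z : List ℕ+} (c : k) (f : Diag k X Y) (g : Diag k Y Z) :
      Rel (comp f (smul c g)) (smul c (comp f g))
  -- strict monoidal structure
  | add_tensor {X Y X' Y' : List ℕ+} (f f' : Diag k X Y) (g : Diag k X' Y') :
      Rel (tensor (add f f') g) (add (tensor f g) (tensor f' g))
  | tensor_add {X Y X' Y' : List ℕ+} (f : Diag k X Y) (g g' : Diag k X' Y') :
      Rel (tensor f (add g g')) (add (tensor f g) (tensor f g'))
  | smul_tensor {X Y X' Y' : List ℕ+} (c : k) (f : Diag k X Y) (g : Diag k X' Y') :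
      Rel (tensor (smul c f) g) (smul c (tensor f g))
  | tensor_smul {X Y X' Y' : List ℕ+} (c : k) (f : Diag k X Y) (g : Diag k X' Y') :
      Rel (tensor f (smul c g)) (smul c (tensor f g))
  | tensor_id (X X' : List ℕ+) :
      Rel (tensor (id (rfl : X = X)) (id (rfl : X' = X'))) (id rfl)
  | interchange {X Y Z X' Y' Z' : List ℕ+} {p q : ZMod 2} (f : Diag k X Y) (f' : Diag k Y Z)
      (g : Diag k X' Y') (g' : Diag k Y' Z') : HasParity f p → HasParity g' q →
      Rel (comp (tensor f g) (tensor f' g')) (smul (koszul k q p) (tensor (comp f f') (comp g g')))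
  | tensor_assoc {X Y X' Y' X'' Y'' : List ℕ+} (f : Diag k X Y) (g : Diag k X' Y')
      (h : Diag k X'' Y'') :
      Rel (comp (tensor (tensor f g) h) (id (List.append_assoc Y Y' Y'')))
        (comp (id (List.append_assoc X X' X'')) (tensor f (tensor g h)))
  | nil_tensor {X Y : List ℕ+} (f : Diag k X Y) : Rel (tensor (id (rfl : [] = [])) f) f
  | tensor_nil {X Y : List ℕ+} (f : Diag k X Y) :
      Rel (comp (tensor f (id (rfl : [] = []))) (id (List.append_nil Y)))
        (comp (id (List.append_nil X)) f)

end Diag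

namespace Diag
section parity
variable {k : Type u}

theorem HasParity.congr {X Y : List ℕ+} {f : Diag k X Y} {p q : ZMod 2} (hf : HasParity f p)
    (h : p = q) : HasParity f q := h ▸ hf

theorem hasParity_sumUpTo {X Y : List ℕ+} {f : ℕ → Diag k X Y} {p : ZMod 2}
    (hf : ∀ t, HasParity (f t) p) : ∀ N, HasParity (sumUpTo f N) p
  | 0 => hf 0
  | N + 1 => .add (hasParity_sumUpTo hf N) (hf (N + 1))

theorem hasParity_rungR (r a b a' b' : ℕ) :
    HasParity (rungR r a b a' b' : Diag k _ _) 0 := by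
  unfold rungR
  split_ifs with h
  · exact (HasParity.comp (.tensor (.split ..) (.id _))
      (.comp (.id _) (.tensor (.id _) (.merge ..)))).congr (by decide)
  · exact .zero ..

theorem hasParity_rungL (r a b a' b' : ℕ) :
    HasParity (rungL r a b a' b' : Diag k _ _) 0 := by
  unfold rungL
  split_ifs with h
  · exact (HasParity.comp (.tensor (.id _) (.split ..))
      (.comp (.id _) (.tensor (.merge ..) (.id _)))).congr (by decide)
  · exact .zero ..

theorem hasParity_capAt (a b a' b' : ℕ) :
    HasParity (capAt a b a' b' : Diag k _ _) 1 := by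
  unfold capAt
  split_ifs with h
  · exact (HasParity.comp (.tensor (.split ..) (.split ..))
      (.comp (.id _) (.tensor (.id _) (.tensor .cap (.id _))))).congr (by decide)
  · exact .zero ..

theorem hasParity_cupAt (a b a' b' : ℕ) :
    HasParity (cupAt a b a' b' : Diag k _ _) 1 := by
  unfold cupAt
  split_ifs with h
  · exact (HasParity.comp (.tensor (.id _) (.tensor .cup (.id _)))
      (.comp (.id _) (.tensor (.merge ..) (.merge ..)))).congr (by decide)
  · exact .zero ..

variable [Field k]

theorem hasParity_antenna : HasParity (antenna : Diag k _ _) 1 :=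
  .smul _ ((HasParity.comp (.split ..) .cap).congr (by decide))

theorem hasParity_antR (a b a' : ℕ) : HasParity (antR a b a' : Diag k _ _) 1 := by
  unfold antR
  split_ifs with h
  · exact (HasParity.comp (.tensor (.split ..) (.id _))
      (.comp (.id _) (.tensor (.id _) (.tensor hasParity_antenna (.id _))))).congr (by decide)
  · exact .zero ..

theorem hasParity_antL (a b b' : ℕ) : HasParity (antL a b b' : Diag k _ _) 1 := by
  unfold antL
  split_ifs with h
  · exact (HasParity.comp (.tensor (.id _) (.split ..))
      (.tensor (.id _) (.tensor hasParity_antenna (.id _)))).congr (by decide)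
  · exact .zero ..

/-- The defining relations are homogeneous. -/
theorem DefRel.homogeneous {X Y : List ℕ+} {f g : Diag k X Y} (h : DefRel f g) :
    ∃ p, HasParity f p ∧ HasParity g p := by
  induction h with
  | split_zero_left b c h => exact ⟨0, .split .., .id _⟩
  | split_zero_right a c h => exact ⟨0, .split .., .id _⟩
  | merge_zero_left b c h => exact ⟨0, .merge .., .id _⟩
  | merge_zero_right a c h => exact ⟨0, .merge .., .id _⟩
  | split_assoc a b c =>
    exact ⟨0, (HasParity.comp (.comp (.split ..) (.tensor (.split ..) (.id _))) (.id _)).congr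
      (by decide), (HasParity.comp (.split ..) (.tensor (.id _) (.split ..))).congr (by decide)⟩
  | merge_assoc a b c =>
    exact ⟨0, (HasParity.comp (.tensor (.merge ..) (.id _)) (.merge ..)).congr (by decide),
      (HasParity.comp (.id _) (.comp (.tensor (.id _) (.merge ..)) (.merge ..))).congr
        (by decide)⟩
  | rung_swap a b r s h₁ h₂ =>
    exact ⟨0, (HasParity.comp (hasParity_rungR ..) (hasParity_rungL ..)).congr (by decide),
      hasParity_sumUpTo (fun t => .smul _ ((HasParity.comp (hasParity_rungL ..)
        (hasParity_rungR ..)).congr (by decide))) _⟩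
  | straighten_left =>
    exact ⟨0, (HasParity.comp (.tensor .cup (.id _))
      (.comp (.id _) (.tensor (.id _) .cap))).congr (by decide), .id _⟩
  | straighten_right =>
    exact ⟨0, (HasParity.comp (.tensor (.id _) .cup)
      (.comp (.id _) (.tensor .cap (.id _)))).congr (by decide), .smul _ (.id _)⟩
  | antenna_retraction =>
    exact ⟨1, (HasParity.comp (.merge ..) hasParity_antenna).congr (by decide), .cap⟩
  | cap_rung_right a b r h₁ h₂ =>
    refine ⟨1, (HasParity.comp (hasParity_rungR ..) (hasParity_capAt ..)).congr (by decide),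
      .add ((HasParity.comp (hasParity_capAt ..) (hasParity_rungR ..)).congr (by decide)) ?_⟩
    split_ifs
    · exact .zero ..
    · exact .smul _ ((HasParity.comp (hasParity_antR ..) (hasParity_rungR ..)).congr (by decide))
  | cap_rung_left a b r h₁ h₂ =>
    refine ⟨1, (HasParity.comp (hasParity_rungL ..) (hasParity_capAt ..)).congr (by decide),
      .add ((HasParity.comp (hasParity_capAt ..) (hasParity_rungL ..)).congr (by decide)) ?_⟩
    split_ifs
    · exact .zero ..
    · exact .smul _ ((HasParity.comp (hasParity_antL ..) (hasParity_rungL ..)).congr (by decide))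
  | cup_rung_right a b r h =>
    exact ⟨1, (HasParity.comp (hasParity_cupAt ..) (hasParity_rungR ..)).congr (by decide),
      (HasParity.comp (hasParity_rungR ..) (hasParity_cupAt ..)).congr (by decide)⟩
  | cup_rung_left a b r h =>
    exact ⟨1, (HasParity.comp (hasParity_cupAt ..) (hasParity_rungL ..)).congr (by decide),
      (HasParity.comp (hasParity_rungL ..) (hasParity_cupAt ..)).congr (by decide)⟩

end parity
end Diag

/-- Morphisms of the web supercategory: web expressions modulo the relations. -/
def WebHom (k : Type u) [Field k] (X Y : List ℕ+) : Type u := Quot (@Diag.Rel k _ X Y)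

namespace WebHom
variable {k : Type u} [Field k] {W X Y Z X' Y' Z' X'' Y'' : List ℕ+}

/-- The morphism represented by a web expression. -/
def mk (f : Diag k X Y) : WebHom k X Y := Quot.mk _ f

theorem sound {f g : Diag k X Y} (h : Diag.Rel f g) : mk f = mk g := Quot.sound h

theorem ind {P : WebHom k X Y → Prop} (h : ∀ f, P (mk f)) (f : WebHom k X Y) : P f :=
  Quot.ind h f

instance : Zero (WebHom k X Y) := ⟨mk (.zero X Y)⟩

instance : Add (WebHom k X Y) :=
  ⟨Quot.lift (fun f => Quot.lift (fun g => mk (.add f g))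
      (fun g g' h => (sound (.add_comm f g)).trans
        ((sound (.add_congr f h)).trans (sound (.add_comm g' f)))))
    (fun f f' h => by
      funext g
      induction g using Quot.ind with | _ g => exact sound (.add_congr g h))⟩

instance : SMul k (WebHom k X Y) :=
  ⟨fun c => Quot.lift (fun f => mk (.smul c f)) (fun _ _ h => sound (.smul_congr c h))⟩

instance : Neg (WebHom k X Y) := ⟨fun f => (-1 : k) • f⟩

/-- Vertical composition. -/
def comp : WebHom k X Y → WebHom k Y Z → WebHom k X Z :=
  Quot.lift (fun f => Quot.lift (fun g => mk (.comp f g))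
      (fun _ _ h => sound (.comp_congr_right f h)))
    (fun f f' h => by
      funext g
      induction g using Quot.ind with | _ g => exact sound (.comp_congr_left g h))

/-- Horizontal juxtaposition. -/
def tensor : WebHom k X Y → WebHom k X' Y' → WebHom k (X ++ X') (Y ++ Y') :=
  Quot.lift (fun f => Quot.lift (fun g => mk (.tensor f g))
      (fun _ _ h => sound (.tensor_congr_right f h)))
    (fun f f' h => by
      funext g
      induction g using Quot.ind with | _ g => exact sound (.tensor_congr_left g h))

/-- The identity diagram between two equal sequences of labels. -/
def ofEq (h : X = Y) : WebHom k X Y := mk (.id h)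

theorem mk_zero : mk (.zero X Y : Diag k X Y) = 0 := rfl
theorem mk_add (f g : Diag k X Y) : mk (.add f g) = mk f + mk g := rfl
theorem mk_smul (c : k) (f : Diag k X Y) : mk (.smul c f) = c • mk f := rfl
theorem mk_comp (f : Diag k X Y) (g : Diag k Y Z) : mk (.comp f g) = comp (mk f) (mk g) := rfl
theorem mk_tensor (f : Diag k X Y) (g : Diag k X' Y') :
    mk (.tensor f g) = tensor (mk f) (mk g) := rfl
theorem mk_id (h : X = Y) : mk (.id h : Diag k X Y) = ofEq h := rfl

protected theorem add_assoc (f g h : WebHom k X Y) : f + g + h = f + (g + h) := by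
  induction f using ind; induction g using ind; induction h using ind
  exact sound (.add_assoc ..)
protected theorem add_comm (f g : WebHom k X Y) : f + g = g + f := by
  induction f using ind; induction g using ind
  exact sound (.add_comm ..)
protected theorem zero_add (f : WebHom k X Y) : 0 + f = f := by
  induction f using ind
  exact sound (.zero_add ..)

instance : AddCommGroup (WebHom k X Y) where
  add_assoc := WebHom.add_assoc
  zero_add := WebHom.zero_add
  add_zero f := (WebHom.add_comm f 0).trans (WebHom.zero_add f)
  add_comm := WebHom.add_comm
  neg_add_cancel f := by
    induction f using ind
    exact sound (.neg_add ..)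
  nsmul := nsmulRec
  zsmul := zsmulRec

protected theorem smul_add (c : k) (f g : WebHom k X Y) : c • (f + g) = c • f + c • g := by
  induction f using ind; induction g using ind
  exact sound (.smul_add ..)
protected theorem add_smul (c d : k) (f : WebHom k X Y) : (c + d) • f = c • f + d • f := by
  induction f using ind
  exact sound (.add_smul ..)
protected theorem one_smul (f : WebHom k X Y) : (1 : k) • f = f := by
  induction f using ind
  exact sound (.one_smul ..)
protected theorem mul_smul (c d : k) (f : WebHom k X Y) : (c * d) • f = c • d • f := by
  induction f using ind
  exact sound (.mul_smul ..)

instance : Module k (WebHom k X Y) where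
  one_smul := WebHom.one_smul
  mul_smul := WebHom.mul_smul
  smul_add := WebHom.smul_add
  add_smul := WebHom.add_smul
  smul_zero c := by
    have h := WebHom.smul_add c (0 : WebHom k X Y) 0
    rw [add_zero] at h
    exact left_eq_add.mp h
  zero_smul f := by
    have h := WebHom.add_smul (0 : k) 0 f
    rw [add_zero] at h
    exact left_eq_add.mp h

theorem ofEq_comp (f : WebHom k X Y) : comp (ofEq rfl) f = f := by
  induction f using ind
  exact sound (.id_comp ..)
theorem comp_ofEq (f : WebHom k X Y) : comp f (ofEq rfl) = f := by
  induction f using ind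
  exact sound (.comp_id ..)
theorem comp_assoc (f : WebHom k W X) (g : WebHom k X Y) (h : WebHom k Y Z) :
    comp (comp f g) h = comp f (comp g h) := by
  induction f using ind; induction g using ind; induction h using ind
  exact sound (.comp_assoc ..)
theorem add_comp (f f' : WebHom k X Y) (g : WebHom k Y Z) :
    comp (f + f') g = comp f g + comp f' g := by
  induction f using ind; induction f' using ind; induction g using ind
  exact sound (.add_comp ..)
theorem comp_add (f : WebHom k X Y) (g g' : WebHom k Y Z) :
    comp f (g + g') = comp f g + comp f g' := by
  induction f using ind; induction g using ind; induction g' using ind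
  exact sound (.comp_add ..)
theorem smul_comp (c : k) (f : WebHom k X Y) (g : WebHom k Y Z) :
    comp (c • f) g = c • comp f g := by
  induction f using ind; induction g using ind
  exact sound (.smul_comp ..)
theorem comp_smul (c : k) (f : WebHom k X Y) (g : WebHom k Y Z) :
    comp f (c • g) = c • comp f g := by
  induction f using ind; induction g using ind
  exact sound (.comp_smul ..)
theorem add_tensor (f f' : WebHom k X Y) (g : WebHom k X' Y') :
    tensor (f + f') g = tensor f g + tensor f' g := by
  induction f using ind; induction f' using ind; induction g using ind
  exact sound (.add_tensor ..)
theorem tensor_add (f : WebHom k X Y) (g g' : WebHom k X' Y') :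
    tensor f (g + g') = tensor f g + tensor f g' := by
  induction f using ind; induction g using ind; induction g' using ind
  exact sound (.tensor_add ..)
theorem smul_tensor (c : k) (f : WebHom k X Y) (g : WebHom k X' Y') :
    tensor (c • f) g = c • tensor f g := by
  induction f using ind; induction g using ind
  exact sound (.smul_tensor ..)
theorem tensor_smul (c : k) (f : WebHom k X Y) (g : WebHom k X' Y') :
    tensor f (c • g) = c • tensor f g := by
  induction f using ind; induction g using ind
  exact sound (.tensor_smul ..)
theorem tensor_ofEq (h : X = Y) (h' : X' = Y') :
    tensor (ofEq h : WebHom k X Y) (ofEq h') = ofEq (by rw [h, h']) := by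
  subst h h'
  exact sound (.tensor_id ..)
theorem ofEq_comp_ofEq (h : X = Y) (h' : Y = Z) :
    comp (ofEq h : WebHom k X Y) (ofEq h') = ofEq (h.trans h') := by
  subst h h'
  exact ofEq_comp _
theorem tensor_assoc (f : WebHom k X Y) (g : WebHom k X' Y') (h : WebHom k X'' Y'') :
    comp (tensor (tensor f g) h) (ofEq (List.append_assoc Y Y' Y'')) =
      comp (ofEq (List.append_assoc X X' X'')) (tensor f (tensor g h)) := by
  induction f using ind; induction g using ind; induction h using ind
  exact sound (.tensor_assoc ..)
theorem nil_tensor (f : WebHom k X Y) : tensor (ofEq (rfl : [] = [])) f = f := by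
  induction f using ind
  exact sound (.nil_tensor ..)
theorem tensor_nil (f : WebHom k X Y) :
    comp (tensor f (ofEq (rfl : [] = []))) (ofEq (List.append_nil Y)) =
      comp (ofEq (List.append_nil X)) f := by
  induction f using ind
  exact sound (.tensor_nil ..)

/-- The morphisms of parity `p`: those represented by a homogeneous expression of parity `p`. -/
def part (X Y : List ℕ+) (p : ZMod 2) : Submodule k (WebHom k X Y) where
  carrier := {f | ∃ d : Diag k X Y, Diag.HasParity d p ∧ mk d = f}
  add_mem' := by
    rintro _ _ ⟨d, hd, rfl⟩ ⟨e, he, rfl⟩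
    exact ⟨_, .add hd he, rfl⟩
  zero_mem' := ⟨_, .zero X Y p, rfl⟩
  smul_mem' := by
    rintro c _ ⟨d, hd, rfl⟩
    exact ⟨_, .smul c hd, rfl⟩

theorem comp_mem {p q : ZMod 2} {f : WebHom k X Y} {g : WebHom k Y Z} (hf : f ∈ part X Y p)
    (hg : g ∈ part Y Z q) : comp f g ∈ part X Z (p + q) := by
  obtain ⟨d, hd, rfl⟩ := hf
  obtain ⟨e, he, rfl⟩ := hg
  exact ⟨_, .comp hd he, rfl⟩

theorem tensor_mem {p q : ZMod 2} {f : WebHom k X Y} {g : WebHom k X' Y'} (hf : f ∈ part X Y p)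
    (hg : g ∈ part X' Y' q) : tensor f g ∈ part (X ++ X') (Y ++ Y') (p + q) := by
  obtain ⟨d, hd, rfl⟩ := hf
  obtain ⟨e, he, rfl⟩ := hg
  exact ⟨_, .tensor hd he, rfl⟩

theorem interchange {p q : ZMod 2} {f : WebHom k X Y} (f' : WebHom k Y Z) (g : WebHom k X' Y')
    {g' : WebHom k Y' Z'} (hf : f ∈ part X Y p) (hg' : g' ∈ part Y' Z' q) :
    comp (tensor f g) (tensor f' g') = koszul k q p • tensor (comp f f') (comp g g') := by
  obtain ⟨d, hd, rfl⟩ := hf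
  obtain ⟨e, he, rfl⟩ := hg'
  induction f' using ind; induction g using ind
  exact sound (.interchange _ _ _ _ hd he)

theorem ofEq_mem (h : X = Y) : (ofEq h : WebHom k X Y) ∈ part X Y 0 := ⟨_, .id h, rfl⟩

/-- The parity involution, negating caps and cups, on expressions. -/
def inv : {X Y : List ℕ+} → Diag k X Y → WebHom k X Y
  | _, _, .zero _ _ => 0
  | _, _, .add f g => inv f + inv g
  | _, _, .smul c f => c • inv f
  | _, _, .id h => ofEq h
  | _, _, .comp f g => comp (inv f) (inv g)
  | _, _, .tensor f g => tensor (inv f) (inv g)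
  | _, _, .split a b c h => mk (.split a b c h)
  | _, _, .merge a b c h => mk (.merge a b c h)
  | _, _, .cap => -mk .cap
  | _, _, .cup => -mk .cup

theorem inv_eq {X Y : List ℕ+} {f : Diag k X Y} {p : ZMod 2} (h : Diag.HasParity f p) :
    inv f = koszul k 1 p • mk f := by
  induction h with
  | zero X Y p => simp [inv, mk_zero]
  | add _ _ h₁ h₂ => simp [inv, h₁, h₂, mk_add]
  | smul c _ h => simp [inv, h, mk_smul, smul_comm c]
  | id h => simp [inv, mk_id]
  | comp _ _ h₁ h₂ =>
    rw [inv, h₁, h₂, mk_comp, smul_comp, comp_smul, koszul_add_right, mul_smul]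
  | tensor _ _ h₁ h₂ =>
    rw [inv, h₁, h₂, mk_tensor, smul_tensor, tensor_smul, koszul_add_right, mul_smul]
  | split a b c h => simp [inv]
  | merge a b c h => simp [inv]
  | cap => simp [inv]
  | cup => simp [inv]

theorem inv_mem {X Y : List ℕ+} {f : Diag k X Y} {p : ZMod 2} (h : Diag.HasParity f p) :
    inv f ∈ part X Y p := by
  rw [inv_eq h]
  exact Submodule.smul_mem _ _ ⟨f, h, rfl⟩

theorem inv_sound {X Y : List ℕ+} {f g : Diag k X Y} (h : Diag.Rel f g) : inv f = inv g := by
  induction h with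
  | of h =>
    obtain ⟨p, hf, hg⟩ := h.homogeneous
    rw [inv_eq hf, inv_eq hg, sound (.of h)]
  | add_congr g _ ih => simp only [inv, ih]
  | smul_congr c _ ih => simp only [inv, ih]
  | comp_congr_left g _ ih => simp only [inv, ih]
  | comp_congr_right f _ ih => simp only [inv, ih]
  | tensor_congr_left g _ ih => simp only [inv, ih]
  | tensor_congr_right f _ ih => simp only [inv, ih]
  | add_assoc => simp only [inv, add_assoc]
  | add_comm => simp only [inv, add_comm]
  | zero_add => simp only [inv, zero_add]
  | neg_add => simp [inv]
  | one_smul => simp only [inv, one_smul]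
  | mul_smul => simp only [inv, mul_smul]
  | smul_add => simp only [inv, smul_add]
  | add_smul => simp only [inv, add_smul]
  | id_comp => simp only [inv, ofEq_comp]
  | comp_id => simp only [inv, comp_ofEq]
  | comp_assoc => simp only [inv, comp_assoc]
  | add_comp => simp only [inv, add_comp]
  | comp_add => simp only [inv, comp_add]
  | smul_comp => simp only [inv, smul_comp]
  | comp_smul => simp only [inv, comp_smul]
  | add_tensor => simp only [inv, add_tensor]
  | tensor_add => simp only [inv, tensor_add]
  | smul_tensor => simp only [inv, smul_tensor]
  | tensor_smul => simp only [inv, tensor_smul]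
  | tensor_id => simp only [inv, tensor_ofEq]
  | interchange f f' g g' hf hg' =>
    have e₁ := inv_mem hf
    have e₂ := inv_mem hg'
    simp only [inv, WebHom.interchange _ _ e₁ e₂]
  | tensor_assoc => simp only [inv, tensor_assoc]
  | nil_tensor => simp only [inv, nil_tensor]
  | tensor_nil => simp only [inv, tensor_nil]

/-- The parity involution on morphisms. -/
def involution : WebHom k X Y → WebHom k X Y := Quot.lift inv fun _ _ => inv_sound

theorem involution_eq {p : ZMod 2} {f : WebHom k X Y} (hf : f ∈ part X Y p) :
    involution f = koszul k 1 p • f := by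
  obtain ⟨d, hd, rfl⟩ := hf
  exact inv_eq hd

theorem exists_homogeneous {X Y : List ℕ+} (f : Diag k X Y) :
    ∃ f₀ ∈ part (k := k) X Y 0, ∃ f₁ ∈ part (k := k) X Y 1, f₀ + f₁ = mk f := by
  induction f with
  | zero X Y => exact ⟨0, zero_mem _, 0, zero_mem _, add_zero _⟩
  | add f g hf hg =>
    obtain ⟨f₀, h₀, f₁, h₁, e⟩ := hf
    obtain ⟨g₀, h₀', g₁, h₁', e'⟩ := hg
    exact ⟨_, add_mem h₀ h₀', _, add_mem h₁ h₁', by rw [mk_add, ← e, ← e']; abel⟩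
  | smul c f hf =>
    obtain ⟨f₀, h₀, f₁, h₁, e⟩ := hf
    exact ⟨_, Submodule.smul_mem _ c h₀, _, Submodule.smul_mem _ c h₁,
      by rw [mk_smul, ← e, smul_add]⟩
  | id h => exact ⟨_, ofEq_mem h, 0, zero_mem _, add_zero _⟩
  | comp f g hf hg =>
    obtain ⟨f₀, h₀, f₁, h₁, e⟩ := hf
    obtain ⟨g₀, h₀', g₁, h₁', e'⟩ := hg
    refine ⟨comp f₀ g₀ + comp f₁ g₁, add_mem (comp_mem h₀ h₀') ?_, comp f₀ g₁ + comp f₁ g₀,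
      add_mem (comp_mem h₀ h₁') (comp_mem h₁ h₀'), ?_⟩
    · have := comp_mem h₁ h₁'
      rwa [zmod2_one_add_one] at this
    · rw [mk_comp, ← e, ← e', add_comp, comp_add, comp_add]; abel
  | tensor f g hf hg =>
    obtain ⟨f₀, h₀, f₁, h₁, e⟩ := hf
    obtain ⟨g₀, h₀', g₁, h₁', e'⟩ := hg
    refine ⟨tensor f₀ g₀ + tensor f₁ g₁, add_mem (tensor_mem h₀ h₀') ?_,
      tensor f₀ g₁ + tensor f₁ g₀, add_mem (tensor_mem h₀ h₁') (tensor_mem h₁ h₀'), ?_⟩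
    · have := tensor_mem h₁ h₁'
      rwa [zmod2_one_add_one] at this
    · rw [mk_tensor, ← e, ← e', add_tensor, tensor_add, tensor_add]; abel
  | split a b c h =>
    exact ⟨mk (.split a b c h), ⟨_, .split a b c h, rfl⟩, 0, zero_mem _, add_zero _⟩
  | merge a b c h =>
    exact ⟨mk (.merge a b c h), ⟨_, .merge a b c h, rfl⟩, 0, zero_mem _, add_zero _⟩
  | cap => exact ⟨0, zero_mem _, mk .cap, ⟨_, .cap, rfl⟩, zero_add _⟩
  | cup => exact ⟨0, zero_mem _, mk .cup, ⟨_, .cup, rfl⟩, zero_add _⟩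

theorem isCompl [NeZero (2 : k)] (X Y : List ℕ+) :
    IsCompl (part (k := k) X Y 0) (part X Y 1) := by
  constructor
  · rw [Submodule.disjoint_def]
    intro f h₀ h₁
    have h := (involution_eq h₀).symm.trans (involution_eq h₁)
    simp only [koszul_zero_right, one_smul, koszul_one_one, neg_smul] at h
    have h2 : (2 : k) • f = 0 := by
      rw [two_smul]; nth_rewrite 1 [h]; exact neg_add_cancel f
    exact (smul_eq_zero.mp h2).resolve_left two_ne_zero
  · rw [codisjoint_iff, Submodule.eq_top_iff']
    intro f
    induction f using ind with | _ f => 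
    obtain ⟨f₀, h₀, f₁, h₁, e⟩ := exists_homogeneous f
    exact Submodule.mem_sup.mpr ⟨f₀, h₀, f₁, h₁, e⟩

end WebHom

/-- The objects of the web supercategory: finite sequences of positive integers. -/
@[ext]
structure PWeb (k : Type u) where
  labels : List ℕ+

namespace PWeb
variable (k : Type u) [Field k]

instance : Category (PWeb k) where
  Hom X Y := WebHom k X.labels Y.labels
  id _ := WebHom.ofEq rfl
  comp f g := WebHom.comp f g
  id_comp := WebHom.ofEq_comp
  comp_id := WebHom.comp_ofEq
  assoc := WebHom.comp_assoc

instance : Preadditive (PWeb k) where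
  homGroup X Y := inferInstanceAs (AddCommGroup (WebHom k X.labels Y.labels))
  add_comp _ _ _ := WebHom.add_comp
  comp_add _ _ _ := WebHom.comp_add

instance : Linear k (PWeb k) where
  homModule X Y := inferInstanceAs (Module k (WebHom k X.labels Y.labels))
  smul_comp _ _ _ := WebHom.smul_comp
  comp_smul _ _ _ := fun f c g => WebHom.comp_smul c f g

variable [NeZero (2 : k)]

instance : Supercategory k (PWeb k) where
  homPart X Y p := WebHom.part X.labels Y.labels p
  isCompl X Y := WebHom.isCompl X.labels Y.labels
  id_mem _ := WebHom.ofEq_mem rfl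
  comp_mem := WebHom.comp_mem

/-- The identity diagram between two equal sequences of labels, as an isomorphism. -/
def isoOfEq {X Y : PWeb k} (h : X.labels = Y.labels) : X ≅ Y where
  hom := WebHom.ofEq h
  inv := WebHom.ofEq h.symm
  hom_inv_id := WebHom.ofEq_comp_ofEq ..
  inv_hom_id := WebHom.ofEq_comp_ofEq ..

/-- The monoidal structure is concatenation on objects and juxtaposition on morphisms. -/
instance : MonoidalSupercategory k (PWeb k) where
  tensorObj X Y := ⟨X.labels ++ Y.labels⟩
  tensorHom f g := WebHom.tensor f g
  add_tensor := WebHom.add_tensor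
  tensor_add := WebHom.tensor_add
  smul_tensor := WebHom.smul_tensor
  tensor_smul := WebHom.tensor_smul
  tensor_mem := WebHom.tensor_mem
  tensor_id _ _ := WebHom.tensor_ofEq rfl rfl
  interchange _ f' g _ hf hg' := WebHom.interchange f' g hf hg'
  unit := ⟨[]⟩
  assoc X Y Z := isoOfEq k (List.append_assoc X.labels Y.labels Z.labels)
  leftUnitor X := isoOfEq k (List.nil_append X.labels)
  rightUnitor X := isoOfEq k (List.append_nil X.labels)
  assoc_mem _ _ _ := WebHom.ofEq_mem _
  leftUnitor_mem _ := WebHom.ofEq_mem _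
  rightUnitor_mem _ := WebHom.ofEq_mem _
  assoc_naturality := WebHom.tensor_assoc
  leftUnitor_naturality {X Y} f := by
    change WebHom.comp (WebHom.tensor (WebHom.ofEq (rfl : ([] : List ℕ+) = [])) f)
      (WebHom.ofEq (rfl : Y.labels = Y.labels)) =
      WebHom.comp (WebHom.ofEq (rfl : X.labels = X.labels)) f
    rw [WebHom.comp_ofEq, WebHom.ofEq_comp]
    exact WebHom.nil_tensor f
  rightUnitor_naturality := WebHom.tensor_nil
  pentagon W X Y Z := by
    change WebHom.comp (WebHom.tensor (WebHom.ofEq _) (WebHom.ofEq _))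
      (WebHom.comp (WebHom.ofEq _) (WebHom.tensor (WebHom.ofEq _) (WebHom.ofEq _))) =
      WebHom.comp (WebHom.ofEq _) (WebHom.ofEq _)
    simp only [WebHom.tensor_ofEq, WebHom.ofEq_comp_ofEq]
  triangle X Y := by
    change WebHom.comp (WebHom.ofEq _) (WebHom.tensor (WebHom.ofEq _) (WebHom.ofEq _)) =
      WebHom.tensor (WebHom.ofEq _) (WebHom.ofEq _)
    simp only [WebHom.tensor_ofEq, WebHom.ofEq_comp_ofEq]

/-- The object `a`, with the convention that `0` is the unit object. -/
def strand (a : ℕ) : PWeb k := ⟨st a⟩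

/-- The split `a + b → (a, b)`. -/
def split (a b : ℕ) : strand k (a + b) ⟶ tensorObj k (strand k a) (strand k b) :=
  WebHom.mk (.split a b (a + b) rfl)

/-- The merge `(a, b) → a + b`. -/
def merge (a b : ℕ) : tensorObj k (strand k a) (strand k b) ⟶ strand k (a + b) :=
  WebHom.mk (.merge a b (a + b) rfl)

/-- The cap `(1, 1) → ∅`. -/
def cap : tensorObj k (strand k 1) (strand k 1) ⟶ unit k := WebHom.mk .cap

/-- The cup `∅ → (1, 1)`. -/
def cup : unit k ⟶ tensorObj k (strand k 1) (strand k 1) := WebHom.mk .cup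

end PWeb

theorem isCompl_of_involution {k : Type*} [Field k] [NeZero (2 : k)] {M : Type*} [AddCommGroup M]
    [Module k M] {P₀ P₁ : Submodule k M} (σ : M →ₗ[k] M) (h₀ : ∀ m ∈ P₀, σ m = m)
    (h₁ : ∀ m ∈ P₁, σ m = -m) (h : ∀ m, ∃ m₀ ∈ P₀, ∃ m₁ ∈ P₁, m₀ + m₁ = m) : IsCompl P₀ P₁ := by
  constructor
  · rw [Submodule.disjoint_def]
    intro m hm₀ hm₁
    have e : m = -m := (h₀ m hm₀).symm.trans (h₁ m hm₁)
    have e' : (2 : k) • m = 0 := by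
      rw [two_smul]; nth_rewrite 1 [e]; exact neg_add_cancel m
    exact (smul_eq_zero.mp e').resolve_left two_ne_zero
  · rw [codisjoint_iff, Submodule.eq_top_iff']
    intro m
    exact Submodule.mem_sup.mpr (h m)

noncomputable section

/-! ## The Lie superalgebra of type P -/

/-- The index set `{1, …, n, -1, …, -n}`; the left summand consists of the positive indices. -/
abbrev Idx (n : ℕ) : Type := Fin n ⊕ Fin n

/-- Positive indices are even, negative ones are odd. -/
def Idx.parity {n : ℕ} : Idx n → ZMod 2 := Sum.elim (fun _ => 0) (fun _ => 1)

section typeP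
variable (k : Type u) [Field k] (n : ℕ)

/-- The superspace `V` with basis `v_i`, `i ∈ Idx n`; the vector `v_i` is `Pi.single i 1`. -/
abbrev V : Type u := Idx n → k

/-- The vectors of parity `p`. -/
def vPart (p : ZMod 2) : Submodule k (V k n) where
  carrier := {v | ∀ i, i.parity ≠ p → v i = 0}
  add_mem' hv hw i hi := by simp [hv i hi, hw i hi]
  zero_mem' _ _ := rfl
  smul_mem' c v hv i hi := by simp [hv i hi]

/-- The odd bilinear form `(v_i, v_j) = δ_{i,-j}`. -/
def form : V k n →ₗ[k] V k n →ₗ[k] k :=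
  LinearMap.mk₂ k (fun v w => ∑ i, v i * w i.swap)
    (fun _ _ _ => by simp [add_mul, Finset.sum_add_distrib])
    (fun _ _ _ => by simp only [Pi.smul_apply, smul_eq_mul, mul_assoc, Finset.mul_sum])
    (fun _ _ _ => by simp [mul_add, Finset.sum_add_distrib])
    (fun _ _ _ => by simp only [Pi.smul_apply, smul_eq_mul, mul_left_comm, Finset.mul_sum])

/-- The part of parity `p` of `𝔭(n)`: the endomorphisms `f` of `V` of parity `p` with
`(f v, w) + (-1)^{|f||v|} (v, f w) = 0` for homogeneous `v` and all `w`. -/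
def pn (p : ZMod 2) : Submodule k (Module.End k (V k n)) where
  carrier := {f | ∀ s, ∀ v ∈ vPart k n s, f v ∈ vPart k n (p + s) ∧
    ∀ w, form k n (f v) w + koszul k p s • form k n v (f w) = 0}
  add_mem' := by
    intro f g hf hg s v hv
    refine ⟨add_mem (hf s v hv).1 (hg s v hv).1, fun w => ?_⟩
    have h₁ := (hf s v hv).2 w
    have h₂ := (hg s v hv).2 w
    simp only [LinearMap.add_apply, map_add, smul_eq_mul] at *
    linear_combination h₁ + h₂
  zero_mem' := by
    intro s v _
    exact ⟨zero_mem _, fun w => by simp⟩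
  smul_mem' := by
    intro c f hf s v hv
    refine ⟨Submodule.smul_mem _ _ (hf s v hv).1, fun w => ?_⟩
    have h₁ := (hf s v hv).2 w
    simp only [LinearMap.smul_apply, map_smul, smul_eq_mul] at *
    linear_combination c * h₁

variable {k n}

/-- The superbracket `[x, y] = x y - (-1)^{|x||y|} y x` of `𝔭(n)`. -/
def bracket {p q : ZMod 2} (x : pn k n p) (y : pn k n q) : pn k n (p + q) :=
  ⟨x.1 * y.1 - koszul k p q • (y.1 * x.1), by
    intro s v hv
    have hx := x.2 s v hv
    have hy := y.2 s v hv
    refine ⟨?_, fun w => ?_⟩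
    · have h₁ := (x.2 _ _ hy.1).1
      have h₂ := (y.2 _ _ hx.1).1
      rw [← add_assoc] at h₁ h₂
      rw [add_comm q p] at h₂
      exact sub_mem h₁ (Submodule.smul_mem _ _ h₂)
    · have h₁ := (x.2 _ _ hy.1).2 w
      have h₂ := (y.2 _ _ hx.1).2 w
      have h₃ := hx.2 (y.1 w)
      have h₄ := hy.2 (x.1 w)
      simp only [LinearMap.sub_apply, LinearMap.smul_apply, Module.End.mul_apply, map_sub,
        map_smul, smul_eq_mul, koszul_add_right, koszul_add_left, koszul_comm k q p] at *
      have e := koszul_mul_self k p q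
      linear_combination h₁ - koszul k p q * h₂ + koszul k q s * h₃
        - koszul k p q * koszul k p s * h₄ + koszul k q s * form k n (x.1 v) (y.1 w) * e⟩

end typeP

/-! ## The symmetric superalgebra `S(V)` -/

section symmetric
variable (k : Type u) [Field k] (n : ℕ)

/-- Supercommutativity of homogeneous vectors. -/
inductive SymRel : TensorAlgebra k (V k n) → TensorAlgebra k (V k n) → Prop
  | comm {s t : ZMod 2} {v w : V k n} (hv : v ∈ vPart k n s) (hw : w ∈ vPart k n t) :
      SymRel (TensorAlgebra.ι k v * TensorAlgebra.ι k w)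
        (koszul k s t • (TensorAlgebra.ι k w * TensorAlgebra.ι k v))

/-- The symmetric superalgebra: the tensor algebra of `V` modulo `v w = (-1)^{|v||w|} w v`. -/
def S : Type u := RingQuot (SymRel k n)

instance : Ring (S k n) := inferInstanceAs (Ring (RingQuot (SymRel k n)))

instance : Algebra k (S k n) :=
  inferInstanceAs (Algebra k (RingQuot (SymRel k n)))

namespace S

/-- The projection from the tensor algebra. -/
def proj : TensorAlgebra k (V k n) →ₐ[k] S k n :=
  RingQuot.mkAlgHom k (SymRel k n)

/-- The inclusion of `V` in `S(V)`. -/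
def ι : V k n →ₗ[k] S k n := (proj k n).toLinearMap ∘ₗ TensorAlgebra.ι k

variable {k n}

theorem ι_mul_ι {s t : ZMod 2} {v w : V k n} (hv : v ∈ vPart k n s) (hw : w ∈ vPart k n t) :
    ι k n v * ι k n w = koszul k s t • (ι k n w * ι k n v) := by
  have : proj k n _ = proj k n _ := RingQuot.mkAlgHom_rel k (SymRel.comm hv hw)
  rwa [map_mul, map_smul, map_mul] at this

/-- The universal property of the symmetric superalgebra. -/
def lift {A : Type*} [Ring A] [Algebra k A] (f : V k n →ₗ[k] A)
    (hf : ∀ s t v w, v ∈ vPart k n s → w ∈ vPart k n t → f v * f w = koszul k s t • (f w * f v)) :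
    S k n →ₐ[k] A :=
  RingQuot.liftAlgHom k ⟨TensorAlgebra.lift k f, by
    rintro _ _ ⟨hv, hw⟩
    simpa using hf _ _ _ _ hv hw⟩

@[simp] theorem lift_ι {A : Type*} [Ring A] [Algebra k A] (f : V k n →ₗ[k] A) (hf) (v : V k n) :
    lift f hf (ι k n v) = f v := by
  refine (RingQuot.liftAlgHom_mkAlgHom_apply ..).trans ?_
  simp

theorem induction {P : S k n → Prop} (algebraMap : ∀ c, P (algebraMap k _ c))
    (ι : ∀ v, P (ι k n v)) (mul : ∀ a b, P a → P b → P (a * b))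
    (add : ∀ a b, P a → P b → P (a + b)) (a : S k n) : P a := by
  obtain ⟨a, rfl⟩ : ∃ b, proj k n b = a := RingQuot.mkAlgHom_surjective k (SymRel k n) a
  induction a using TensorAlgebra.induction with
  | algebraMap c => simpa using algebraMap c
  | ι v => exact ι v
  | mul a b ha hb => simpa using mul _ _ ha hb
  | add a b ha hb => simpa using add _ _ ha hb

theorem hom_ext {A : Type*} [Ring A] [Algebra k A] {f g : S k n →ₐ[k] A}
    (h : ∀ v, f (ι k n v) = g (ι k n v)) : f = g := by
  refine AlgHom.ext fun a => ?_
  induction a using S.induction with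
  | algebraMap c => simp
  | ι v => exact h v
  | mul a b ha hb => rw [map_mul, map_mul, ha, hb]
  | add a b ha hb => rw [map_add, map_add, ha, hb]

variable (k n)

/-- The linear map `v ↦ (-1)^{p|v|} v` of `V`. -/
def vTwist (p : ZMod 2) : V k n →ₗ[k] V k n :=
  LinearMap.pi fun i => koszul k p i.parity • LinearMap.proj i

variable {k n}

theorem vTwist_of_mem {p s : ZMod 2} {v : V k n} (hv : v ∈ vPart k n s) :
    vTwist k n p v = koszul k p s • v := by
  ext i
  by_cases h : i.parity = s
  · simp [vTwist, h]
  · simp [vTwist, hv i h]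

theorem vSplit (v : V k n) : ∃ v₀ ∈ vPart k n 0, ∃ v₁ ∈ vPart k n 1, v₀ + v₁ = v := by
  refine ⟨fun i => if i.parity = 0 then v i else 0, fun i hi => if_neg hi,
    fun i => if i.parity = 0 then 0 else v i, fun i hi => ?_, ?_⟩
  · rcases zmod2_cases i.parity with h | h
    · simp [h]
    · exact absurd h hi
  · ext i
    by_cases h : i.parity = 0 <;> simp [h]

variable (k n)

/-- The algebra automorphism `a ↦ (-1)^{p|a|} a` of `S(V)`. -/
def twist (p : ZMod 2) : S k n →ₐ[k] S k n :=
  lift (ι k n ∘ₗ vTwist k n p) (by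
    intro s t v w hv hw
    simp only [LinearMap.comp_apply, vTwist_of_mem hv, vTwist_of_mem hw, map_smul,
      smul_mul_smul_comm, ι_mul_ι hv hw, smul_smul]
    congr 1
    ring)

variable {k n}

theorem twist_ι {p s : ZMod 2} {v : V k n} (hv : v ∈ vPart k n s) :
    twist k n p (ι k n v) = koszul k p s • ι k n v := by
  simp [twist, vTwist_of_mem hv]

theorem twist_zero (a : S k n) : twist k n 0 a = a := by
  have : twist k n 0 = AlgHom.id k _ := hom_ext fun v => by
    obtain ⟨v₀, h₀, v₁, h₁, rfl⟩ := vSplit v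
    simp [twist_ι h₀, twist_ι h₁]
  simp [this]

theorem twist_twist (p : ZMod 2) (a : S k n) : twist k n p (twist k n p a) = a := by
  have : (twist k n p).comp (twist k n p) = AlgHom.id k _ := hom_ext fun v => by
    obtain ⟨v₀, h₀, v₁, h₁, rfl⟩ := vSplit v
    simp [twist_ι h₀, twist_ι h₁, smul_smul, koszul_mul_self]
  exact DFunLike.congr_fun this a

variable (k n)

/-- The elements of parity `p` of `S(V)`: those with `twist 1 a = (-1)^p a`, where `twist 1` is the
algebra automorphism with `v ↦ (-1)^{|v|} v`. -/
def part (p : ZMod 2) : Submodule k (S k n) where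
  carrier := {a | twist k n 1 a = koszul k 1 p • a}
  add_mem' ha hb := by simp_all
  zero_mem' := by simp
  smul_mem' c a ha := by simp_all [smul_comm c]

variable {k n}

theorem mem_part {p : ZMod 2} {a : S k n} : a ∈ part k n p ↔ twist k n 1 a = koszul k 1 p • a :=
  Iff.rfl

theorem twist_of_mem {p s : ZMod 2} {a : S k n} (ha : a ∈ part k n s) :
    twist k n p a = koszul k p s • a := by
  rcases zmod2_cases p with rfl | rfl
  · simp [twist_zero]
  · exact ha

theorem ι_mem_part {s : ZMod 2} {v : V k n} (hv : v ∈ vPart k n s) : ι k n v ∈ part k n s :=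
  twist_ι hv

instance : SetLike.GradedMonoid (part k n) where
  one_mem := by simp [mem_part]
  mul_mem p q a b ha hb := by
    rw [mem_part] at *
    rw [map_mul, ha, hb, smul_mul_smul_comm, koszul_add_right]

theorem exists_homogeneous [NeZero (2 : k)] (W : Submodule k (S k n))
    (hW : ∀ a ∈ W, twist k n 1 a ∈ W) (a : S k n) (ha : a ∈ W) :
    ∃ a₀ ∈ W ⊓ part k n 0, ∃ a₁ ∈ W ⊓ part k n 1, a₀ + a₁ = a := by
  have h2 : (2 : k) ≠ 0 := two_ne_zero
  refine ⟨(2 : k)⁻¹ • (a + twist k n 1 a), ⟨W.smul_mem _ (W.add_mem ha (hW a ha)), ?_⟩,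
    (2 : k)⁻¹ • (a - twist k n 1 a), ⟨W.smul_mem _ (W.sub_mem ha (hW a ha)), ?_⟩, ?_⟩
  · simp [mem_part, twist_twist, add_comm]
  · change _ ∈ part k n 1
    rw [mem_part, map_smul, map_sub, twist_twist, koszul_one_one]
    module
  · rw [← smul_add, show a + twist k n 1 a + (a - twist k n 1 a) = (2 : k) • a by module,
      smul_smul, inv_mul_cancel₀ h2, one_smul]

theorem isCompl_part [NeZero (2 : k)] : IsCompl (part k n 0) (part k n 1) := by
  refine isCompl_of_involution (twist k n 1).toLinearMap (fun a ha => ?_) (fun a ha => ?_)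
    fun a => ?_
  · simpa using mem_part.mp ha
  · simpa using mem_part.mp ha
  · obtain ⟨a₀, h₀, a₁, h₁, e⟩ := exists_homogeneous ⊤ (fun _ _ => trivial) a trivial
    exact ⟨a₀, h₀.2, a₁, h₁.2, e⟩

instance [NeZero (2 : k)] : DirectSum.Decomposition (part k n) :=
  ((DirectSum.isInternal_submodule_iff_isCompl (part k n) zero_ne_one (by
    ext p; simpa using zmod2_cases p)).mpr isCompl_part).chooseDecomposition

instance [NeZero (2 : k)] : GradedAlgebra (part k n) where

/-- The coproduct of `S(V)`, the algebra homomorphism to the super tensor product with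
`v ↦ v ⊗ 1 + 1 ⊗ v`. -/
def comulHom [NeZero (2 : k)] :
    S k n →ₐ[k] GradedTensorProduct k (part k n) (part k n) :=
  lift ((GradedTensorProduct.includeLeft (part k n) (part k n)).toLinearMap ∘ₗ ι k n +
      (GradedTensorProduct.includeRight (part k n) (part k n)).toLinearMap ∘ₗ ι k n) (by
    intro s t v w hv hw
    have hv' := ι_mem_part hv
    have hw' := ι_mem_part hw
    simp only [LinearMap.add_apply, LinearMap.comp_apply, AlgHom.toLinearMap_apply, mul_add,
      add_mul, smul_add, ← map_mul, ι_mul_ι hv hw, map_smul]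
    have e₁ : ∀ a b : S k n,
        GradedTensorProduct.includeLeft (part k n) (part k n) a *
          GradedTensorProduct.includeRight (part k n) (part k n) b =
        GradedTensorProduct.tmul k a b := fun a b =>
      GradedTensorProduct.tmul_one_mul_one_tmul (part k n) (part k n) a b
    have e₂ : ∀ (s t : ZMod 2) (a b : S k n), a ∈ part k n s → b ∈ part k n t →
        GradedTensorProduct.includeRight (part k n) (part k n) b *
          GradedTensorProduct.includeLeft (part k n) (part k n) a =
        koszul k t s • GradedTensorProduct.tmul k a b := fun s t a b ha hb => by
      have := GradedTensorProduct.tmul_coe_mul_coe_tmul (part k n) (part k n) 1 ⟨b, hb⟩ ⟨a, ha⟩ 1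
      rw [one_mul, mul_one] at this
      refine this.trans ?_
      rcases zmod2_cases s with rfl | rfl <;> rcases zmod2_cases t with rfl | rfl <;> simp
    rw [e₁, e₁, e₂ _ _ _ _ hw' hv', e₂ _ _ _ _ hv' hw', smul_smul, koszul_comm k t s,
      koszul_mul_self, one_smul]
    abel)

/-- The coproduct of `S(V)` as a linear map. -/
def comul [NeZero (2 : k)] : S k n →ₗ[k] S k n ⊗[k] S k n :=
  (GradedTensorProduct.of k (part k n) (part k n)).symm.toLinearMap ∘ₗ comulHom.toLinearMap

/-- The counit of `S(V)`, the algebra homomorphism with `v ↦ 0`. -/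
def counit : S k n →ₐ[k] k := lift 0 (by simp)

variable (k n)

/-- The `d`-th symmetric power inside `S(V)`: the span of the products of `d` vectors. -/
def deg (d : ℕ) : Submodule k (S k n) := LinearMap.range (ι k n) ^ d

instance : SetLike.GradedMonoid (deg k n) :=
  Submodule.nat_power_gradedMonoid (LinearMap.range (ι k n))

/-- The inclusion of `V` in degree one. -/
def ιDeg : V k n →ₗ[k] deg k n 1 :=
  (ι k n).codRestrict _ fun v => by
    simpa only [deg, pow_one] using LinearMap.mem_range_self (ι k n) v

theorem of_deg_eq {i j : ℕ} (h : i = j) {a b : S k n} (ha : a ∈ deg k n i) (hb : b ∈ deg k n j)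
    (e : a = b) : DirectSum.of (fun i => deg k n i) i ⟨a, ha⟩ = DirectSum.of _ j ⟨b, hb⟩ := by
  subst h e; rfl

/-- The inclusion of `V` in the direct sum of the homogeneous parts of `S(V)`. -/
def gradeι : V k n →ₗ[k] DirectSum ℕ fun d => deg k n d :=
  DirectSum.lof k ℕ (fun d => deg k n d) 1 ∘ₗ ιDeg k n

theorem gradeι_apply (v : V k n) :
    gradeι k n v = DirectSum.of (fun d => deg k n d) 1 (ιDeg k n v) := rfl

/-- The decomposition of `S(V)` by degree, as an algebra homomorphism. -/
def gradeHom : S k n →ₐ[k] DirectSum ℕ fun d => deg k n d :=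
  lift (k := k) (n := n) (A := DirectSum ℕ fun d => deg k n d) (gradeι k n) (by
    intro s t v w hv hw
    rw [gradeι_apply, gradeι_apply, DirectSum.of_mul_of, DirectSum.of_mul_of, ← DirectSum.lof_eq_of k, ← DirectSum.lof_eq_of k,
      ← map_smul]
    congr 1
    exact Subtype.ext (ι_mul_ι hv hw))

theorem gradeHom_eq (d : ℕ) (x : deg k n d) :
    gradeHom k n x = DirectSum.of (fun d => deg k n d) d x := by
  obtain ⟨x, hx⟩ := x
  dsimp only [Subtype.coe_mk]
  unfold deg at hx
  induction hx using Submodule.pow_induction_on_left' with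
  | algebraMap c => rw [(gradeHom k n).commutes c]; rfl
  | add _ _ _ _ _ ihx ihy => rw [map_add, ihx, ihy, ← map_add]; rfl
  | mem_mul _ hm _ _ _ ih =>
    obtain ⟨v, rfl⟩ := hm
    rw [map_mul, ih, gradeHom, lift_ι, gradeι_apply,
      DirectSum.of_mul_of]
    exact of_deg_eq k n (add_comm _ _) _ _ rfl

instance : GradedAlgebra (deg k n) :=
  GradedAlgebra.ofAlgHom _ (gradeHom k n)
    (hom_ext fun v => by
      rw [AlgHom.comp_apply, gradeHom, lift_ι, gradeι_apply,
        DirectSum.coeAlgHom_of]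
      rfl)
    (gradeHom_eq k n)

/-- The projection of `S(V)` onto its part of degree `d`. -/
def projDeg (d : ℕ) : S k n →ₗ[k] deg k n d :=
  DirectSum.component k ℕ (fun d => deg k n d) d ∘ₗ
    (DirectSum.decomposeLinearEquiv (deg k n)).toLinearMap

/-! ### The action of `𝔭(n)` by superderivations -/

variable {k n}

/-- The algebra homomorphism `a ↦ [(-1)^{p|a|} a, x.a; 0, a]` to two-by-two matrices. -/
def derHom {p : ZMod 2} (x : pn k n p) :
    S k n →ₐ[k] Matrix (Fin 2) (Fin 2) (S k n) :=
  lift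
    { toFun := fun v => !![ι k n (vTwist k n p v), ι k n (x.1 v); 0, ι k n v]
      map_add' := fun v w => by
        ext i j; fin_cases i <;> fin_cases j <;> simp
      map_smul' := fun c v => by
        ext i j; fin_cases i <;> fin_cases j <;> simp }
    (by
      intro s t v w hv hw
      have h₁ := ι_mul_ι (x.2 _ _ hv).1 hw
      have h₂ := ι_mul_ι hv (x.2 _ _ hw).1
      have h₃ := ι_mul_ι hv hw
      have e₁ := koszul_mul_self k p t
      have e₂ := koszul_mul_self k s t
      rw [koszul_add_left] at h₁
      rw [koszul_add_right, koszul_comm k s p] at h₂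
      ext i j
      fin_cases i <;> fin_cases j
      · simp [vTwist_of_mem hv, vTwist_of_mem hw, h₃, smul_smul]
        congr 1; ring
      · simp [vTwist_of_mem hv, vTwist_of_mem hw, Matrix.mul_apply, h₁, h₂, smul_smul]
        rw [← mul_assoc, koszul_mul_self, one_mul, mul_comm (koszul k s t) (koszul k p t), add_comm]
      · simp [Matrix.mul_apply]
      · simp [Matrix.mul_apply, h₃])

/-- The action of `x ∈ 𝔭(n)` on `S(V)`: the superderivation extending the action on `V`, that is,
`x.(a b) = (x.a) b + (-1)^{|x||a|} a (x.b)`. -/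
def der {p : ZMod 2} (x : pn k n p) : S k n →ₗ[k] S k n :=
  Matrix.entryLinearMap k (S k n) 0 1 ∘ₗ (derHom x).toLinearMap

theorem derHom_eq {p : ZMod 2} (x : pn k n p) (a : S k n) :
    derHom x a = !![twist k n p a, der x a; 0, a] := by
  have key : derHom x a 0 0 = twist k n p a ∧ derHom x a 1 0 = 0 ∧ derHom x a 1 1 = a := by
    induction a using S.induction with
    | algebraMap c => simp [Matrix.algebraMap_matrix_apply]
    | ι v => simp [derHom, twist]
    | mul a b ha hb => simp [Matrix.mul_apply, Fin.sum_univ_two, ha, hb]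
    | add a b ha hb => simp [ha, hb]
  ext i j
  fin_cases i <;> fin_cases j
  · exact key.1
  · rfl
  · exact key.2.1
  · exact key.2.2

@[simp] theorem der_ι {p : ZMod 2} (x : pn k n p) (v : V k n) :
    der x (ι k n v) = ι k n (x.1 v) := by
  simp [der, derHom]

@[simp] theorem der_algebraMap {p : ZMod 2} (x : pn k n p) (c : k) :
    der x (algebraMap k _ c) = 0 := by
  simp [der, Matrix.algebraMap_matrix_apply]

theorem der_mul {p : ZMod 2} (x : pn k n p) (a b : S k n) :
    der x (a * b) = der x a * b + twist k n p a * der x b := by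
  have : der x (a * b) = (derHom x a * derHom x b) 0 1 := by rw [← map_mul]; rfl
  rw [this, derHom_eq, derHom_eq]
  simp [Matrix.mul_apply, Fin.sum_univ_two, add_comm]

/-- To check an identity for all elements, check it on `1` and under left multiplication by
homogeneous vectors. -/
theorem induction_left {P : S k n → Prop} (one : P 1) (smul : ∀ (c : k) a, P a → P (c • a))
    (mul : ∀ s, ∀ v ∈ vPart k n s, ∀ a, P a → P (ι k n v * a))
    (add : ∀ a b, P a → P b → P (a + b)) (a : S k n) : P a := by
  have key : ∀ a b : S k n, P b → P (a * b) := fun a => by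
    induction a using S.induction with
    | algebraMap c =>
      intro b hb
      rw [← Algebra.smul_def]
      exact smul c b hb
    | ι v =>
      intro b hb
      obtain ⟨v₀, h₀, v₁, h₁, rfl⟩ := vSplit v
      rw [map_add, add_mul]
      exact add _ _ (mul 0 _ h₀ _ hb) (mul 1 _ h₁ _ hb)
    | mul a a' ha ha' => intro b hb; rw [mul_assoc]; exact ha _ (ha' _ hb)
    | add a a' ha ha' => intro b hb; rw [add_mul]; exact add _ _ (ha _ hb) (ha' _ hb)
  have := key a 1 one
  rwa [mul_one] at this

theorem der_ι_mul {p s : ZMod 2} (x : pn k n p) {v : V k n} (hv : v ∈ vPart k n s) (a : S k n) :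
    der x (ι k n v * a) = ι k n (x.1 v) * a + koszul k p s • (ι k n v * der x a) := by
  rw [der_mul, der_ι, twist_ι hv, smul_mul_assoc]

theorem der_one {p : ZMod 2} (x : pn k n p) : der x (1 : S k n) = 0 := by
  simpa using der_algebraMap x (1 : k)

theorem der_add {p : ZMod 2} (x y : pn k n p) (a : S k n) :
    der (x + y) a = der x a + der y a := by
  induction a using induction_left with
  | one => simp [der_one]
  | smul c a ha => simp [ha]
  | mul s v hv a ha =>
    rw [der_ι_mul _ hv, der_ι_mul _ hv, der_ι_mul _ hv, ha, Submodule.coe_add,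
      LinearMap.add_apply, map_add, add_mul, mul_add]
    module
  | add a b ha hb => simp only [map_add, ha, hb]; abel

theorem der_smul {p : ZMod 2} (c : k) (x : pn k n p) (a : S k n) :
    der (c • x) a = c • der x a := by
  induction a using induction_left with
  | one => simp [der_one]
  | smul d a ha => simp only [map_smul, ha, smul_comm c d]
  | mul s v hv a ha =>
    rw [der_ι_mul _ hv, der_ι_mul _ hv, ha, Submodule.coe_smul, LinearMap.smul_apply, map_smul,
      smul_mul_assoc, mul_smul_comm]
    module
  | add a b ha hb => simp only [map_add, ha, hb, smul_add]

theorem twist_der {p : ZMod 2} (x : pn k n p) (a : S k n) :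
    twist k n 1 (der x a) = koszul k 1 p • der x (twist k n 1 a) := by
  induction a using induction_left with
  | one => simp [der_one]
  | smul d a ha => simp only [map_smul, ha, smul_comm d]
  | mul s v hv a ha =>
    rw [der_ι_mul _ hv, map_add, map_smul, map_mul, map_mul, map_mul, ha, twist_ι hv,
      twist_ι (x.2 _ _ hv).1]
    simp only [smul_mul_assoc, map_smul, der_ι_mul _ hv, koszul_add_right, mul_smul_comm]
    module
  | add a b ha hb => simp only [map_add, ha, hb, smul_add]

theorem der_mem_part {p s : ZMod 2} (x : pn k n p) {a : S k n} (ha : a ∈ part k n s) :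
    der x a ∈ part k n (p + s) := by
  rw [mem_part] at *
  rw [twist_der, ha, map_smul, smul_smul, koszul_add_right]

theorem der_bracket {p q : ZMod 2} (x : pn k n p) (y : pn k n q) (a : S k n) :
    der (bracket x y) a = der x (der y a) - koszul k p q • der y (der x a) := by
  induction a using induction_left with
  | one => simp [der_one]
  | smul d a ha => simp only [map_smul, ha]; module
  | mul s v hv a ha =>
    have hx := (x.2 _ _ hv).1
    have hy := (y.2 _ _ hv).1
    have hb : (bracket x y).1 v = x.1 (y.1 v) - koszul k p q • y.1 (x.1 v) := rfl
    rw [der_ι_mul _ hv, der_ι_mul _ hv, der_ι_mul _ hv, map_add, map_add, map_smul, map_smul,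
      der_ι_mul _ hv, der_ι_mul _ hv, der_ι_mul _ hx, der_ι_mul _ hy, ha, hb, koszul_add_left,
      koszul_add_right, koszul_add_right, map_sub, map_smul, sub_mul, mul_sub, smul_mul_assoc,
      mul_smul_comm, koszul_comm k q p]
    have e := koszul_mul_self k p q
    match_scalars <;> first | ring1 | linear_combination (-koszul k q s) * e |
      linear_combination koszul k q s * e
  | add a b ha hb => simp only [map_add, ha, hb, smul_add]; abel

theorem twist_mem_deg {d : ℕ} {a : S k n} (p : ZMod 2) (ha : a ∈ deg k n d) :
    twist k n p a ∈ deg k n d := by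
  unfold deg at ha
  induction ha using Submodule.pow_induction_on_left' with
  | algebraMap c =>
    rw [AlgHom.commutes, deg, pow_zero]
    exact Submodule.algebraMap_mem c
  | add _ _ _ _ _ ihx ihy => rw [map_add]; exact add_mem ihx ihy
  | mem_mul _ hm _ _ _ ih =>
    obtain ⟨v, rfl⟩ := hm
    rw [map_mul, deg, pow_succ']
    exact Submodule.mul_mem_mul (by simp [twist]) ih

theorem der_mem_deg {d : ℕ} {p : ZMod 2} (x : pn k n p) {a : S k n} (ha : a ∈ deg k n d) :
    der x a ∈ deg k n d := by
  unfold deg at ha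
  induction ha using Submodule.pow_induction_on_left' with
  | algebraMap c => rw [der_algebraMap]; exact zero_mem _
  | add _ _ _ _ _ ihx ihy => rw [map_add]; exact add_mem ihx ihy
  | mem_mul _ hm _ _ hi ih =>
    obtain ⟨v, rfl⟩ := hm
    rw [der_mul, der_ι, deg, pow_succ']
    refine add_mem (Submodule.mul_mem_mul (LinearMap.mem_range_self _ _) hi)
      (Submodule.mul_mem_mul (by simp [twist]) ih)

end S
end symmetric

/-! ## Supermodules over `𝔭(n)` -/

/-- A `𝔭(n)`-supermodule: a `ℤ/2`-graded vector space with a linear action of the even and the odd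
part of `𝔭(n)` that adds parities and satisfies `[x, y].m = x.(y.m) - (-1)^{|x||y|} y.(x.m)`. -/
structure PMod (k : Type u) [Field k] (n : ℕ) where
  carrier : Type u
  [addCommGroup : AddCommGroup carrier]
  [module : Module k carrier]
  part : ZMod 2 → Submodule k carrier
  isCompl : IsCompl (part 0) (part 1)
  act (p : ZMod 2) : pn k n p →ₗ[k] Module.End k carrier
  act_mem {p s : ZMod 2} (x : pn k n p) {m : carrier} : m ∈ part s → act p x m ∈ part (p + s)
  act_bracket {p q : ZMod 2} (x : pn k n p) (y : pn k n q) (m : carrier) :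
    act (p + q) (bracket x y) m = act p x (act q y m) - koszul k p q • act q y (act p x m)

namespace PMod

attribute [instance] PMod.addCommGroup PMod.module

section basics
variable {k : Type u} [Field k] {n : ℕ} (M N : PMod k n)

/-- The projection onto the part of parity `p`. -/
def pr (p : ZMod 2) : Module.End k M.carrier :=
  if p = 0 then Submodule.projection _ _ M.isCompl else Submodule.projection _ _ M.isCompl.symm

/-- The linear map `m ↦ (-1)^{p|m|} m`. -/
def twist (p : ZMod 2) : Module.End k M.carrier :=
  M.pr 0 + koszul k p 1 • M.pr 1

variable {M N}

theorem exists_split (m : M.carrier) : ∃ m₀ ∈ M.part 0, ∃ m₁ ∈ M.part 1, m₀ + m₁ = m :=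
  Submodule.mem_sup.mp (M.isCompl.sup_eq_top ▸ Submodule.mem_top)

theorem pr_of_mem {p s : ZMod 2} {m : M.carrier} (hm : m ∈ M.part s) :
    M.pr p m = if p = s then m else 0 := by
  rcases zmod2_cases s with rfl | rfl
  · rcases zmod2_cases p with rfl | rfl
    · simpa [pr] using Submodule.projection_apply_left M.isCompl ⟨m, hm⟩
    · simpa [pr] using (Submodule.projection_apply_eq_zero_iff M.isCompl.symm).mpr hm
  · rcases zmod2_cases p with rfl | rfl
    · simpa [pr] using (Submodule.projection_apply_eq_zero_iff M.isCompl).mpr hm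
    · simpa [pr] using Submodule.projection_apply_left M.isCompl.symm ⟨m, hm⟩

theorem twist_of_mem {p s : ZMod 2} {m : M.carrier} (hm : m ∈ M.part s) :
    M.twist p m = koszul k p s • m := by
  rcases zmod2_cases s with rfl | rfl <;> simp [twist, pr_of_mem hm]

/-- Linear maps that agree on homogeneous elements are equal. -/
theorem ext_part {X : Type*} [AddCommGroup X] [Module k X] {f g : M.carrier →ₗ[k] X}
    (h : ∀ s, ∀ m ∈ M.part s, f m = g m) : f = g := by
  ext m
  obtain ⟨m₀, h₀, m₁, h₁, rfl⟩ := exists_split m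
  rw [map_add, map_add, h _ _ h₀, h _ _ h₁]

theorem ext_part₂ {X : Type*} [AddCommGroup X] [Module k X]
    {f g : M.carrier ⊗[k] N.carrier →ₗ[k] X}
    (h : ∀ s, ∀ m ∈ M.part s, ∀ t, ∀ m' ∈ N.part t, f (m ⊗ₜ m') = g (m ⊗ₜ m')) : f = g :=
  TensorProduct.ext (ext_part fun s m hm => ext_part fun t m' hm' => h s m hm t m' hm')

theorem eq_zero_of_mem {m : M.carrier} {s : ZMod 2} (h : m ∈ M.part s) (h' : m ∈ M.part (1 + s)) :
    m = 0 := by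
  rcases zmod2_cases s with rfl | rfl
  · exact Submodule.disjoint_def.mp M.isCompl.disjoint m h (by simpa using h')
  · exact Submodule.disjoint_def.mp M.isCompl.disjoint m (by simpa [zmod2_one_add_one] using h') h

end basics

/-! ### Homomorphisms -/

section homs
variable {k : Type u} [Field k] {n : ℕ} (M N : PMod k n)

/-- The homomorphisms of parity `p`: linear maps `f` with `f(M_s) ⊆ N_{p+s}` and
`f(x.m) = (-1)^{|x|p} x.f(m)`. -/
def homs (p : ZMod 2) : Submodule k (M.carrier →ₗ[k] N.carrier) where
  carrier := {f | (∀ s, ∀ m ∈ M.part s, f m ∈ N.part (p + s)) ∧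
    ∀ q (x : pn k n q) m, f (M.act q x m) = koszul k q p • N.act q x (f m)}
  add_mem' hf hg := ⟨fun s m hm => add_mem (hf.1 s m hm) (hg.1 s m hm), fun q x m => by
    simp only [LinearMap.add_apply, hf.2, hg.2, map_add, smul_add]⟩
  zero_mem' := ⟨fun _ _ _ => zero_mem _, fun q x m => by simp⟩
  smul_mem' c f hf := ⟨fun s m hm => Submodule.smul_mem _ c (hf.1 s m hm), fun q x m => by
    simp only [LinearMap.smul_apply, hf.2, map_smul, smul_comm c]⟩

/-- All homomorphisms, not only the homogeneous ones. -/
def allHoms : Submodule k (M.carrier →ₗ[k] N.carrier) := homs M N 0 ⊔ homs M N 1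

variable {M N}

theorem homs_le (p : ZMod 2) : homs M N p ≤ allHoms M N := by
  rcases zmod2_cases p with rfl | rfl
  · exact le_sup_left
  · exact le_sup_right

theorem allHoms_induction {P : (M.carrier →ₗ[k] N.carrier) → Prop}
    (h : ∀ p, ∀ f ∈ homs M N p, P f) (add : ∀ f g, P f → P g → P (f + g))
    {f : M.carrier →ₗ[k] N.carrier} (hf : f ∈ allHoms M N) : P f := by
  obtain ⟨f₀, h₀, f₁, h₁, rfl⟩ := Submodule.mem_sup.mp hf
  exact add _ _ (h _ _ h₀) (h _ _ h₁)

theorem id_mem : LinearMap.id ∈ homs M M 0 :=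
  ⟨fun s m hm => by simpa using hm, fun q x m => by simp⟩

theorem comp_mem {L : PMod k n} {p q : ZMod 2} {f : L.carrier →ₗ[k] M.carrier}
    {g : M.carrier →ₗ[k] N.carrier} (hf : f ∈ homs L M p) (hg : g ∈ homs M N q) :
    g ∘ₗ f ∈ homs L N (p + q) :=
  ⟨fun s m hm => by
    have := hg.1 _ _ (hf.1 _ _ hm)
    rwa [← add_assoc, add_comm q p] at this,
  fun r x m => by
    rw [LinearMap.comp_apply, hf.2, map_smul, hg.2, smul_smul, koszul_add_right,
      LinearMap.comp_apply]⟩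

theorem comp_mem_allHoms {L : PMod k n} {f : L.carrier →ₗ[k] M.carrier}
    {g : M.carrier →ₗ[k] N.carrier} (hf : f ∈ allHoms L M) (hg : g ∈ allHoms M N) :
    g ∘ₗ f ∈ allHoms L N := by
  refine allHoms_induction (P := fun f => g ∘ₗ f ∈ allHoms L N) (fun p f hf => ?_)
    (fun f f' h h' => ?_) hf
  · refine allHoms_induction (P := fun g => g ∘ₗ f ∈ allHoms L N) (fun q g hg => ?_)
      (fun g g' h h' => ?_) hg
    · exact homs_le _ (comp_mem hf hg)
    · rw [LinearMap.add_comp]; exact add_mem h h'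
  · rw [LinearMap.comp_add]; exact add_mem h h'

theorem homs_disjoint : Disjoint (homs M N 0) (homs M N 1) := by
  rw [Submodule.disjoint_def]
  intro f h₀ h₁
  refine ext_part fun s m hm => ?_
  have e := h₀.1 s m hm
  rw [zero_add] at e
  exact eq_zero_of_mem e (h₁.1 s m hm)

instance : Category (PMod k n) where
  Hom M N := allHoms M N
  id M := ⟨LinearMap.id, homs_le 0 id_mem⟩
  comp f g := ⟨g.1 ∘ₗ f.1, comp_mem_allHoms f.2 g.2⟩

/-- The linear map underlying a homomorphism. -/
def lin (f : M ⟶ N) : M.carrier →ₗ[k] N.carrier := f.1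

theorem hom_ext {f g : M ⟶ N} (h : lin f = lin g) : f = g := Subtype.ext h

instance : Preadditive (PMod k n) where
  homGroup M N := inferInstanceAs (AddCommGroup (allHoms M N))
  add_comp _ _ _ _ _ _ := Subtype.ext (LinearMap.comp_add ..)
  comp_add _ _ _ _ _ _ := Subtype.ext (LinearMap.add_comp ..)

instance : Linear k (PMod k n) where
  homModule M N := inferInstanceAs (Module k (allHoms M N))
  smul_comp _ _ _ _ _ _ := Subtype.ext (LinearMap.comp_smul ..)
  comp_smul _ _ _ _ _ _ := Subtype.ext (LinearMap.smul_comp ..)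

@[simp] theorem lin_id : lin (𝟙 M) = LinearMap.id := rfl
@[simp] theorem lin_comp {L : PMod k n} (f : L ⟶ M) (g : M ⟶ N) :
    lin (f ≫ g) = lin g ∘ₗ lin f := rfl
@[simp] theorem lin_add (f g : M ⟶ N) : lin (f + g) = lin f + lin g := rfl
@[simp] theorem lin_smul (c : k) (f : M ⟶ N) : lin (c • f) = c • lin f := rfl

instance : Supercategory k (PMod k n) where
  homPart M N p := (homs M N p).comap (allHoms M N).subtype
  isCompl M N := by
    constructor
    · rw [Submodule.disjoint_def]
      intro f h₀ h₁
      exact Subtype.ext (Submodule.disjoint_def.mp homs_disjoint _ h₀ h₁)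
    · rw [codisjoint_iff, Submodule.eq_top_iff']
      rintro ⟨f, hf⟩
      obtain ⟨f₀, h₀, f₁, h₁, rfl⟩ := Submodule.mem_sup.mp hf
      exact Submodule.mem_sup.mpr ⟨⟨f₀, homs_le 0 h₀⟩, h₀, ⟨f₁, homs_le 1 h₁⟩, h₁, rfl⟩
  id_mem _ := id_mem
  comp_mem := comp_mem

end homs

/-! ### Tensor products -/

section tensor
variable {k : Type u} [Field k] {n : ℕ}

/-- The trivial supermodule `k`, concentrated in even parity. -/
abbrev trivial (k : Type u) [Field k] (n : ℕ) : PMod k n where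
  carrier := k
  part p := if p = 0 then ⊤ else ⊥
  isCompl := by simpa using isCompl_top_bot
  act _ := 0
  act_mem _ _ _ := zero_mem _
  act_bracket _ _ _ := by simp

theorem trivial_mem (c : k) : c ∈ (trivial k n).part 0 := Submodule.mem_top

variable (M N : PMod k n)

/-- `(M ⊗ N)_s = ⨁_i M_i ⊗ N_{s-i}`. -/
def tensorPart (s : ZMod 2) : Submodule k (M.carrier ⊗[k] N.carrier) :=
  ⨆ i, Submodule.map₂ (TensorProduct.mk k M.carrier N.carrier) (M.part i) (N.part (s - i))

variable {M N}

theorem tmul_mem {s t : ZMod 2} {m : M.carrier} {m' : N.carrier} (hm : m ∈ M.part s)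
    (hm' : m' ∈ N.part t) : m ⊗ₜ m' ∈ tensorPart M N (s + t) :=
  Submodule.mem_iSup_of_mem s (Submodule.apply_mem_map₂ _ hm (by simpa using hm'))

theorem tmul_mem' {r s t : ZMod 2} (h : s + t = r) {m : M.carrier} {m' : N.carrier}
    (hm : m ∈ M.part s) (hm' : m' ∈ N.part t) : m ⊗ₜ m' ∈ tensorPart M N r :=
  h ▸ tmul_mem hm hm'

theorem tensorPart_le {s : ZMod 2} {W : Submodule k (M.carrier ⊗[k] N.carrier)}
    (h : ∀ i j, i + j = s → ∀ m ∈ M.part i, ∀ m' ∈ N.part j, m ⊗ₜ m' ∈ W) :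
    tensorPart M N s ≤ W :=
  iSup_le fun i => Submodule.map₂_le.mpr fun m hm m' hm' =>
    h i (s - i) (by abel) m hm m' hm'

variable (M N)

/-- `m ⊗ m' ↦ x.m ⊗ m' + (-1)^{|x||m|} m ⊗ x.m'`. -/
def tensorAct (p : ZMod 2) : pn k n p →ₗ[k] Module.End k (M.carrier ⊗[k] N.carrier) where
  toFun x := TensorProduct.map (M.act p x) LinearMap.id +
    TensorProduct.map (M.twist p) (N.act p x)
  map_add' x y := by
    simp only [map_add, TensorProduct.map_add_left, TensorProduct.map_add_right]; abel
  map_smul' c x := by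
    simp only [map_smul, TensorProduct.map_smul_left, TensorProduct.map_smul_right, smul_add,
      RingHom.id_apply]

variable {M N}

theorem tensorAct_tmul {p s : ZMod 2} (x : pn k n p) {m : M.carrier} (hm : m ∈ M.part s)
    (m' : N.carrier) : tensorAct M N p x (m ⊗ₜ m') =
      M.act p x m ⊗ₜ m' + koszul k p s • m ⊗ₜ N.act p x m' := by
  simp [tensorAct, twist_of_mem hm, TensorProduct.smul_tmul']

theorem tensorAct_mem {p s : ZMod 2} (x : pn k n p) {z : M.carrier ⊗[k] N.carrier}
    (hz : z ∈ tensorPart M N s) : tensorAct M N p x z ∈ tensorPart M N (p + s) := by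
  refine (tensorPart_le (W := (tensorPart M N (p + s)).comap (tensorAct M N p x)) ?_) hz
  rintro i j rfl m hm m' hm'
  rw [Submodule.mem_comap, tensorAct_tmul x hm]
  refine add_mem ?_ (Submodule.smul_mem _ _ ?_)
  · have := tmul_mem (M.act_mem x hm) hm'
    rwa [add_assoc] at this
  · have := tmul_mem hm (N.act_mem x hm')
    rwa [add_left_comm] at this

theorem tensorAct_bracket {p q : ZMod 2} (x : pn k n p) (y : pn k n q)
    (z : M.carrier ⊗[k] N.carrier) : tensorAct M N (p + q) (bracket x y) z =
      tensorAct M N p x (tensorAct M N q y z) -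
        koszul k p q • tensorAct M N q y (tensorAct M N p x z) := by
  suffices h : tensorAct M N (p + q) (bracket x y) =
      tensorAct M N p x ∘ₗ tensorAct M N q y -
        koszul k p q • (tensorAct M N q y ∘ₗ tensorAct M N p x) from
    DFunLike.congr_fun h z
  refine ext_part₂ fun s m hm t m' hm' => ?_
  simp only [LinearMap.sub_apply, LinearMap.smul_apply, LinearMap.comp_apply,
    tensorAct_tmul _ hm, map_add, map_smul, tensorAct_tmul _ (M.act_mem _ hm),
    M.act_bracket, N.act_bracket, TensorProduct.sub_tmul, TensorProduct.tmul_sub,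
    TensorProduct.tmul_smul, ← TensorProduct.smul_tmul', koszul_add_right, koszul_add_left,
    koszul_comm k q p]
  have e := koszul_mul_self k p q
  match_scalars <;> first | ring1 | linear_combination (-koszul k q s) * e |
    linear_combination koszul k q s * e

end tensor

/-! ### Tensor products of homomorphisms -/

section sTensor
variable {k : Type u} [Field k] {n : ℕ} {M N : PMod k n}

/-- A linear map that shifts parities by `p`. -/
def IsHomogeneous (p : ZMod 2) (f : M.carrier →ₗ[k] N.carrier) : Prop :=
  ∀ s, ∀ m ∈ M.part s, f m ∈ N.part (p + s)

/-- The component of parity `p` of a linear map. -/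
def component (p : ZMod 2) (f : M.carrier →ₗ[k] N.carrier) : M.carrier →ₗ[k] N.carrier :=
  N.pr p ∘ₗ f ∘ₗ M.pr 0 + N.pr (p + 1) ∘ₗ f ∘ₗ M.pr 1

theorem component_eq {p q : ZMod 2} {f : M.carrier →ₗ[k] N.carrier} (hf : IsHomogeneous q f) :
    component p f = if p = q then f else 0 := by
  refine ext_part fun s m hm => ?_
  rcases zmod2_cases s with rfl | rfl
  · simp only [component, LinearMap.add_apply, LinearMap.comp_apply, pr_of_mem hm, if_true,
      pr_of_mem (hf _ _ hm), one_ne_zero, if_false, map_zero, add_zero]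
    split_ifs <;> rfl
  · simp only [component, LinearMap.add_apply, LinearMap.comp_apply, pr_of_mem hm, if_true,
      pr_of_mem (hf _ _ hm), zero_ne_one, if_false, map_zero, zero_add, add_left_inj]
    split_ifs <;> rfl

variable {M' N' L L' : PMod k n}

/-- The tensor product of linear maps between superspaces, determined by
`(f ⊗ g)(m ⊗ m') = (-1)^{|g||m|} f(m) ⊗ g(m')`. -/
def sTensor (f : M.carrier →ₗ[k] N.carrier) (g : M'.carrier →ₗ[k] N'.carrier) :
    M.carrier ⊗[k] M'.carrier →ₗ[k] N.carrier ⊗[k] N'.carrier :=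
  TensorProduct.map f (component 0 g) + TensorProduct.map (f ∘ₗ M.twist 1) (component 1 g)

theorem sTensor_tmul {q s : ZMod 2} (f : M.carrier →ₗ[k] N.carrier)
    {g : M'.carrier →ₗ[k] N'.carrier} (hg : IsHomogeneous q g) {m : M.carrier}
    (hm : m ∈ M.part s) (m' : M'.carrier) :
    sTensor f g (m ⊗ₜ m') = koszul k q s • f m ⊗ₜ g m' := by
  rcases zmod2_cases q with rfl | rfl <;>
    simp [sTensor, component_eq hg, twist_of_mem hm, TensorProduct.smul_tmul']

theorem sTensor_add_left (f f' : M.carrier →ₗ[k] N.carrier) (g : M'.carrier →ₗ[k] N'.carrier) :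
    sTensor (f + f') g = sTensor f g + sTensor f' g := by
  simp only [sTensor, TensorProduct.map_add_left, LinearMap.add_comp]; abel

theorem sTensor_add_right (f : M.carrier →ₗ[k] N.carrier) (g g' : M'.carrier →ₗ[k] N'.carrier) :
    sTensor f (g + g') = sTensor f g + sTensor f g' := by
  simp only [sTensor, component, TensorProduct.map_add_right, LinearMap.comp_add,
    LinearMap.add_comp]; abel

theorem sTensor_smul_left (c : k) (f : M.carrier →ₗ[k] N.carrier)
    (g : M'.carrier →ₗ[k] N'.carrier) : sTensor (c • f) g = c • sTensor f g := by
  simp only [sTensor, TensorProduct.map_smul_left, LinearMap.smul_comp, smul_add]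

theorem sTensor_smul_right (c : k) (f : M.carrier →ₗ[k] N.carrier)
    (g : M'.carrier →ₗ[k] N'.carrier) : sTensor f (c • g) = c • sTensor f g := by
  simp only [sTensor, component, TensorProduct.map_smul_right, TensorProduct.map_add_right,
    LinearMap.comp_smul, LinearMap.smul_comp, smul_add]

theorem sTensor_id : sTensor (LinearMap.id : M.carrier →ₗ[k] M.carrier)
    (LinearMap.id : M'.carrier →ₗ[k] M'.carrier) = LinearMap.id := by
  refine ext_part₂ fun s m hm t m' hm' => ?_
  rw [sTensor_tmul _ id_mem.1 hm]
  simp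

theorem sTensor_comp {p q : ZMod 2} {f : M.carrier →ₗ[k] N.carrier}
    (f' : N.carrier →ₗ[k] L.carrier) {g : M'.carrier →ₗ[k] N'.carrier}
    {g' : N'.carrier →ₗ[k] L'.carrier} (hf : f ∈ homs M N p) (hg : g ∈ allHoms M' N')
    (hg' : g' ∈ homs N' L' q) :
    sTensor f' g' ∘ₗ sTensor f g = koszul k q p • sTensor (f' ∘ₗ f) (g' ∘ₗ g) := by
  refine allHoms_induction (P := fun g => sTensor f' g' ∘ₗ sTensor f g =
    koszul k q p • sTensor (f' ∘ₗ f) (g' ∘ₗ g)) (fun r g hg => ?_) (fun g h hg hh => ?_) hg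
  · refine ext_part₂ fun s m hm t m' hm' => ?_
    rw [LinearMap.comp_apply, LinearMap.smul_apply, sTensor_tmul f hg.1 hm, map_smul,
      sTensor_tmul f' hg'.1 (hf.1 _ _ hm), sTensor_tmul _ (comp_mem hg hg').1 hm, smul_smul,
      smul_smul, koszul_add_right, koszul_add_left, LinearMap.comp_apply, LinearMap.comp_apply]
    congr 1
    ring
  · rw [sTensor_add_right, LinearMap.comp_add, hg, hh, LinearMap.comp_add, sTensor_add_right,
      smul_add]

theorem symm_mem (e : M.carrier ≃ₗ[k] N.carrier) (he : e.toLinearMap ∈ homs M N 0) :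
    e.symm.toLinearMap ∈ homs N M 0 := by
  have he₁ : ∀ s, ∀ m ∈ M.part s, e m ∈ N.part s := fun s m hm => by
    simpa using he.1 s m hm
  constructor
  · intro s m hm
    obtain ⟨m, rfl⟩ := e.surjective m
    obtain ⟨m₀, h₀, m₁, h₁, rfl⟩ := exists_split m
    rw [LinearEquiv.coe_coe, LinearEquiv.symm_apply_apply, zero_add]
    rcases zmod2_cases s with rfl | rfl
    · have h : e m₁ ∈ N.part 0 := by
        have := Submodule.sub_mem _ hm (he₁ _ _ h₀)
        rwa [map_add, add_sub_cancel_left] at this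
      have h' : m₁ = 0 := e.map_eq_zero_iff.mp (eq_zero_of_mem h (by simpa using he₁ _ _ h₁))
      rwa [h', add_zero]
    · have h : e m₀ ∈ N.part 1 := by
        have := Submodule.sub_mem _ hm (he₁ _ _ h₁)
        rwa [map_add, add_sub_cancel_right] at this
      have h' : m₀ = 0 :=
        e.map_eq_zero_iff.mp (eq_zero_of_mem (he₁ _ _ h₀) (by simpa using h))
      rwa [h', zero_add]
  · intro q x m
    obtain ⟨m, rfl⟩ := e.surjective m
    have := he.2 q x m
    simp only [koszul_zero_right, one_smul, LinearEquiv.coe_coe] at this ⊢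
    rw [← this, LinearEquiv.symm_apply_apply, LinearEquiv.symm_apply_apply]

/-- An even isomorphism from an even equivariant linear equivalence. -/
def isoOfEquiv (e : M.carrier ≃ₗ[k] N.carrier) (he : e.toLinearMap ∈ homs M N 0) : M ≅ N where
  hom := ⟨e.toLinearMap, homs_le 0 he⟩
  inv := ⟨e.symm.toLinearMap, homs_le 0 (symm_mem e he)⟩
  hom_inv_id := Subtype.ext (LinearMap.ext fun m => e.symm_apply_apply m)
  inv_hom_id := Subtype.ext (LinearMap.ext fun m => e.apply_symm_apply m)

theorem lid_sTensor {f : M.carrier →ₗ[k] N.carrier} (hf : f ∈ allHoms M N) :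
    (TensorProduct.lid k N.carrier).toLinearMap ∘ₗ
        sTensor (M := trivial k n) (N := trivial k n) LinearMap.id f =
      f ∘ₗ (TensorProduct.lid k M.carrier).toLinearMap := by
  refine allHoms_induction (P := fun f => (TensorProduct.lid k N.carrier).toLinearMap ∘ₗ
        sTensor (M := trivial k n) (N := trivial k n) LinearMap.id f =
      f ∘ₗ (TensorProduct.lid k M.carrier).toLinearMap) (fun p f hf => ?_) (fun f g e e' => ?_) hf
  · refine TensorProduct.ext (LinearMap.ext fun (c : k) => LinearMap.ext fun m => ?_)
    change TensorProduct.lid k N.carrier (sTensor (M := trivial k n) (N := trivial k n)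
      LinearMap.id f (c ⊗ₜ[k] m)) = f (TensorProduct.lid k M.carrier (c ⊗ₜ[k] m))
    rw [sTensor_tmul (M := trivial k n) (N := trivial k n) _ hf.1 (trivial_mem c)]
    change TensorProduct.lid k N.carrier (koszul k p 0 • c ⊗ₜ[k] f m) = _
    rw [koszul_zero_right, one_smul, TensorProduct.lid_tmul, TensorProduct.lid_tmul, map_smul]
  · rw [sTensor_add_right, LinearMap.comp_add, e, e', LinearMap.add_comp]

theorem rid_sTensor (f : M.carrier →ₗ[k] N.carrier) :
    (TensorProduct.rid k N.carrier).toLinearMap ∘ₗ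
        sTensor (M' := trivial k n) (N' := trivial k n) f LinearMap.id =
      f ∘ₗ (TensorProduct.rid k M.carrier).toLinearMap := by
  refine TensorProduct.ext (ext_part fun s m hm => LinearMap.ext fun (c : k) => ?_)
  change TensorProduct.rid k N.carrier (sTensor (M' := trivial k n) (N' := trivial k n)
    f LinearMap.id (m ⊗ₜ[k] c)) = f (TensorProduct.rid k M.carrier (m ⊗ₜ[k] c))
  rw [sTensor_tmul (M' := trivial k n) (N' := trivial k n) _ id_mem.1 hm]
  change TensorProduct.rid k N.carrier (koszul k 0 s • f m ⊗ₜ[k] c) = _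
  rw [koszul_zero_left, one_smul, TensorProduct.rid_tmul, TensorProduct.rid_tmul, map_smul]

/-- Tensoring with an even map on the right, there are no signs. -/
theorem sTensor_eq_map (f : M.carrier →ₗ[k] N.carrier) {g : M'.carrier →ₗ[k] N'.carrier}
    (hg : g ∈ homs M' N' 0) : sTensor f g = TensorProduct.map f g := by
  refine ext_part₂ fun s m hm t m' hm' => ?_
  rw [sTensor_tmul f hg.1 hm, koszul_zero_left, one_smul, TensorProduct.map_tmul]

end sTensor

section tensorCategory
variable {k : Type u} [Field k] [NeZero (2 : k)] {n : ℕ} {M N M' N' L : PMod k n}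

theorem tensorPart_isCompl : IsCompl (tensorPart M N 0) (tensorPart M N 1) := by
  refine isCompl_of_involution (TensorProduct.map (M.twist 1) (N.twist 1)) (fun z hz => ?_)
    (fun z hz => ?_) fun z => ?_
  · refine (tensorPart_le (W := LinearMap.eqLocus
      (TensorProduct.map (M.twist 1) (N.twist 1)) LinearMap.id) ?_) hz
    intro i j hij m hm m' hm'
    rw [LinearMap.mem_eqLocus, TensorProduct.map_tmul, twist_of_mem hm, twist_of_mem hm',
      TensorProduct.smul_tmul_smul, ← koszul_add_right, hij]
    simp
  · refine (tensorPart_le (W := LinearMap.eqLocus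
      (TensorProduct.map (M.twist 1) (N.twist 1)) (-LinearMap.id)) ?_) hz
    intro i j hij m hm m' hm'
    rw [LinearMap.mem_eqLocus, TensorProduct.map_tmul, twist_of_mem hm, twist_of_mem hm',
      TensorProduct.smul_tmul_smul, ← koszul_add_right, hij]
    simp
  · induction z using TensorProduct.induction_on with
    | zero => exact ⟨0, zero_mem _, 0, zero_mem _, add_zero _⟩
    | add z z' hz hz' =>
      obtain ⟨z₀, h₀, z₁, h₁, rfl⟩ := hz
      obtain ⟨z₀', h₀', z₁', h₁', rfl⟩ := hz'
      exact ⟨z₀ + z₀', Submodule.add_mem _ h₀ h₀', z₁ + z₁', Submodule.add_mem _ h₁ h₁', by abel⟩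
    | tmul m m' =>
      obtain ⟨m₀, h₀, m₁, h₁, rfl⟩ := exists_split m
      obtain ⟨m₀', h₀', m₁', h₁', rfl⟩ := exists_split m'
      refine ⟨m₀ ⊗ₜ m₀' + m₁ ⊗ₜ m₁', Submodule.add_mem _ (tmul_mem' (by decide) h₀ h₀')
        (tmul_mem' (by decide) h₁ h₁'), m₀ ⊗ₜ m₁' + m₁ ⊗ₜ m₀', Submodule.add_mem _
        (tmul_mem' (by decide) h₀ h₁') (tmul_mem' (by decide) h₁ h₀'), ?_⟩
      simp only [TensorProduct.add_tmul, TensorProduct.tmul_add]; abel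

/-- The tensor product of supermodules. -/
abbrev tensor (M N : PMod k n) : PMod k n where
  carrier := M.carrier ⊗[k] N.carrier
  part := tensorPart M N
  isCompl := tensorPart_isCompl
  act := tensorAct M N
  act_mem := tensorAct_mem
  act_bracket := tensorAct_bracket

theorem sTensor_mem {p q : ZMod 2} {f : M.carrier →ₗ[k] N.carrier}
    {g : M'.carrier →ₗ[k] N'.carrier} (hf : f ∈ homs M N p) (hg : g ∈ homs M' N' q) :
    sTensor f g ∈ homs (tensor M M') (tensor N N') (p + q) := by
  constructor
  · intro s z hz
    refine (tensorPart_le (W := (tensorPart N N' (p + q + s)).comap (sTensor f g)) ?_) hz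
    rintro i j rfl m hm m' hm'
    rw [Submodule.mem_comap, sTensor_tmul f hg.1 hm]
    exact Submodule.smul_mem _ _ (tmul_mem' (by abel) (hf.1 _ _ hm) (hg.1 _ _ hm'))
  · intro r x z
    suffices h : sTensor f g ∘ₗ tensorAct M M' r x =
        koszul k r (p + q) • (tensorAct N N' r x ∘ₗ sTensor f g) from DFunLike.congr_fun h z
    refine ext_part₂ fun s m hm t m' hm' => ?_
    simp only [LinearMap.comp_apply, LinearMap.smul_apply, tensorAct_tmul _ hm, map_add, map_smul,
      sTensor_tmul f hg.1 hm, sTensor_tmul f hg.1 (M.act_mem x hm), hf.2, hg.2,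
      tensorAct_tmul _ (hf.1 _ _ hm), koszul_add_right, TensorProduct.tmul_smul,
      ← TensorProduct.smul_tmul', koszul_comm k q r]
    have e := koszul_mul_self k r p
    match_scalars
    · ring1
    · linear_combination (-(koszul k r s * koszul k q s * koszul k r q)) * e

theorem sTensor_mem_allHoms {f : M.carrier →ₗ[k] N.carrier} {g : M'.carrier →ₗ[k] N'.carrier}
    (hf : f ∈ allHoms M N) (hg : g ∈ allHoms M' N') :
    sTensor f g ∈ allHoms (tensor M M') (tensor N N') := by
  refine allHoms_induction (P := fun f => sTensor f g ∈ allHoms (tensor M M') (tensor N N'))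
    (fun p f hf => ?_) (fun f f' h h' => ?_) hf
  · refine allHoms_induction (P := fun g => sTensor f g ∈ allHoms (tensor M M') (tensor N N'))
      (fun q g hg => ?_) (fun g g' h h' => ?_) hg
    · exact homs_le _ (sTensor_mem hf hg)
    · rw [sTensor_add_right]; exact Submodule.add_mem _ h h'
  · rw [sTensor_add_left]; exact Submodule.add_mem _ h h'

theorem assoc_mem : (TensorProduct.assoc k M.carrier N.carrier L.carrier).toLinearMap ∈
    homs (tensor (tensor M N) L) (tensor M (tensor N L)) 0 := by
  constructor
  · intro s z hz
    refine (tensorPart_le (M := tensor M N) (W := (tensorPart M (tensor N L) (0 + s)).comap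
      (TensorProduct.assoc k M.carrier N.carrier L.carrier).toLinearMap) ?_) hz
    rintro i j rfl z hz l hl
    refine (tensorPart_le (W := ((tensorPart M (tensor N L) (0 + (i + j))).comap
      (TensorProduct.assoc k M.carrier N.carrier L.carrier).toLinearMap).comap
        ((TensorProduct.mk k (M.carrier ⊗[k] N.carrier) L.carrier).flip l)) ?_) hz
    rintro a b rfl m hm m' hm'
    exact tmul_mem' (N := tensor N L) (by abel) hm (tmul_mem hm' hl)
  · intro q x z
    suffices h : (TensorProduct.assoc k M.carrier N.carrier L.carrier).toLinearMap ∘ₗ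
        tensorAct (tensor M N) L q x = koszul k q 0 • (tensorAct M (tensor N L) q x ∘ₗ
          (TensorProduct.assoc k M.carrier N.carrier L.carrier).toLinearMap) from
      DFunLike.congr_fun h z
    refine TensorProduct.ext ?_
    refine ext_part₂ fun s m hm t m' hm' => LinearMap.ext fun l => ?_
    have h₁ : (tensorAct (tensor M N) L q x) ((m ⊗ₜ[k] m') ⊗ₜ[k] l) =
        (M.act q x m ⊗ₜ[k] m' + koszul k q s • m ⊗ₜ[k] N.act q x m') ⊗ₜ[k] l +
          koszul k q (s + t) • (m ⊗ₜ[k] m') ⊗ₜ[k] L.act q x l := by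
      rw [tensorAct_tmul (M := tensor M N) x (tmul_mem hm hm')]
      exact congrArg (fun z => z ⊗ₜ[k] l + koszul k q (s + t) • (m ⊗ₜ[k] m') ⊗ₜ[k] L.act q x l)
        (tensorAct_tmul x hm m')
    have h₂ : (tensorAct M (tensor N L) q x) (m ⊗ₜ[k] (m' ⊗ₜ[k] l)) =
        M.act q x m ⊗ₜ[k] (m' ⊗ₜ[k] l) + koszul k q s • m ⊗ₜ[k] (N.act q x m' ⊗ₜ[k] l +
          koszul k q t • m' ⊗ₜ[k] L.act q x l) := by
      rw [tensorAct_tmul (N := tensor N L) x hm]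
      exact congrArg (fun z => M.act q x m ⊗ₜ[k] (m' ⊗ₜ[k] l) + koszul k q s • m ⊗ₜ[k] z)
        (tensorAct_tmul x hm' l)
    change TensorProduct.assoc k _ _ _ (tensorAct (tensor M N) L q x ((m ⊗ₜ[k] m') ⊗ₜ[k] l)) =
      koszul k q 0 • tensorAct M (tensor N L) q x (m ⊗ₜ[k] (m' ⊗ₜ[k] l))
    rw [h₁, h₂]
    simp only [TensorProduct.add_tmul, TensorProduct.tmul_add, map_add, map_smul,
      TensorProduct.assoc_tmul, ← TensorProduct.smul_tmul', TensorProduct.tmul_smul,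
      koszul_zero_right, one_smul, koszul_add_right, smul_add, mul_smul, add_assoc]

theorem lid_mem : (TensorProduct.lid k M.carrier).toLinearMap ∈
    homs (tensor (trivial k n) M) M 0 := by
  constructor
  · intro s z hz
    refine (tensorPart_le (M := trivial k n) (W := (M.part (0 + s)).comap
      (TensorProduct.lid k M.carrier).toLinearMap) ?_) hz
    rintro i j rfl (c : k) hc m hm
    change TensorProduct.lid k M.carrier (c ⊗ₜ[k] m) ∈ M.part (0 + (i + j))
    rw [TensorProduct.lid_tmul]
    rcases zmod2_cases i with rfl | rfl
    · simpa using Submodule.smul_mem _ c hm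
    · have : c = 0 := hc
      rw [this, zero_smul]
      exact Submodule.zero_mem _
  · intro q x z
    suffices h : (TensorProduct.lid k M.carrier).toLinearMap ∘ₗ
        tensorAct (trivial k n) M q x = koszul k q 0 • (M.act q x ∘ₗ
          (TensorProduct.lid k M.carrier).toLinearMap) from
      DFunLike.congr_fun h z
    refine TensorProduct.ext ?_
    refine LinearMap.ext fun (c : k) => LinearMap.ext fun m => ?_
    have hc := trivial_mem (n := n) c
    change TensorProduct.lid k M.carrier (tensorAct (trivial k n) M q x (c ⊗ₜ[k] m)) =
      koszul k q 0 • M.act q x (TensorProduct.lid k M.carrier (c ⊗ₜ[k] m))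
    rw [tensorAct_tmul x hc]
    change TensorProduct.lid k M.carrier ((0 : k) ⊗ₜ[k] m +
      koszul k q 0 • c ⊗ₜ[k] M.act q x m) = _
    rw [TensorProduct.zero_tmul, zero_add, map_smul, TensorProduct.lid_tmul,
      TensorProduct.lid_tmul, map_smul]

theorem rid_mem : (TensorProduct.rid k M.carrier).toLinearMap ∈
    homs (tensor M (trivial k n)) M 0 := by
  constructor
  · intro s z hz
    refine (tensorPart_le (N := trivial k n) (W := (M.part (0 + s)).comap
      (TensorProduct.rid k M.carrier).toLinearMap) ?_) hz
    rintro i j rfl m hm (c : k) hc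
    change TensorProduct.rid k M.carrier (m ⊗ₜ[k] c) ∈ M.part (0 + (i + j))
    rw [TensorProduct.rid_tmul]
    rcases zmod2_cases j with rfl | rfl
    · simpa using Submodule.smul_mem _ c hm
    · have : c = 0 := hc
      rw [this, zero_smul]
      exact Submodule.zero_mem _
  · intro q x z
    suffices h : (TensorProduct.rid k M.carrier).toLinearMap ∘ₗ
        tensorAct M (trivial k n) q x = koszul k q 0 • (M.act q x ∘ₗ
          (TensorProduct.rid k M.carrier).toLinearMap) from
      DFunLike.congr_fun h z
    refine TensorProduct.ext (ext_part fun s m hm => LinearMap.ext fun (c : k) => ?_)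
    change TensorProduct.rid k M.carrier (tensorAct M (trivial k n) q x (m ⊗ₜ[k] c)) =
      koszul k q 0 • M.act q x (TensorProduct.rid k M.carrier (m ⊗ₜ[k] c))
    rw [tensorAct_tmul x hm]
    change TensorProduct.rid k M.carrier (M.act q x m ⊗ₜ[k] c +
      koszul k q s • m ⊗ₜ[k] (0 : k)) = _
    rw [TensorProduct.tmul_zero, smul_zero, add_zero, TensorProduct.rid_tmul,
      TensorProduct.rid_tmul, map_smul, koszul_zero_right, one_smul]

theorem sTensor_assoc {X X' X'' Y Y' Y'' : PMod k n} {f : X.carrier →ₗ[k] Y.carrier}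
    {g : X'.carrier →ₗ[k] Y'.carrier} {h : X''.carrier →ₗ[k] Y''.carrier}
    (hg : g ∈ allHoms X' Y') (hh : h ∈ allHoms X'' Y'') :
    (TensorProduct.assoc k Y.carrier Y'.carrier Y''.carrier).toLinearMap ∘ₗ
        sTensor (M := tensor X X') (N := tensor Y Y') (sTensor f g) h =
      sTensor (M' := tensor X' X'') (N' := tensor Y' Y'') f (sTensor g h) ∘ₗ
        (TensorProduct.assoc k X.carrier X'.carrier X''.carrier).toLinearMap := by
  refine allHoms_induction (P := fun g => (TensorProduct.assoc k _ _ _).toLinearMap ∘ₗ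
        sTensor (M := tensor X X') (N := tensor Y Y') (sTensor f g) h =
      sTensor (M' := tensor X' X'') (N' := tensor Y' Y'') f (sTensor g h) ∘ₗ
        (TensorProduct.assoc k _ _ _).toLinearMap) (fun p g hg => ?_) (fun g g' e e' => ?_) hg
  · refine allHoms_induction (P := fun h => (TensorProduct.assoc k _ _ _).toLinearMap ∘ₗ
        sTensor (M := tensor X X') (N := tensor Y Y') (sTensor f g) h =
      sTensor (M' := tensor X' X'') (N' := tensor Y' Y'') f (sTensor g h) ∘ₗ
        (TensorProduct.assoc k _ _ _).toLinearMap) (fun q h hh => ?_) (fun h h' e e' => ?_) hh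
    · refine TensorProduct.ext ?_
      refine ext_part₂ fun s m hm t m' hm' => LinearMap.ext fun l => ?_
      have h₁ : sTensor (M := tensor X X') (N := tensor Y Y') (sTensor f g) h
          ((m ⊗ₜ[k] m') ⊗ₜ[k] l) =
          koszul k q (s + t) • (koszul k p s • f m ⊗ₜ[k] g m') ⊗ₜ[k] h l := by
        rw [sTensor_tmul (M := tensor X X') (N := tensor Y Y') _ hh.1 (tmul_mem hm hm')]
        exact congrArg (fun z => koszul k q (s + t) • z ⊗ₜ[k] h l) (sTensor_tmul f hg.1 hm m')
      have h₂ : sTensor (M' := tensor X' X'') (N' := tensor Y' Y'') f (sTensor g h)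
          (m ⊗ₜ[k] (m' ⊗ₜ[k] l)) =
          koszul k (p + q) s • f m ⊗ₜ[k] (koszul k q t • g m' ⊗ₜ[k] h l) := by
        rw [sTensor_tmul (M' := tensor X' X'') (N' := tensor Y' Y'') _ (sTensor_mem hg hh).1 hm]
        exact congrArg (fun z => koszul k (p + q) s • f m ⊗ₜ[k] z) (sTensor_tmul g hh.1 hm' l)
      change TensorProduct.assoc k _ _ _ (sTensor (M := tensor X X') (N := tensor Y Y')
          (sTensor f g) h ((m ⊗ₜ[k] m') ⊗ₜ[k] l)) =
        sTensor (M' := tensor X' X'') (N' := tensor Y' Y'') f (sTensor g h)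
          (m ⊗ₜ[k] (m' ⊗ₜ[k] l))
      rw [h₁, h₂, map_smul, ← TensorProduct.smul_tmul', map_smul, TensorProduct.assoc_tmul,
        TensorProduct.tmul_smul, smul_smul, smul_smul, koszul_add_right, koszul_add_left]
      congr 1
      ring
    · rw [sTensor_add_right, sTensor_add_right, LinearMap.comp_add, e, e', sTensor_add_right,
        LinearMap.add_comp]
  · rw [sTensor_add_right, sTensor_add_left, sTensor_add_left, LinearMap.comp_add, e, e',
      sTensor_add_right, LinearMap.add_comp]

theorem sTensor_pentagon (W X Y Z : PMod k n) :
    (sTensor (M := W) (N := W) (M' := tensor (tensor X Y) Z) (N' := tensor X (tensor Y Z))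
        LinearMap.id (TensorProduct.assoc k X.carrier Y.carrier Z.carrier).toLinearMap ∘ₗ
      (TensorProduct.assoc k W.carrier (X.carrier ⊗[k] Y.carrier) Z.carrier).toLinearMap) ∘ₗ
      sTensor (M := tensor (tensor W X) Y) (N := tensor W (tensor X Y)) (M' := Z) (N' := Z)
        (TensorProduct.assoc k W.carrier X.carrier Y.carrier).toLinearMap LinearMap.id =
    (TensorProduct.assoc k W.carrier X.carrier (Y.carrier ⊗[k] Z.carrier)).toLinearMap ∘ₗ
      (TensorProduct.assoc k (W.carrier ⊗[k] X.carrier) Y.carrier Z.carrier).toLinearMap := by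
  rw [sTensor_eq_map _ id_mem,
    sTensor_eq_map (M' := tensor (tensor X Y) Z) (N' := tensor X (tensor Y Z)) _ assoc_mem]
  exact TensorProduct.ext_fourfold fun a b c d => rfl

theorem sTensor_triangle (X Y : PMod k n) :
    sTensor (M := X) (N := X) (M' := tensor (trivial k n) Y) (N' := Y) LinearMap.id
        (TensorProduct.lid k Y.carrier).toLinearMap ∘ₗ
      (TensorProduct.assoc k X.carrier k Y.carrier).toLinearMap =
    sTensor (M := tensor X (trivial k n)) (N := X) (M' := Y) (N' := Y)
      (TensorProduct.rid k X.carrier).toLinearMap LinearMap.id := by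
  rw [sTensor_eq_map _ id_mem, sTensor_eq_map (M' := tensor (trivial k n) Y) _ lid_mem]
  refine TensorProduct.ext_threefold fun a b c => ?_
  change a ⊗ₜ[k] (b • c) = (b • a) ⊗ₜ[k] c
  exact (TensorProduct.smul_tmul b a c).symm

/-- The monoidal supercategory of `𝔭(n)`-supermodules. -/
instance : MonoidalSupercategory k (PMod k n) where
  tensorObj := tensor
  tensorHom f g := ⟨sTensor f.1 g.1, sTensor_mem_allHoms f.2 g.2⟩
  add_tensor _ _ _ := Subtype.ext (sTensor_add_left ..)
  tensor_add _ _ _ := Subtype.ext (sTensor_add_right ..)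
  smul_tensor _ _ _ := Subtype.ext (sTensor_smul_left ..)
  tensor_smul _ _ _ := Subtype.ext (sTensor_smul_right ..)
  tensor_mem hf hg := sTensor_mem hf hg
  tensor_id _ _ := Subtype.ext sTensor_id
  interchange _ f' g _ hf hg' := Subtype.ext (sTensor_comp f'.1 hf g.2 hg')
  unit := trivial k n
  assoc L M N := isoOfEquiv (TensorProduct.assoc k L.carrier M.carrier N.carrier) assoc_mem
  leftUnitor M := isoOfEquiv (TensorProduct.lid k M.carrier) lid_mem
  rightUnitor M := isoOfEquiv (TensorProduct.rid k M.carrier) rid_mem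
  assoc_mem _ _ _ := assoc_mem
  leftUnitor_mem _ := lid_mem
  rightUnitor_mem M := rid_mem (M := M)
  assoc_naturality _ g h := Subtype.ext (sTensor_assoc g.2 h.2)
  leftUnitor_naturality f := Subtype.ext (lid_sTensor f.2)
  rightUnitor_naturality f := Subtype.ext (rid_sTensor f.1)
  pentagon W X Y Z := Subtype.ext (sTensor_pentagon W X Y Z)
  triangle X Y := Subtype.ext (sTensor_triangle X Y)

end tensorCategory
end PMod

/-! ## Full monoidal subcategories -/

section fullSub

/-- A property of objects that holds for the unit object and is closed under tensor products. -/
class IsTensorClosed (k : Type u) [CommRing k] {C : Type v} [Category.{w} C] [Preadditive C]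
    [Linear k C] [Supercategory k C] [MonoidalSupercategory k C] (P : C → Prop) : Prop where
  unit : P (unit k)
  tensor {X Y : C} : P X → P Y → P (tensorObj k X Y)

/-- The full subcategory on the objects with property `P`. -/
structure FullSub {C : Type v} (P : C → Prop) where
  obj : C
  property : P obj

namespace FullSub

variable {C : Type v} [Category.{w} C] {P : C → Prop}

instance : Category (FullSub P) where
  Hom X Y := X.obj ⟶ Y.obj
  id X := 𝟙 X.obj
  comp f g := f ≫ g
  id_comp {X Y} f := Category.id_comp (X := X.obj) (Y := Y.obj) f
  comp_id {X Y} f := Category.comp_id (X := X.obj) (Y := Y.obj) f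
  assoc {W X Y Z} f g h :=
    Category.assoc (W := W.obj) (X := X.obj) (Y := Y.obj) (Z := Z.obj) f g h

/-- A morphism of the full subcategory as a morphism of the ambient category. -/
def toHom {X Y : FullSub P} (f : X ⟶ Y) : X.obj ⟶ Y.obj := f

/-- An isomorphism of the ambient category as an isomorphism of the full subcategory. -/
def isoMk {X Y : FullSub P} (e : X.obj ≅ Y.obj) : X ≅ Y where
  hom := e.hom
  inv := e.inv
  hom_inv_id := e.hom_inv_id
  inv_hom_id := e.inv_hom_id

variable [Preadditive C]

instance : Preadditive (FullSub P) where
  homGroup X Y := inferInstanceAs (AddCommGroup (X.obj ⟶ Y.obj))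
  add_comp X Y Z f f' g := Preadditive.add_comp X.obj Y.obj Z.obj f f' g
  comp_add X Y Z f g g' := Preadditive.comp_add X.obj Y.obj Z.obj f g g'

variable {k : Type u} [CommRing k] [Linear k C]

instance : Linear k (FullSub P) where
  homModule X Y := inferInstanceAs (Module k (X.obj ⟶ Y.obj))
  smul_comp X Y Z c f g := Linear.smul_comp X.obj Y.obj Z.obj c f g
  comp_smul X Y Z f c g := Linear.comp_smul X.obj Y.obj Z.obj f c g

variable [Supercategory k C]

instance : Supercategory k (FullSub P) where
  homPart X Y p := homPart k X.obj Y.obj p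
  isCompl X Y := Supercategory.isCompl X.obj Y.obj
  id_mem X := Supercategory.id_mem X.obj
  comp_mem {X Y Z} _ _ _ _ hf hg :=
    Supercategory.comp_mem (X := X.obj) (Y := Y.obj) (Z := Z.obj) hf hg

variable [MonoidalSupercategory k C] [IsTensorClosed k P]

instance : MonoidalSupercategory k (FullSub P) where
  tensorObj X Y := ⟨tensorObj k X.obj Y.obj, IsTensorClosed.tensor X.property Y.property⟩
  tensorHom {X Y X' Y'} f g :=
    tensorHom k (X := X.obj) (Y := Y.obj) (X' := X'.obj) (Y' := Y'.obj) f g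
  add_tensor {X Y X' Y'} f f' g := MonoidalSupercategory.add_tensor
    (X := X.obj) (Y := Y.obj) (X' := X'.obj) (Y' := Y'.obj) f f' g
  tensor_add {X Y X' Y'} f g g' := MonoidalSupercategory.tensor_add
    (X := X.obj) (Y := Y.obj) (X' := X'.obj) (Y' := Y'.obj) f g g'
  smul_tensor {X Y X' Y'} c f g := MonoidalSupercategory.smul_tensor
    (X := X.obj) (Y := Y.obj) (X' := X'.obj) (Y' := Y'.obj) c f g
  tensor_smul {X Y X' Y'} c f g := MonoidalSupercategory.tensor_smul
    (X := X.obj) (Y := Y.obj) (X' := X'.obj) (Y' := Y'.obj) c f g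
  tensor_mem {X Y X' Y'} _ _ _ _ hf hg := MonoidalSupercategory.tensor_mem
    (X := X.obj) (Y := Y.obj) (X' := X'.obj) (Y' := Y'.obj) hf hg
  tensor_id X X' := MonoidalSupercategory.tensor_id X.obj X'.obj
  interchange {X Y Z X' Y' Z'} _ _ f f' g g' hf hg' :=
    MonoidalSupercategory.interchange (X := X.obj) (Y := Y.obj) (Z := Z.obj)
      (X' := X'.obj) (Y' := Y'.obj) (Z' := Z'.obj) f f' g g' hf hg'
  unit := ⟨unit k, IsTensorClosed.unit⟩
  assoc X Y Z := isoMk (assoc k X.obj Y.obj Z.obj)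
  leftUnitor X := isoMk (leftUnitor k X.obj)
  rightUnitor X := isoMk (rightUnitor k X.obj)
  assoc_mem X Y Z := MonoidalSupercategory.assoc_mem X.obj Y.obj Z.obj
  leftUnitor_mem X := MonoidalSupercategory.leftUnitor_mem X.obj
  rightUnitor_mem X := MonoidalSupercategory.rightUnitor_mem X.obj
  assoc_naturality {X Y X' Y' X'' Y''} f g h :=
    MonoidalSupercategory.assoc_naturality (X := X.obj) (Y := Y.obj)
      (X' := X'.obj) (Y' := Y'.obj) (X'' := X''.obj) (Y'' := Y''.obj) f g h
  leftUnitor_naturality {X Y} f :=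
    MonoidalSupercategory.leftUnitor_naturality (X := X.obj) (Y := Y.obj) f
  rightUnitor_naturality {X Y} f :=
    MonoidalSupercategory.rightUnitor_naturality (X := X.obj) (Y := Y.obj) f
  pentagon W X Y Z := MonoidalSupercategory.pentagon W.obj X.obj Y.obj Z.obj
  triangle X Y := MonoidalSupercategory.triangle X.obj Y.obj

end FullSub
end fullSub

/-! ## Symmetric powers -/

section symmetricPowers
variable (k : Type u) [Field k] [NeZero (2 : k)] (n : ℕ)

/-- The `d`-th symmetric power as a `𝔭(n)`-supermodule. -/
def symDeg (d : ℕ) : PMod k n where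
  carrier := S.deg k n d
  part p := (S.part k n p).comap (S.deg k n d).subtype
  isCompl := by
    refine isCompl_of_involution
      ((S.twist k n 1).toLinearMap.restrict fun a ha => S.twist_mem_deg 1 ha) (fun a ha => ?_)
      (fun a ha => ?_) fun a => ?_
    · refine Subtype.ext ((S.mem_part.mp ha).trans ?_)
      rw [koszul_zero_right, one_smul]
      rfl
    · refine Subtype.ext ((S.mem_part.mp ha).trans ?_)
      rw [koszul_one_one, neg_smul, one_smul]
      rfl
    · obtain ⟨a₀, h₀, a₁, h₁, e⟩ := S.exists_homogeneous (S.deg k n d)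
        (fun _ h => S.twist_mem_deg 1 h) a.1 a.2
      exact ⟨⟨a₀, h₀.1⟩, h₀.2, ⟨a₁, h₁.1⟩, h₁.2, Subtype.ext e⟩
  act p :=
    { toFun := fun x => (S.der x).restrict fun _ ha => S.der_mem_deg x ha
      map_add' := fun x y => LinearMap.ext fun a => Subtype.ext (S.der_add x y a.1)
      map_smul' := fun c x => LinearMap.ext fun a => Subtype.ext (S.der_smul c x a.1) }
  act_mem x _ ha := S.der_mem_part x ha
  act_bracket x y a := Subtype.ext (S.der_bracket x y a.1)

/-- The symmetric powers `S^d(V)`, where `S^0(V)` is the trivial module `k`. -/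
def Sym : ℕ → PMod k n
  | 0 => PMod.trivial k n
  | d + 1 => symDeg k n (d + 1)

/-- The inclusion `S^d(V) → S(V)`. -/
def symIncl : (d : ℕ) → (Sym k n d).carrier →ₗ[k] S k n
  | 0 => Algebra.linearMap k (S k n)
  | d + 1 => (S.deg k n (d + 1)).subtype

/-- The projection `S(V) → S^d(V)`. -/
def symProj : (d : ℕ) → S k n →ₗ[k] (Sym k n d).carrier
  | 0 => S.counit.toLinearMap
  | d + 1 => S.projDeg k n (d + 1)

/-- The identification of `V` with `S^1(V)`. -/
def vIncl : V k n →ₗ[k] (Sym k n 1).carrier := S.ιDeg k n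

/-- The linear map `spl = (p_a ⊗ p_b) ∘ Δ ∘ ι_{a+b} : S^{a+b}(V) → S^a(V) ⊗ S^b(V)`. -/
def spl (a b : ℕ) : (Sym k n (a + b)).carrier →ₗ[k]
    (Sym k n a).carrier ⊗[k] (Sym k n b).carrier :=
  TensorProduct.map (symProj k n a) (symProj k n b) ∘ₗ S.comul ∘ₗ symIncl k n (a + b)

/-- The linear map `mer = p_{a+b} ∘ ∇ ∘ (ι_a ⊗ ι_b) : S^a(V) ⊗ S^b(V) → S^{a+b}(V)`. -/
def mer (a b : ℕ) : (Sym k n a).carrier ⊗[k] (Sym k n b).carrier →ₗ[k]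
    (Sym k n (a + b)).carrier :=
  symProj k n (a + b) ∘ₗ LinearMap.mul' k (S k n) ∘ₗ
    TensorProduct.map (symIncl k n a) (symIncl k n b)

/-- The element `∪(1) = ∑_i (-1)^{|i|} v_i ⊗ v_{-i}` of `S^1(V) ⊗ S^1(V)`. -/
def cupElem : (Sym k n 1).carrier ⊗[k] (Sym k n 1).carrier :=
  ∑ i : Idx n, koszul k 1 i.parity •
    vIncl k n (Pi.single i 1) ⊗ₜ[k] vIncl k n (Pi.single i.swap 1)

end symmetricPowers

/-! ## The category generated by the symmetric powers -/

section generated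
variable (k : Type u) [Field k] [NeZero (2 : k)] (n : ℕ)

/-- The supermodules that are tensor products of symmetric powers. -/
inductive IsSymTensor : PMod k n → Prop
  | sym (d : ℕ) : IsSymTensor (Sym k n d)
  | tensor {M N : PMod k n} : IsSymTensor M → IsSymTensor N → IsSymTensor (tensorObj k M N)

instance : IsTensorClosed k (IsSymTensor k n) where
  unit := .sym 0
  tensor := .tensor

/-- The full monoidal subcategory of the category of `𝔭(n)`-supermodules generated by the symmetric
powers of `V`. -/
abbrev PModS : Type (u + 1) := FullSub (IsSymTensor k n)

/-- The symmetric power `S^d(V)` as an object. -/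
def PModS.sym (d : ℕ) : PModS k n := ⟨Sym k n d, .sym d⟩

variable {k n}

/-- The linear map underlying a morphism. -/
def PModS.lin {X Y : PModS k n} (f : X ⟶ Y) : X.obj.carrier →ₗ[k] Y.obj.carrier :=
  PMod.lin (FullSub.toHom f)

end generated

end

end PWebs

open PWebs

/-! A monoidal superfunctor out of the web category is given by values of the generators that are
homogeneous, `𝔭(n)`-equivariant and satisfy the defining relations. The relations are identities
between operators on `S(V) ⊗ S(V)`, and the algebra of the proof takes place there.

With the super tensor product, `S(V) ⊗ S(V)` is generated by the elements `v ⊗ 1` and `1 ⊗ v`. Write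
`L_v` and `R_v` for left multiplication by them (`mulL`, `mulR`). A linear operator is determined by
its value at `1 ⊗ 1` and by its commutation with all `L_v` and `R_v`, so each identity is an
induction (`tensor_induction`, `tensor_deg_induction`).

Rungs: the sum of the `E_r` over all `r` (`rungE`) is the algebra automorphism with `v ⊗ 1 ↦ v ⊗ 1 +
1 ⊗ v` that fixes `1 ⊗ v`. Hence `E_r L_v = L_v E_r + R_v E_{r-1}` and `E_r R_v = R_v E_r`; for
`F_r` (`rungF`) the two factors change roles. The rung swap follows by induction on the bidegree,
and Pascal's rule is what makes the coefficients match (`rungF_rungE`).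

Caps: contraction with a coordinate is a superderivation, a partial derivative. Let `conL i` and
`conR i` be the contractions of the two factors. The cap is `∑ conR (-i) ∘ conL i`, and twice the
antennas are `∑ conL i ∘ conL (-i)` and `∑ conR (-i) ∘ conR i` (`capOp_eq`, `antOpL_eq`,
`antOpR_eq`). Dually to the rules for multiplications, `conL i` commutes with `E_r`, while `conR i ∘
E_r = E_r ∘ conR i + E_{r-1} ∘ conL i`. Substitution gives the cap/rung swaps, with the factor 2
coming from the normalisation of the antenna.

Cups: the cup is `∑ (-1)^{|i|} L_i R_{-i}`. Commuting it with `E_r` leaves only `∑ (-1)^{|i|} R_i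
R_{-i}`, which is zero because `v_i` and `v_{-i}` commute and the sign changes under `i ↦ -i`.

The other relations: coassociativity, the counit axioms and associativity of the product give the
relations on splits, merges and strands labelled zero; straightening is duality of the bases `v_i`
and `v_{-i}`; antenna retraction holds because the form is supersymmetric, so that both mixed terms
of `Δ(vw)` contribute `(v, w)`.

Equivariance: `𝔭(n)` acts by superderivations, which are compatible with the product and with `Δ`.
The form is invariant by definition of `𝔭(n)`, and the cup is the dual invariant (`pn_matrix`,
`derTensor_cupVec`).

To pass from operators to webs, `interp` assigns a linear map to each web expression, and `Rep`
records that this map becomes a given operator once symmetric powers are embedded in `S(V)`. These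
embeddings are injective, so an operator identity yields the relation (`Rep.eq`); `interp_rel`
collects all relations, and `webFunctor` is the resulting functor on the quotient. -/

namespace PWebs
noncomputable section
namespace S

/-! ## Left multiplications on `S(V) ⊗ S(V)` and the coproduct -/

section coproduct
variable {k : Type u} [Field k] {n : ℕ}

/-- Left multiplication by `v ⊗ 1` in the super tensor product. -/
def mulL (v : V k n) : S k n ⊗[k] S k n →ₗ[k] S k n ⊗[k] S k n :=
  TensorProduct.map (LinearMap.mulLeft k (ι k n v)) LinearMap.id

/-- Left multiplication by `1 ⊗ v` in the super tensor product, for `v` of parity `s`. -/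
def mulR (s : ZMod 2) (v : V k n) : S k n ⊗[k] S k n →ₗ[k] S k n ⊗[k] S k n :=
  TensorProduct.map (twist k n s).toLinearMap (LinearMap.mulLeft k (ι k n v))

@[simp] theorem mulL_tmul (v : V k n) (a b : S k n) :
    mulL v (a ⊗ₜ b) = (ι k n v * a) ⊗ₜ b := rfl

@[simp] theorem mulR_tmul (s : ZMod 2) (v : V k n) (a b : S k n) :
    mulR s v (a ⊗ₜ b) = twist k n s a ⊗ₜ (ι k n v * b) := rfl

/-- The super tensor product is generated by the `v ⊗ 1` and `1 ⊗ v`. A linear identity therefore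
has to be checked at `1 ⊗ 1` only and then propagated through `mulL` and `mulR`. -/
theorem tensor_induction {P : S k n ⊗[k] S k n → Prop} (one : P (1 ⊗ₜ 1))
    (smul : ∀ (c : k) z, P z → P (c • z)) (add : ∀ z w, P z → P w → P (z + w))
    (mulL : ∀ s, ∀ v ∈ vPart k n s, ∀ z, P z → P (mulL v z))
    (mulR : ∀ s, ∀ v ∈ vPart k n s, ∀ z, P z → P (mulR s v z)) (z : S k n ⊗[k] S k n) : P z := by
  have key : ∀ b : S k n, P (1 ⊗ₜ b) := fun b => by
    induction b using induction_left with
    | one => exact one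
    | smul c b hb => rw [TensorProduct.tmul_smul]; exact smul c _ hb
    | mul s v hv b hb => simpa using mulR s v hv _ hb
    | add b c hb hc => rw [TensorProduct.tmul_add]; exact add _ _ hb hc
  induction z using TensorProduct.induction_on with
  | zero => simpa using smul 0 _ one
  | add z w hz hw => exact add _ _ hz hw
  | tmul a b =>
    induction a using induction_left with
    | one => exact key b
    | smul c a ha => rw [← TensorProduct.smul_tmul']; exact smul c _ ha
    | mul s v hv a ha => exact mulL s v hv _ ha
    | add a c ha hc => rw [TensorProduct.add_tmul]; exact add _ _ ha hc

theorem one_mem_deg : (1 : S k n) ∈ deg k n 0 := SetLike.GradedOne.one_mem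

theorem ι_mul_mem_deg (v : V k n) {d : ℕ} {a : S k n} (ha : a ∈ deg k n d) :
    ι k n v * a ∈ deg k n (d + 1) := by
  rw [deg, pow_succ']
  exact Submodule.mul_mem_mul (LinearMap.mem_range_self _ _) ha

theorem deg_induction {P : ℕ → S k n → Prop} (one : P 0 1)
    (smul : ∀ d (c : k) a, P d a → P d (c • a))
    (add : ∀ d a b, P d a → P d b → P d (a + b))
    (mul : ∀ d s, ∀ v ∈ vPart k n s, ∀ a, P d a → P (d + 1) (ι k n v * a))
    {d : ℕ} {a : S k n} (ha : a ∈ deg k n d) : P d a := by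
  unfold deg at ha
  induction ha using Submodule.pow_induction_on_left' with
  | algebraMap c => rw [Algebra.algebraMap_eq_smul_one]; exact smul _ _ _ one
  | add _ _ _ _ _ hx hy => exact add _ _ _ hx hy
  | mem_mul _ hm d _ _ ih =>
    obtain ⟨v, rfl⟩ := hm
    obtain ⟨v₀, h₀, v₁, h₁, rfl⟩ := vSplit v
    rw [map_add, add_mul]
    exact add _ _ _ (mul _ _ _ h₀ _ ih) (mul _ _ _ h₁ _ ih)

/-- The predicate carries the bidegree because the binomial coefficients of the rung swap depend on
it. -/
theorem tensor_deg_induction {P : ℕ → ℕ → S k n ⊗[k] S k n → Prop} (one : P 0 0 (1 ⊗ₜ 1))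
    (smul : ∀ a b (c : k) z, P a b z → P a b (c • z))
    (add : ∀ a b z w, P a b z → P a b w → P a b (z + w))
    (mulL : ∀ a b s, ∀ v ∈ vPart k n s, ∀ z, P a b z → P (a + 1) b (mulL v z))
    (mulR : ∀ a b s, ∀ v ∈ vPart k n s, ∀ z, P a b z → P a (b + 1) (mulR s v z))
    {a b : ℕ} {x y : S k n} (hx : x ∈ deg k n a) (hy : y ∈ deg k n b) : P a b (x ⊗ₜ y) := by
  have key : P 0 b (1 ⊗ₜ y) := by
    refine deg_induction (P := fun b y => P 0 b (1 ⊗ₜ y)) one ?_ ?_ ?_ hy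
    · intro d c b hb
      rw [TensorProduct.tmul_smul]; exact smul _ _ c _ hb
    · intro d b c hb hc
      rw [TensorProduct.tmul_add]; exact add _ _ _ _ hb hc
    · intro d s v hv b hb
      simpa using mulR _ _ s v hv _ hb
  refine deg_induction (P := fun a x => P a b (x ⊗ₜ y)) key ?_ ?_ ?_ hx
  · intro d c b hb
    rw [← TensorProduct.smul_tmul']; exact smul _ _ c _ hb
  · intro d b c hb hc
    rw [TensorProduct.add_tmul]; exact add _ _ _ _ hb hc
  · intro d s v hv a ha
    exact mulL _ _ s v hv _ ha

theorem twist_twist_comm (p q : ZMod 2) (a : S k n) :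
    twist k n p (twist k n q a) = twist k n (p + q) a := by
  have : (twist k n p).comp (twist k n q) = twist k n (p + q) := hom_ext fun v => by
    obtain ⟨v₀, h₀, v₁, h₁, rfl⟩ := vSplit v
    simp [twist_ι h₀, twist_ι h₁, smul_smul, koszul_add_left, mul_comm]
  exact DFunLike.congr_fun this a

/-- Moving a homogeneous vector from the right end of a product to the left costs exactly the sign
recorded by `twist`. Rungs create products with a vector in the middle, and this rule normalises
them. -/
theorem mul_ι {s : ZMod 2} {v : V k n} (hv : v ∈ vPart k n s) (a : S k n) :
    a * ι k n v = ι k n v * twist k n s a := by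
  induction a using induction_left with
  | one => simp
  | smul c a ha => simp [ha]
  | mul t w hw a ha =>
    rw [mul_assoc, ha, map_mul, twist_ι hw, ← mul_assoc, ι_mul_ι hw hv, smul_mul_assoc,
      smul_mul_assoc, mul_smul_comm, mul_assoc, koszul_comm]
  | add a b ha hb => rw [add_mul, ha, hb, map_add, mul_add]

theorem map_twist_mulL (p : ZMod 2) {s : ZMod 2} {v : V k n} (hv : v ∈ vPart k n s)
    (z : S k n ⊗[k] S k n) :
    TensorProduct.map (twist k n p).toLinearMap (twist k n p).toLinearMap (mulL v z) =
      koszul k p s • mulL v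
        (TensorProduct.map (twist k n p).toLinearMap (twist k n p).toLinearMap z) := by
  induction z using TensorProduct.induction_on with
  | zero => simp
  | add z w hz hw => simp only [map_add, smul_add, hz, hw]
  | tmul a b => simp [twist_ι hv, TensorProduct.smul_tmul']

theorem map_twist_mulR (p : ZMod 2) {s : ZMod 2} {v : V k n} (hv : v ∈ vPart k n s)
    (z : S k n ⊗[k] S k n) :
    TensorProduct.map (twist k n p).toLinearMap (twist k n p).toLinearMap (mulR s v z) =
      koszul k p s • mulR s v
        (TensorProduct.map (twist k n p).toLinearMap (twist k n p).toLinearMap z) := by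
  induction z using TensorProduct.induction_on with
  | zero => simp
  | add z w hz hw => simp only [map_add, smul_add, hz, hw]
  | tmul a b => simp [twist_ι hv, TensorProduct.tmul_smul, twist_twist_comm, add_comm]

variable [NeZero (2 : k)]

theorem comul_one : comul (1 : S k n) = 1 ⊗ₜ[k] 1 := by
  change (GradedTensorProduct.of k (part k n) (part k n)).symm (comulHom 1) = _
  rw [map_one]; rfl

/-- This is multiplicativity of `Δ` together with `Δ(v) = v ⊗ 1 + 1 ⊗ v`, with the product of the
graded tensor product expanded once and for all. Together with `comul_one` it is a recursion from
which the later facts on `Δ` are derived by induction. -/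
theorem comul_ι_mul {s : ZMod 2} {v : V k n} (hv : v ∈ vPart k n s) (a : S k n) :
    comul (ι k n v * a) = mulL v (comul a) + mulR s v (comul a) := by
  have key : ∀ z : S k n ⊗[k] S k n,
      (GradedTensorProduct.of k (part k n) (part k n)).symm
        (comulHom (ι k n v) * GradedTensorProduct.of k (part k n) (part k n) z) =
      mulL v z + mulR s v z := by
    intro z
    induction z using TensorProduct.induction_on with
    | zero => simp
    | add z w hz hw => rw [map_add, mul_add, map_add, hz, hw, map_add, map_add]; abel
    | tmul a b =>
      -- The sign in the product `(1 ⊗ v)(a ⊗ b)` depends on the parity of `a`, so `a` is split into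
      -- homogeneous parts.
      obtain ⟨a₀, h₀, a₁, h₁, rfl⟩ : ∃ a₀ ∈ part k n 0, ∃ a₁ ∈ part k n 1, a₀ + a₁ = a :=
        Submodule.mem_sup.mp (isCompl_part (k := k) (n := n).sup_eq_top ▸ Submodule.mem_top)
      have hom : ∀ t, ∀ a ∈ part k n t, (GradedTensorProduct.of k (part k n) (part k n)).symm
          (comulHom (ι k n v) * GradedTensorProduct.of k (part k n) (part k n) (a ⊗ₜ b)) =
          mulL v (a ⊗ₜ b) + mulR s v (a ⊗ₜ b) := by
        intro t a ha
        have e : comulHom (ι k n v) = GradedTensorProduct.tmul k (𝒜 := part k n)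
            (ℬ := part k n) (ι k n v) 1 +
            GradedTensorProduct.tmul k (𝒜 := part k n) (ℬ := part k n) 1 (ι k n v) := by
          rw [comulHom, lift_ι]; rfl
        have e₁ := GradedTensorProduct.tmul_one_mul_coe_tmul (R := k) (part k n) (part k n)
          (ι k n v) ⟨a, ha⟩ b
        have e₂ := GradedTensorProduct.tmul_coe_mul_coe_tmul (R := k) (part k n) (part k n)
          1 ⟨_, ι_mem_part hv⟩ ⟨a, ha⟩ b
        rw [e, add_mul, map_add]
        refine congrArg₂ (· + ·) (congrArg _ e₁) ((congrArg _ e₂).trans ?_)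
        rw [mulR_tmul, twist_of_mem ha, one_mul]
        rcases zmod2_cases s with rfl | rfl <;> rcases zmod2_cases t with rfl | rfl <;>
          simp [TensorProduct.neg_tmul]
      rw [TensorProduct.add_tmul, map_add, mul_add, map_add, map_add, map_add, hom _ _ h₀,
        hom _ _ h₁]
      abel
  refine Eq.trans ?_ (key (comul a))
  change (GradedTensorProduct.of k (part k n) (part k n)).symm (comulHom (ι k n v * a)) = _
  rw [map_mul]
  rfl

theorem comul_twist (p : ZMod 2) (a : S k n) :
    comul (twist k n p a) =
      TensorProduct.map (twist k n p).toLinearMap (twist k n p).toLinearMap (comul a) := by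
  induction a using induction_left with
  | one => simp [comul_one]
  | smul c a ha => simp only [map_smul, ha]
  | add a b ha hb => simp only [map_add, ha, hb]
  | mul s v hv a ha =>
    rw [map_mul, twist_ι hv, smul_mul_assoc, map_smul, comul_ι_mul hv, comul_ι_mul hv, ha, map_add,
      map_twist_mulL p hv, map_twist_mulR p hv, smul_add]

end coproduct
end S
end
end PWebs

namespace PWebs
noncomputable section
namespace S

/-! ## Projections to degrees and coordinates -/

section projections
variable {k : Type u} [Field k] {n : ℕ}

variable (k n) in
/-- The projection of `S(V)` onto its part of degree `r`, as an endomorphism of `S(V)`; it is zero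
when `r` is negative. -/
def pdeg (r : ℤ) : S k n →ₗ[k] S k n :=
  if 0 ≤ r then (deg k n r.toNat).subtype ∘ₗ projDeg k n r.toNat else 0

theorem projDeg_of_mem {d e : ℕ} {a : S k n} (ha : a ∈ deg k n d) :
    (projDeg k n e a : S k n) = if e = d then a else 0 := by
  split_ifs with h
  · subst h
    exact DirectSum.decompose_of_mem_same _ ha
  · exact DirectSum.decompose_of_mem_ne _ ha (Ne.symm h)

theorem pdeg_natCast (d : ℕ) (a : S k n) : pdeg k n d a = projDeg k n d a := by
  simp [pdeg]

theorem pdeg_of_mem {d : ℕ} {a : S k n} (ha : a ∈ deg k n d) (r : ℤ) :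
    pdeg k n r a = if r = d then a else 0 := by
  by_cases hr : 0 ≤ r
  · lift r to ℕ using hr
    rw [pdeg_natCast, projDeg_of_mem ha]
    norm_cast
  · rw [if_neg (by omega), pdeg, if_neg hr, LinearMap.zero_apply]

theorem ext_deg {X : Type*} [AddCommGroup X] [Module k X] {f g : S k n →ₗ[k] X}
    (h : ∀ d, ∀ a ∈ deg k n d, f a = g a) : f = g := by
  ext a
  induction a using DirectSum.Decomposition.inductionOn (deg k n) with
  | zero => simp
  | homogeneous a => exact h _ _ a.2
  | add a b ha hb => rw [map_add, map_add, ha, hb]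

theorem pdeg_one (r : ℤ) : pdeg k n r 1 = if r = 0 then 1 else 0 := by
  simpa using pdeg_of_mem one_mem_deg r

/-- Degrees are integers here so that `r - 1` needs no side condition: at `r = 0` both sides vanish,
because `pdeg` is zero at negative indices. -/
theorem pdeg_ι_mul (r : ℤ) (v : V k n) (a : S k n) :
    pdeg k n r (ι k n v * a) = ι k n v * pdeg k n (r - 1) a := by
  refine DFunLike.congr_fun (f := pdeg k n r ∘ₗ LinearMap.mulLeft k (ι k n v))
    (g := LinearMap.mulLeft k (ι k n v) ∘ₗ pdeg k n (r - 1)) (ext_deg fun d a ha => ?_) a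
  simp only [LinearMap.comp_apply, LinearMap.mulLeft_apply, pdeg_of_mem ha,
    pdeg_of_mem (ι_mul_mem_deg v ha)]
  by_cases h : r = (d + 1 : ℕ)
  · rw [if_pos h, if_pos (by push_cast at h; omega)]
  · rw [if_neg h, if_neg (by push_cast at h; omega), mul_zero]

theorem pdeg_twist (r : ℤ) (p : ZMod 2) (a : S k n) :
    pdeg k n r (twist k n p a) = twist k n p (pdeg k n r a) := by
  refine DFunLike.congr_fun (f := pdeg k n r ∘ₗ (twist k n p).toLinearMap)
    (g := (twist k n p).toLinearMap ∘ₗ pdeg k n r) (ext_deg fun d a ha => ?_) a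
  simp only [LinearMap.comp_apply, AlgHom.toLinearMap_apply, pdeg_of_mem ha,
    pdeg_of_mem (twist_mem_deg p ha)]
  split_ifs <;> simp

/-- `S^0(V)` is `k` itself rather than a submodule of `S(V)`, and its projection is the counit. This
identifies that projection with the projection to degree zero. -/
theorem pdeg_zero (a : S k n) : pdeg k n 0 a = algebraMap k _ (counit a) := by
  induction a using induction_left with
  | one => simp [pdeg_one]
  | smul c a ha => rw [map_smul, ha, map_smul, Algebra.smul_def, smul_eq_mul, map_mul]
  | add a b ha hb => simp only [map_add, ha, hb]
  | mul s v hv a ha => 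
    rw [pdeg_ι_mul, map_mul, counit, lift_ι]
    simp [pdeg]

variable (k n)

/-- The projection of `S(V)` onto `V`. -/
def vProj : S k n →ₗ[k] V k n :=
  TrivSqZeroExt.sndHom k (V k n) ∘ₗ
    (lift (TrivSqZeroExt.inrHom k (V k n)) (by simp) :
      S k n →ₐ[k] TrivSqZeroExt k (V k n)).toLinearMap

variable {k n}

@[simp] theorem vProj_one : vProj k n 1 = 0 := by simp [vProj]

@[simp] theorem vProj_ι (v : V k n) : vProj k n (ι k n v) = v := by simp [vProj]

/-- In the square-zero extension `k ⊕ V`, a product with an element of `V` sees only the scalar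
component of the other factor, and that component is the counit. -/
theorem vProj_ι_mul (v : V k n) (a : S k n) : vProj k n (ι k n v * a) = counit a • v := by
  have : TrivSqZeroExt.fst ((lift (TrivSqZeroExt.inrHom k (V k n)) (by simp) :
      S k n →ₐ[k] TrivSqZeroExt k (V k n)) a) = counit a := by
    induction a using S.induction with
    | algebraMap c => simp [TrivSqZeroExt.algebraMap_eq_inl]
    | ι v => simp [counit]
    | mul a b ha hb => simp [ha, hb]
    | add a b ha hb => simp [ha, hb]
  simp [vProj, this]

theorem counit_twist (p : ZMod 2) (a : S k n) : counit (twist k n p a) = counit a := by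
  have : (counit (k := k) (n := n)).comp (twist k n p) = counit := hom_ext fun v => by
    simp [counit, twist]
  exact DFunLike.congr_fun this a

theorem counit_ι_mul (v : V k n) (a : S k n) : counit (ι k n v * a) = 0 := by
  simp [counit]

theorem vProj_twist (p : ZMod 2) (a : S k n) :
    vProj k n (twist k n p a) = vTwist k n p (vProj k n a) := by
  induction a using induction_left with
  | one => simp
  | smul c a ha => simp only [map_smul, ha]
  | add a b ha hb => simp only [map_add, ha, hb]
  | mul s v hv a ha =>
    rw [map_mul, twist_ι hv, smul_mul_assoc, map_smul, vProj_ι_mul, vProj_ι_mul, map_smul,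
      vTwist_of_mem hv, counit_twist, smul_comm]

theorem counit_of_mem {d : ℕ} {a : S k n} (ha : a ∈ deg k n d) (hd : d ≠ 0) : counit a = 0 := by
  revert hd
  refine deg_induction (P := fun d a => d ≠ 0 → counit a = 0) ?_ ?_ ?_ ?_ ha
  · simp
  · intro d c a ha hd; rw [map_smul, ha hd, smul_zero]
  · intro d a b ha hb hd; rw [map_add, ha hd, hb hd, add_zero]
  · intro d s v hv a ha hd; exact counit_ι_mul v a

theorem vProj_of_mem {d : ℕ} {a : S k n} (ha : a ∈ deg k n d) (hd : d ≠ 1) :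
    vProj k n a = 0 := by
  refine (deg_induction (P := fun d a => a ∈ deg k n d ∧ (d ≠ 1 → vProj k n a = 0))
    ?_ ?_ ?_ ?_ ha).2 hd
  · exact ⟨one_mem_deg, by simp⟩
  · intro d c a ha
    exact ⟨Submodule.smul_mem _ _ ha.1, fun hd => by rw [map_smul, ha.2 hd, smul_zero]⟩
  · intro d a b ha hb
    exact ⟨add_mem ha.1 hb.1, fun hd => by rw [map_add, ha.2 hd, hb.2 hd, add_zero]⟩
  · intro d s v hv a ha
    exact ⟨ι_mul_mem_deg v ha.1, fun hd => by
      rw [vProj_ι_mul, counit_of_mem ha.1 (by simpa using hd), zero_smul]⟩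

theorem vProj_pdeg_one (a : S k n) : vProj k n (pdeg k n 1 a) = vProj k n a := by
  refine DFunLike.congr_fun (f := vProj k n ∘ₗ pdeg k n 1) (ext_deg fun d a ha => ?_) a
  rw [LinearMap.comp_apply, pdeg_of_mem ha]
  split_ifs with h
  · rfl
  · rw [map_zero, vProj_of_mem ha fun h' => h (by simp [h'])]

end projections
end S
end
end PWebs

namespace PWebs
noncomputable section

theorem Idx.parity_swap {n : ℕ} (i : Idx n) : Idx.parity i.swap = 1 + i.parity := by
  rcases i with i | i
  · rfl
  · exact zmod2_one_add_one.symm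

namespace S

/-! ## Bialgebra axioms and ladder operators -/

section operators
variable {k : Type u} [Field k] [NeZero (2 : k)] {n : ℕ}

theorem counit_comul (a : S k n) :
    TensorProduct.lid k _ (TensorProduct.map counit.toLinearMap LinearMap.id (comul a)) = a := by
  induction a using induction_left with
  | one => simp [comul_one]
  | smul c a ha => simp only [map_smul, ha]
  | add a b ha hb => simp only [map_add, ha, hb]
  | mul s v hv a ha =>
    -- The induction hypothesis expresses the `a` on the right-hand side through `comul a`. Then
    -- `comul a` may be replaced by an arbitrary tensor, and pure tensors suffice.
    nth_rewrite 2 [← ha]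
    rw [comul_ι_mul hv]
    generalize comul a = z
    induction z using TensorProduct.induction_on with
    | zero => simp
    | add z w hz hw =>
      simp only [map_add, mul_add] at *
      rw [← hz, ← hw]
      abel
    | tmul a b => simp [counit_ι_mul, counit_twist]

theorem comul_counit (a : S k n) :
    TensorProduct.rid k _ (TensorProduct.map LinearMap.id counit.toLinearMap (comul a)) = a := by
  induction a using induction_left with
  | one => simp [comul_one]
  | smul c a ha => simp only [map_smul, ha]
  | add a b ha hb => simp only [map_add, ha, hb]
  | mul s v hv a ha =>
    nth_rewrite 2 [← ha]
    rw [comul_ι_mul hv]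
    generalize comul a = z
    induction z using TensorProduct.induction_on with
    | zero => simp
    | add z w hz hw =>
      simp only [map_add, mul_add] at *
      rw [← hz, ← hw]
      abel
    | tmul a b => simp [counit_ι_mul]

/-- Both sides satisfy the same recursion: left multiplication of `a` by `v` becomes the sum of the
left multiplications by `v ⊗ 1 ⊗ 1`, `1 ⊗ v ⊗ 1` and `1 ⊗ 1 ⊗ v`, with Koszul signs. `h₁`, `h₂` and
`h₃` carry these three through the associator. -/
theorem comul_coassoc (a : S k n) :
    TensorProduct.assoc k _ _ _ (TensorProduct.map comul LinearMap.id (comul a)) =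
      TensorProduct.map LinearMap.id comul (comul a) := by
  have h₁ : ∀ (v : V k n) (w : S k n ⊗[k] S k n) (b : S k n),
      TensorProduct.assoc k _ _ _ (mulL v w ⊗ₜ b) =
        TensorProduct.map (LinearMap.mulLeft k (ι k n v)) LinearMap.id
          (TensorProduct.assoc k _ _ _ (w ⊗ₜ b)) := fun v w b => by
    induction w using TensorProduct.induction_on with
    | zero => simp
    | add z w hz hw => simp only [map_add, TensorProduct.add_tmul, hz, hw]
    | tmul a b => simp
  have h₂ : ∀ (s : ZMod 2) (v : V k n) (w : S k n ⊗[k] S k n) (b : S k n),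
      TensorProduct.assoc k _ _ _ (mulR s v w ⊗ₜ b) =
        TensorProduct.map (twist k n s).toLinearMap (mulL v)
          (TensorProduct.assoc k _ _ _ (w ⊗ₜ b)) := fun s v w b => by
    induction w using TensorProduct.induction_on with
    | zero => simp
    | add z w hz hw => simp only [map_add, TensorProduct.add_tmul, hz, hw]
    | tmul a b => simp
  have h₃ : ∀ (s : ZMod 2) (v : V k n) (w : S k n ⊗[k] S k n) (b : S k n),
      TensorProduct.assoc k _ _ _ (TensorProduct.map (twist k n s).toLinearMap
          (twist k n s).toLinearMap w ⊗ₜ (ι k n v * b)) =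
        TensorProduct.map (twist k n s).toLinearMap (mulR s v)
          (TensorProduct.assoc k _ _ _ (w ⊗ₜ b)) := fun s v w b => by
    induction w using TensorProduct.induction_on with
    | zero => simp
    | add z w hz hw => simp only [map_add, TensorProduct.add_tmul, hz, hw]
    | tmul a b => simp
  induction a using induction_left with
  | one => simp [comul_one]
  | smul c a ha => simp only [map_smul, ha]
  | add a b ha hb => simp only [map_add, ha, hb]
  | mul s v hv a ha =>
    have e₁ : ∀ z : S k n ⊗[k] S k n,
        TensorProduct.assoc k _ _ _ (TensorProduct.map comul LinearMap.id
          (mulL v z + mulR s v z)) =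
        TensorProduct.map (LinearMap.mulLeft k (ι k n v)) LinearMap.id (TensorProduct.assoc k _ _ _
          (TensorProduct.map comul LinearMap.id z)) +
        TensorProduct.map (twist k n s).toLinearMap (mulL v) (TensorProduct.assoc k _ _ _
          (TensorProduct.map comul LinearMap.id z)) +
        TensorProduct.map (twist k n s).toLinearMap (mulR s v) (TensorProduct.assoc k _ _ _
          (TensorProduct.map comul LinearMap.id z)) := fun z => by
      induction z using TensorProduct.induction_on with
      | zero => simp
      | add z w hz hw =>
        simp only [map_add] at *
        rw [add_add_add_comm, hz, hw]
        abel
      | tmul a b =>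
        simp only [mulL_tmul, mulR_tmul, map_add, TensorProduct.map_tmul, LinearMap.id_apply,
          comul_ι_mul hv, comul_twist, TensorProduct.add_tmul, h₁, h₂, h₃]
    have e₂ : ∀ z : S k n ⊗[k] S k n,
        TensorProduct.map LinearMap.id comul (mulL v z + mulR s v z) =
        TensorProduct.map (LinearMap.mulLeft k (ι k n v)) LinearMap.id
          (TensorProduct.map LinearMap.id comul z) +
        TensorProduct.map (twist k n s).toLinearMap (mulL v)
          (TensorProduct.map LinearMap.id comul z) +
        TensorProduct.map (twist k n s).toLinearMap (mulR s v)
          (TensorProduct.map LinearMap.id comul z) := fun z => by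
      induction z using TensorProduct.induction_on with
      | zero => simp
      | add z w hz hw =>
        simp only [map_add] at *
        rw [add_add_add_comm, hz, hw]
        abel
      | tmul a b =>
        simp [comul_ι_mul hv, TensorProduct.tmul_add, add_assoc]
    rw [comul_ι_mul hv, e₁, e₂, ha]

/-! ### Graded components of the coproduct, rungs and the rung swap -/

/-- The component of the coproduct whose right factor has degree `r`. -/
def comulR (r : ℤ) : S k n →ₗ[k] S k n ⊗[k] S k n :=
  TensorProduct.map LinearMap.id (pdeg k n r) ∘ₗ comul

/-- The component of the coproduct whose left factor has degree `r`. -/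
def comulL (r : ℤ) : S k n →ₗ[k] S k n ⊗[k] S k n :=
  TensorProduct.map (pdeg k n r) LinearMap.id ∘ₗ comul

theorem comulR_one (r : ℤ) : comulR r (1 : S k n) = if r = 0 then 1 ⊗ₜ 1 else 0 := by
  rw [comulR, LinearMap.comp_apply, comul_one, TensorProduct.map_tmul, pdeg_one]
  split_ifs <;> simp

theorem comulL_one (r : ℤ) : comulL r (1 : S k n) = if r = 0 then 1 ⊗ₜ 1 else 0 := by
  rw [comulL, LinearMap.comp_apply, comul_one, TensorProduct.map_tmul, pdeg_one]
  split_ifs <;> simp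

theorem comulR_ι_mul (r : ℤ) {s : ZMod 2} {v : V k n} (hv : v ∈ vPart k n s) (a : S k n) :
    comulR r (ι k n v * a) = mulL v (comulR r a) + mulR s v (comulR (r - 1) a) := by
  simp only [comulR, LinearMap.comp_apply, comul_ι_mul hv]
  generalize comul a = z
  induction z using TensorProduct.induction_on with
  | zero => simp
  | add z w hz hw =>
    simp only [map_add] at *
    rw [add_add_add_comm, hz, hw]
    abel
  | tmul a b => simp [pdeg_ι_mul]

theorem comulL_ι_mul (r : ℤ) {s : ZMod 2} {v : V k n} (hv : v ∈ vPart k n s) (a : S k n) :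
    comulL r (ι k n v * a) = mulL v (comulL (r - 1) a) + mulR s v (comulL r a) := by
  simp only [comulL, LinearMap.comp_apply, comul_ι_mul hv]
  generalize comul a = z
  induction z using TensorProduct.induction_on with
  | zero => simp
  | add z w hz hw =>
    simp only [map_add] at *
    rw [add_add_add_comm, hz, hw]
    abel
  | tmul a b => simp [pdeg_ι_mul, pdeg_twist]

theorem comulR_twist (r : ℤ) (p : ZMod 2) (a : S k n) :
    comulR r (twist k n p a) =
      TensorProduct.map (twist k n p).toLinearMap (twist k n p).toLinearMap (comulR r a) := by
  simp only [comulR, LinearMap.comp_apply, comul_twist]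
  generalize comul a = z
  induction z using TensorProduct.induction_on with
  | zero => simp
  | add z w hz hw => simp only [map_add, hz, hw]
  | tmul a b => simp [pdeg_twist]

/-- The rung of thickness `r` from left to right: `x ⊗ y ↦ ∑ x₁ ⊗ x₂ y` with `x₂` of degree `r`. -/
def rungE (r : ℤ) : S k n ⊗[k] S k n →ₗ[k] S k n ⊗[k] S k n :=
  TensorProduct.map LinearMap.id (LinearMap.mul' k (S k n)) ∘ₗ
    (TensorProduct.assoc k _ _ _).toLinearMap ∘ₗ TensorProduct.map (comulR r) LinearMap.id

/-- The rung of thickness `r` from right to left: `x ⊗ y ↦ ∑ x y₁ ⊗ y₂` with `y₁` of degree `r`. -/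
def rungF (r : ℤ) : S k n ⊗[k] S k n →ₗ[k] S k n ⊗[k] S k n :=
  TensorProduct.map (LinearMap.mul' k (S k n)) LinearMap.id ∘ₗ
    (TensorProduct.assoc k _ _ _).symm.toLinearMap ∘ₗ TensorProduct.map LinearMap.id (comulL r)

theorem rungE_tmul (r : ℤ) (a b : S k n) :
    rungE r (a ⊗ₜ b) =
      TensorProduct.map LinearMap.id (LinearMap.mulRight k b) (comulR r a) := by
  simp only [rungE, LinearMap.comp_apply, TensorProduct.map_tmul, LinearMap.id_apply,
    LinearEquiv.coe_coe]
  generalize comulR r a = z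
  induction z using TensorProduct.induction_on with
  | zero => simp
  | add z w hz hw => simp only [map_add, TensorProduct.add_tmul, hz, hw]
  | tmul a b => simp

theorem rungF_tmul (r : ℤ) (a b : S k n) :
    rungF r (a ⊗ₜ b) =
      TensorProduct.map (LinearMap.mulLeft k a) LinearMap.id (comulL r b) := by
  simp only [rungF, LinearMap.comp_apply, TensorProduct.map_tmul, LinearMap.id_apply,
    LinearEquiv.coe_coe]
  generalize comulL r b = z
  induction z using TensorProduct.induction_on with
  | zero => simp
  | add z w hz hw => simp only [map_add, TensorProduct.tmul_add, hz, hw]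
  | tmul a b => simp

theorem rungE_one (r : ℤ) : rungE r (1 ⊗ₜ (1 : S k n)) = if r = 0 then 1 ⊗ₜ 1 else 0 := by
  rw [rungE_tmul, comulR_one]
  split_ifs <;> simp

theorem rungF_one (r : ℤ) : rungF r (1 ⊗ₜ (1 : S k n)) = if r = 0 then 1 ⊗ₜ 1 else 0 := by
  rw [rungF_tmul, comulL_one]
  split_ifs <;> simp

/-- When `v x` is split, the vector `v` either stays on the left upright or travels along the rung,
where it uses up one unit of thickness. -/
theorem rungE_mulL (r : ℤ) {s : ZMod 2} {v : V k n} (hv : v ∈ vPart k n s)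
    (z : S k n ⊗[k] S k n) :
    rungE r (mulL v z) = mulL v (rungE r z) + mulR s v (rungE (r - 1) z) := by
  induction z using TensorProduct.induction_on with
  | zero => simp
  | add z w hz hw =>
    simp only [map_add, hz, hw]
    abel
  | tmul a b =>
    rw [mulL_tmul, rungE_tmul, rungE_tmul, rungE_tmul, comulR_ι_mul r hv, map_add]
    congr 1
    · generalize comulR r a = w
      induction w using TensorProduct.induction_on with
      | zero => simp
      | add z w hz hw => simp only [map_add, hz, hw]
      | tmul x y => simp
    · generalize comulR (r - 1) a = w
      induction w using TensorProduct.induction_on with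
      | zero => simp
      | add z w hz hw => simp only [map_add, hz, hw]
      | tmul x y => simp [mul_assoc]

/-- The part of `x` that travels along the rung lands to the left of `v`. The sign for exchanging
the two is the one that `mulR` already contains for this part of `x`, so the signs cancel. -/
theorem rungE_mulR (r : ℤ) {s : ZMod 2} {v : V k n} (hv : v ∈ vPart k n s)
    (z : S k n ⊗[k] S k n) : rungE r (mulR s v z) = mulR s v (rungE r z) := by
  induction z using TensorProduct.induction_on with
  | zero => simp
  | add z w hz hw => simp only [map_add, hz, hw]
  | tmul a b =>
    rw [mulR_tmul, rungE_tmul, rungE_tmul, comulR_twist]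
    generalize comulR r a = w
    induction w using TensorProduct.induction_on with
    | zero => simp
    | add z w hz hw => simp only [map_add, hz, hw]
    | tmul x y => simp [← mul_assoc, mul_ι hv, twist_twist]

theorem rungF_mulL (r : ℤ) (v : V k n) (z : S k n ⊗[k] S k n) :
    rungF r (mulL v z) = mulL v (rungF r z) := by
  induction z using TensorProduct.induction_on with
  | zero => simp
  | add z w hz hw => simp only [map_add, hz, hw]
  | tmul a b =>
    rw [mulL_tmul, rungF_tmul, rungF_tmul]
    generalize comulL r b = w
    induction w using TensorProduct.induction_on with
    | zero => simp
    | add z w hz hw => simp only [map_add, hz, hw]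
    | tmul x y => simp

theorem rungF_mulR (r : ℤ) {s : ZMod 2} {v : V k n} (hv : v ∈ vPart k n s)
    (z : S k n ⊗[k] S k n) :
    rungF r (mulR s v z) = mulR s v (rungF r z) + mulL v (rungF (r - 1) z) := by
  induction z using TensorProduct.induction_on with
  | zero => simp
  | add z w hz hw =>
    simp only [map_add, hz, hw]
    abel
  | tmul a b =>
    rw [mulR_tmul, rungF_tmul, rungF_tmul, rungF_tmul, comulL_ι_mul r hv, map_add, add_comm]
    congr 1
    · generalize comulL r b = w
      induction w using TensorProduct.induction_on with
      | zero => simp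
      | add z w hz hw => simp only [map_add, hz, hw]
      | tmul x y => simp
    · generalize comulL (r - 1) b = w
      induction w using TensorProduct.induction_on with
      | zero => simp
      | add z w hz hw => simp only [map_add, hz, hw]
      | tmul x y => simp [← mul_assoc, mul_ι hv, twist_twist]

theorem rungE_of_neg {r : ℤ} (hr : r < 0) (z : S k n ⊗[k] S k n) : rungE r z = 0 := by
  simp [rungE, comulR, pdeg, not_le.mpr hr]

theorem rungF_of_neg {r : ℤ} (hr : r < 0) (z : S k n ⊗[k] S k n) : rungF r z = 0 := by
  simp [rungF, comulL, pdeg, not_le.mpr hr]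

/-- The rung swap. -/
theorem rungF_rungE {a b : ℕ} {x y : S k n} (hx : x ∈ deg k n a) (hy : y ∈ deg k n b)
    (r s : ℤ) (N : ℕ) (hN : r < N ∨ s < N) :
    rungF r (rungE s (x ⊗ₜ y)) = ∑ t ∈ Finset.range N,
      ((Ring.choose ((a : ℤ) - b + r - s) t : ℤ) : k) •
        rungE (s - t) (rungF (r - t) (x ⊗ₜ y)) := by
  -- The induction steps use the hypothesis at `(r, s - 1)`, `(r - 1, s)` and `(r - 1, s - 1)` as
  -- well, so `r` and `s` stay general. The bound `N` only has to exceed one of them: for `t ≥ N`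
  -- one of the two rungs then has negative thickness.
  revert r s N
  -- Pascal's rule summed against an arbitrary family. The second sum is shorter by one because its
  -- index has been shifted.
  have pascal : ∀ (m : ℤ) (G : ℕ → S k n ⊗[k] S k n) (N : ℕ), G N = 0 →
      ∑ t ∈ Finset.range N, ((Ring.choose (m + 1) t : ℤ) : k) • G t =
        ∑ t ∈ Finset.range N, ((Ring.choose m t : ℤ) : k) • G t +
        ∑ t ∈ Finset.range (N - 1), ((Ring.choose m t : ℤ) : k) • G (t + 1) := by
    intro m G N hG
    rcases N with - | N
    · simp
    · rw [Finset.sum_range_succ', Finset.sum_range_succ' _ N, Nat.add_sub_cancel]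
      simp only [Ring.choose_succ_succ, Ring.choose_zero_right, Int.cast_add, add_smul,
        Finset.sum_add_distrib]
      abel
  -- Lowering `r` and `s` together leaves `m + r - s` unchanged. The hypothesis at `(r - 1, s - 1)`
  -- thus has the same coefficients as the one at `(r, s)`, with the summands moved by one place,
  -- which is the second sum in Pascal's rule.
  have shift : ∀ (m : ℤ) (z : S k n ⊗[k] S k n),
      (∀ (r s : ℤ) (N : ℕ), r < N ∨ s < N → rungF r (rungE s z) = ∑ t ∈ Finset.range N,
        ((Ring.choose (m + r - s) t : ℤ) : k) • rungE (s - t) (rungF (r - t) z)) →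
      ∀ (r s : ℤ) (N : ℕ), r < N ∨ s < N →
        rungF (r - 1) (rungE (s - 1) z) = ∑ t ∈ Finset.range (N - 1),
          ((Ring.choose (m + r - s) t : ℤ) : k) •
            rungE (s - (t + 1 : ℕ)) (rungF (r - (t + 1 : ℕ)) z) := by
    intro m z hz r s N hN
    by_cases h : r - 1 < 0 ∨ s - 1 < 0
    · rw [Finset.sum_eq_zero]
      · rcases h with h | h
        · exact rungF_of_neg h _
        · rw [rungE_of_neg h, map_zero]
      · intro t _
        rcases h with h | h
        · rw [rungF_of_neg (by push_cast; omega), map_zero, smul_zero]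
        · rw [rungE_of_neg (by push_cast; omega), smul_zero]
    · rw [hz _ _ (N - 1) (by omega)]
      refine Finset.sum_congr rfl fun t _ => ?_
      rw [show m + (r - 1) - (s - 1) = m + r - s by ring,
        show s - 1 - t = s - (t + 1 : ℕ) by push_cast; ring,
        show r - 1 - t = r - (t + 1 : ℕ) by push_cast; ring]
  refine tensor_deg_induction (P := fun a b z => ∀ (r s : ℤ) (N : ℕ), r < N ∨ s < N →
    rungF r (rungE s z) = ∑ t ∈ Finset.range N,
      ((Ring.choose ((a : ℤ) - b + r - s) t : ℤ) : k) • rungE (s - t) (rungF (r - t) z))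
    ?_ ?_ ?_ ?_ ?_ hx hy
  -- At `1 ⊗ 1` a product of two rungs survives only if both have thickness zero. On the right this
  -- forces `t = r = s`, and the coefficient is then `0` choose `r`, which is zero unless `r = 0`.
  · intro r s N hN
    have h₁ : rungF r (rungE s (1 ⊗ₜ[k] (1 : S k n))) =
        if r = 0 ∧ s = 0 then 1 ⊗ₜ 1 else 0 := by
      rw [rungE_one]
      by_cases hs : s = 0
      · rw [if_pos hs, rungF_one]; simp [hs]
      · simp [hs]
    have h₂ : ∀ t : ℕ, rungE (s - t) (rungF (r - t) (1 ⊗ₜ[k] (1 : S k n))) =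
        if r = t ∧ s = t then 1 ⊗ₜ 1 else 0 := fun t => by
      rw [rungF_one]
      by_cases hr : r = t
      · rw [if_pos (by omega), rungE_one]; simp [hr, sub_eq_zero]
      · rw [if_neg (by omega)]; simp [hr]
    simp only [h₁, h₂]
    by_cases hrs : r = s
    · subst hrs
      by_cases hr : 0 ≤ r
      · lift r to ℕ using hr
        rw [Finset.sum_eq_single r]
        · rcases r with - | r
          · simp
          · have : ((0 : ℕ) : ℤ) - (0 : ℕ) + ((r + 1 : ℕ) : ℤ) - ((r + 1 : ℕ) : ℤ) = 0 := by
              push_cast; ring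
            rw [this, Ring.choose_zero_succ]
            simp
            omega
        · intro t _ ht
          rw [if_neg (by omega), smul_zero]
        · intro h
          rw [Finset.mem_range] at h
          omega
      · rw [if_neg (by omega), Finset.sum_eq_zero]
        intro t _
        rw [if_neg (by omega), smul_zero]
    · rw [if_neg (by omega), Finset.sum_eq_zero]
      intro t _
      rw [if_neg (by omega), smul_zero]
  · intro a b c z hz r s N hN
    simp only [map_smul, hz r s N hN, Finset.smul_sum, smul_comm c]
  · intro a b z w hz hw r s N hN
    simp only [map_add, hz r s N hN, hw r s N hN, smul_add, Finset.sum_add_distrib]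
  -- Let `m = a - b + r - s`; the new coefficients have upper index `m + 1`. On the left, `F_r E_s
  -- L_v = L_v (F_r E_s + F_{r-1} E_{s-1}) + R_v F_r E_{s-1}`. The `R_v` terms are the hypothesis at
  -- `(r, s - 1)`, whose upper index is already `m + 1`; the `L_v` terms match by Pascal's rule.
  · intro a b p v hv z hz r s N hN
    have hz' := shift _ z hz r s N hN
    have e₂ := hz r (s - 1) N (by omega)
    have e₁ := pascal ((a : ℤ) - b + r - s) (fun t => rungE (s - t) (rungF (r - t) z)) N (by
      rcases hN with h | h
      · rw [rungF_of_neg (by omega), map_zero]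
      · rw [rungE_of_neg (by omega)])
    rw [← hz r s N hN, ← hz'] at e₁
    have e₃ := congrArg (mulL v) e₁
    simp only [map_sum, map_smul, map_add] at e₃
    rw [rungE_mulL s hv, map_add, rungF_mulL, rungF_mulR r hv, e₂]
    simp only [rungF_mulL, rungE_mulL _ hv, smul_add, Finset.sum_add_distrib, map_sum, map_smul]
    rw [show ((a + 1 : ℕ) : ℤ) - b + r - s = (a : ℤ) - b + r - s + 1 by push_cast; ring,
      show (a : ℤ) - b + r - (s - 1) = (a : ℤ) - b + r - s + 1 by ring, e₃]
    simp only [sub_right_comm s _ (1 : ℤ)]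
    abel
  -- Now the new upper index is `m - 1`, and `F_r E_s R_v = R_v F_r E_s + L_v F_{r-1} E_s`. The
  -- `L_v` terms are the hypothesis at `(r - 1, s)`. On the right-hand side the `R_v` terms occur
  -- with `t` and with `t + 1`, and Pascal's rule combines them into the sum for `m`.
  · intro a b p v hv z hz r s N hN
    have e₂ := hz (r - 1) s N (by omega)
    have e₁ := pascal ((a : ℤ) - b + r - s - 1) (fun t => rungE (s - t) (rungF (r - t) z)) N (by
      rcases hN with h | h
      · rw [rungF_of_neg (by omega), map_zero]
      · rw [rungE_of_neg (by omega)])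
    -- The summand that is added to the shifted sum contains a rung of negative thickness, so both
    -- sums can run over the same range.
    have e₃ : ∑ t ∈ Finset.range (N - 1), ((Ring.choose ((a : ℤ) - b + r - s - 1) t : ℤ) : k) •
          rungE (s - (t + 1 : ℕ)) (rungF (r - (t + 1 : ℕ)) z) =
        ∑ t ∈ Finset.range N, ((Ring.choose ((a : ℤ) - b + r - s - 1) t : ℤ) : k) •
          rungE (s - t - 1) (rungF (r - t - 1) z) := by
      rcases N with - | N
      · simp
      · rw [Finset.sum_range_succ, Nat.add_sub_cancel]
        have h0 : rungE (s - N - 1) (rungF (r - N - 1) z) = 0 := by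
          rcases hN with h | h
          · rw [rungF_of_neg (by push_cast at h; omega), map_zero]
          · rw [rungE_of_neg (by push_cast at h; omega)]
        rw [h0, smul_zero, add_zero]
        refine Finset.sum_congr rfl fun t _ => ?_
        rw [show s - t - 1 = s - (t + 1 : ℕ) by push_cast; ring,
          show r - t - 1 = r - (t + 1 : ℕ) by push_cast; ring]
    rw [sub_add_cancel, ← hz r s N hN, e₃] at e₁
    have e₄ := congrArg (mulR p v) e₁
    simp only [map_sum, map_smul, map_add] at e₄
    rw [rungE_mulR s hv, rungF_mulR r hv, e₂]
    simp only [rungF_mulR _ hv, map_add, rungE_mulR _ hv, rungE_mulL _ hv, smul_add,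
      Finset.sum_add_distrib, map_sum, map_smul]
    rw [show (a : ℤ) - (b + 1 : ℕ) + r - s = (a : ℤ) - b + r - s - 1 by push_cast; ring,
      show (a : ℤ) - b + (r - 1) - s = (a : ℤ) - b + r - s - 1 by ring, e₄]
    simp only [sub_right_comm r _ (1 : ℤ)]
    abel

end operators
end S
end
end PWebs

namespace PWebs
noncomputable section
namespace S

/-! ## Contractions, caps and cups -/

section contractions
variable {k : Type u} [Field k] {n : ℕ}

variable (k) in
/-- The `i`-th coordinate of the degree one part of an element of `S(V)`. -/
def coord (i : Idx n) : S k n →ₗ[k] k := LinearMap.proj i ∘ₗ vProj k n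

theorem coord_one (i : Idx n) : coord k i 1 = 0 := by simp [coord]

theorem coord_ι_mul (i : Idx n) (v : V k n) (a : S k n) :
    coord k i (ι k n v * a) = counit a * v i := by
  simp [coord, vProj_ι_mul]

theorem coord_twist (i : Idx n) (p : ZMod 2) (a : S k n) :
    coord k i (twist k n p a) = koszul k p i.parity * coord k i a := by
  simp [coord, vProj_twist, vTwist]

/-- A contraction has the parity of its index `i`, a homogeneous vector `v` has its own parity `s`,
and the two meet only through `v i`. Either this coordinate vanishes or the parities agree, which
settles the signs in the contraction rules. -/
theorem eq_parity {s : ZMod 2} {v : V k n} (hv : v ∈ vPart k n s) {i : Idx n} (h : v i ≠ 0) :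
    i.parity = s := by
  by_contra h'
  exact h (hv i h')

variable (k n) in
/-- The form on `S(V) ⊗ S(V)` that vanishes outside of `V ⊗ V`. -/
def capForm : S k n ⊗[k] S k n →ₗ[k] k :=
  TensorProduct.lift ((form k n).compl₁₂ (vProj k n) (vProj k n))

theorem capForm_tmul (a b : S k n) : capForm k n (a ⊗ₜ b) = form k n (vProj k n a) (vProj k n b) :=
  rfl

theorem capForm_eq_sum (a b : S k n) :
    capForm k n (a ⊗ₜ b) = ∑ i : Idx n, coord k i a * coord k i.swap b := rfl

theorem single_mem (i : Idx n) : (Pi.single i 1 : V k n) ∈ vPart k n i.parity := by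
  intro j hj
  rw [Pi.single_apply, if_neg]
  rintro rfl
  exact hj rfl

/-- One of `v_i` and `v_{-i}` is even, so they commute without a sign. -/
theorem koszul_swap (i : Idx n) : koszul k i.parity (Idx.parity i.swap) = 1 := by
  rcases i with i | i <;> simp [Idx.parity]

theorem koszul_swap' (i : Idx n) : koszul k (Idx.parity i.swap) i.parity = 1 := by
  rw [koszul_comm, koszul_swap]

/-- The index swap has no fixed points, so the terms cancel in pairs and no division by 2 is needed.
-/
theorem sum_anti {X : Type*} [AddCommGroup X] {f : Idx n → X} (h : ∀ i, f i.swap = -f i) :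
    ∑ i, f i = 0 := by
  rw [Fintype.sum_sum_type, ← Finset.sum_add_distrib]
  refine Finset.sum_eq_zero fun i _ => ?_
  rw [show (Sum.inr i : Idx n) = Sum.swap (Sum.inl i) from rfl, h, add_neg_cancel]

theorem koszul_parity_swap (i : Idx n) :
    koszul k 1 (Idx.parity i.swap) = -koszul k 1 i.parity := by
  rcases i with i | i <;> simp [Idx.parity]

theorem mulR_mulR_swap (i : Idx n) (z : S k n ⊗[k] S k n) :
    mulR i.parity (Pi.single i 1) (mulR (Idx.parity i.swap) (Pi.single i.swap 1) z) =
      mulR (Idx.parity i.swap) (Pi.single i.swap 1) (mulR i.parity (Pi.single i 1) z) := by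
  induction z using TensorProduct.induction_on with
  | zero => simp
  | add z w hz hw => simp only [map_add, hz, hw]
  | tmul a b =>
    simp only [mulR_tmul, twist_twist_comm, ← mul_assoc, ι_mul_ι (single_mem i)
      (single_mem i.swap), koszul_swap, one_smul, add_comm i.parity]

theorem mulL_mulL_swap (i : Idx n) (z : S k n ⊗[k] S k n) :
    mulL (Pi.single i 1) (mulL (Pi.single i.swap 1) z) =
      mulL (Pi.single i.swap 1) (mulL (Pi.single i 1) z) := by
  induction z using TensorProduct.induction_on with
  | zero => simp
  | add z w hz hw => simp only [map_add, hz, hw]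
  | tmul a b =>
    simp only [mulL_tmul, ← mul_assoc, ι_mul_ι (single_mem i)
      (single_mem i.swap), koszul_swap, one_smul]

/-! ### The cup through left multiplications -/

variable (k n) in
/-- The invariant `∑ (-1)^{|i|} v_i ⊗ v_{-i}` in `S(V) ⊗ S(V)`. -/
def cupVec : S k n ⊗[k] S k n :=
  ∑ i : Idx n, koszul k 1 i.parity •
    ι k n (Pi.single i 1) ⊗ₜ[k] ι k n (Pi.single i.swap 1)

/-- The cup `x ⊗ y ↦ ± ∑ x v_i ⊗ v_{-i} y`. -/
def cupOp : S k n ⊗[k] S k n →ₗ[k] S k n ⊗[k] S k n :=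
  TensorProduct.map (LinearMap.mul' k (S k n)) (LinearMap.mul' k (S k n)) ∘ₗ
    (TensorProduct.assoc k _ _ _).symm.toLinearMap ∘ₗ
    TensorProduct.map (twist k n 1).toLinearMap
      ((TensorProduct.assoc k _ _ _).toLinearMap ∘ₗ
        TensorProduct.mk k (S k n ⊗[k] S k n) (S k n) (cupVec k n))

/-- Passing the odd cup across `x` twists `x` by parity 1, and moving `v_i` to the front of `x`
twists by `|i|`. As `|-i| = 1 + |i|`, the result is exactly the twist contained in `mulR` for the
vector `v_{-i}`. -/
theorem cupOp_eq (z : S k n ⊗[k] S k n) :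
    cupOp z = ∑ i : Idx n, koszul k 1 i.parity •
      mulL (Pi.single i 1) (mulR (Idx.parity i.swap) (Pi.single i.swap 1) z) := by
  induction z using TensorProduct.induction_on with
  | zero => simp
  | add z w hz hw => simp only [map_add, hz, hw, smul_add, Finset.sum_add_distrib]
  | tmul a b =>
    simp only [cupOp, cupVec, LinearMap.comp_apply, TensorProduct.map_tmul, TensorProduct.mk_apply,
      LinearMap.sum_apply, LinearMap.smul_apply, map_sum, TensorProduct.tmul_sum,
        AlgHom.toLinearMap_apply,
      LinearEquiv.coe_coe, map_smul, TensorProduct.tmul_smul,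
      TensorProduct.assoc_tmul, TensorProduct.assoc_symm_tmul, LinearMap.mul'_apply, mulR_tmul,
      mulL_tmul, mul_ι (single_mem _), twist_twist_comm, Idx.parity_swap, add_comm (1 : ZMod 2)]

variable [NeZero (2 : k)]

/-! ### Contractions as superderivations, and their commutation with rungs -/

variable (k) in
/-- Contraction on the left with the `i`-th coordinate. -/
def lam (i : Idx n) : S k n →ₗ[k] S k n :=
  (TensorProduct.lid k _).toLinearMap ∘ₗ TensorProduct.map (coord k i) LinearMap.id ∘ₗ comul

variable (k) in
/-- Contraction on the right with the `i`-th coordinate. -/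
def rho (i : Idx n) : S k n →ₗ[k] S k n :=
  (TensorProduct.rid k _).toLinearMap ∘ₗ TensorProduct.map LinearMap.id (coord k i) ∘ₗ comul

theorem lam_one (i : Idx n) : lam k i 1 = 0 := by simp [lam, comul_one, coord_one]

/-- Contraction is the superderivation of parity `|i|` that extends the `i`-th coordinate of `V`.
The first summand arises when `v` itself is the contracted factor, and the counit axiom recovers `a`
from the rest. -/
theorem lam_ι_mul (i : Idx n) {s : ZMod 2} {v : V k n} (hv : v ∈ vPart k n s) (a : S k n) :
    lam k i (ι k n v * a) = v i • a + koszul k i.parity s • (ι k n v * lam k i a) := by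
  nth_rewrite 2 [← counit_comul a]
  simp only [lam, LinearMap.comp_apply, comul_ι_mul hv, LinearEquiv.coe_coe]
  generalize comul a = z
  induction z using TensorProduct.induction_on with
  | zero => simp
  | add z w hz hw =>
    simp only [map_add, mul_add, smul_add] at *
    rw [add_add_add_comm, hz, hw]
    abel
  | tmul a b =>
    simp [coord_ι_mul, coord_twist, koszul_comm k s, smul_smul, mul_comm]

/-- Contracting at the other end of a product differs only by the sign of moving the contracted
vector past the remaining factors. All contractions can therefore be written with `lam`. -/
theorem rho_eq (i : Idx n) (a : S k n) : rho k i a = twist k n i.parity (lam k i a) := by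
  induction a using induction_left with
  | one => simp [lam_one, rho, comul_one, coord_one]
  | smul c a ha => simp only [map_smul, ha]
  | add a b ha hb => simp only [map_add, ha, hb]
  | mul s v hv a ha =>
    have key : rho k i (ι k n v * a) = ι k n v * rho k i a + v i • twist k n s a := by
      conv_rhs => enter [2]; rw [← comul_counit a]
      simp only [rho, LinearMap.comp_apply, comul_ι_mul hv, LinearEquiv.coe_coe]
      generalize comul a = z
      induction z using TensorProduct.induction_on with
      | zero => simp
      | add z w hz hw =>
        simp only [map_add, mul_add, smul_add] at *
        rw [add_add_add_comm, hz, hw]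
        abel
      | tmul a b => simp [coord_ι_mul, smul_smul, mul_comm]
    rw [key, ha, lam_ι_mul i hv, map_add, map_smul, map_smul, map_mul, twist_ι hv, smul_mul_assoc,
      smul_smul, koszul_mul_self, one_smul, add_comm]
    by_cases h : v i = 0
    · simp [h]
    · rw [eq_parity hv h]

theorem lam_twist (i : Idx n) (p : ZMod 2) (a : S k n) :
    lam k i (twist k n p a) = koszul k p i.parity • twist k n p (lam k i a) := by
  induction a using induction_left with
  | one => simp [lam_one]
  | smul c a ha => simp only [map_smul, ha, smul_comm c]
  | add a b ha hb => simp only [map_add, ha, hb, smul_add]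
  | mul s v hv a ha =>
    rw [map_mul, twist_ι hv, smul_mul_assoc, map_smul, lam_ι_mul i hv, lam_ι_mul i hv, ha, map_add,
      map_smul, map_smul, map_mul, twist_ι hv, smul_mul_assoc, mul_smul_comm]
    by_cases h : v i = 0
    · simp only [h, zero_smul]
      module
    · rw [eq_parity hv h]

variable (k) in
/-- Contraction in the left tensor factor. -/
def conL (i : Idx n) : S k n ⊗[k] S k n →ₗ[k] S k n ⊗[k] S k n :=
  TensorProduct.map (lam k i) LinearMap.id

variable (k) in
/-- Contraction in the right tensor factor. -/
def conR (i : Idx n) : S k n ⊗[k] S k n →ₗ[k] S k n ⊗[k] S k n :=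
  TensorProduct.map (twist k n i.parity).toLinearMap (lam k i)

/-- This and the next three rules say that `conL i` and `conR i` are superderivations of parity
`|i|` of the super tensor product, dual to the two copies of `V`. They kill `1 ⊗ 1`, so the rules
determine them. -/
theorem conL_mulL (i : Idx n) {s : ZMod 2} {v : V k n} (hv : v ∈ vPart k n s)
    (z : S k n ⊗[k] S k n) :
    conL k i (mulL v z) = v i • z + koszul k i.parity s • mulL v (conL k i z) := by
  induction z using TensorProduct.induction_on with
  | zero => simp
  | add z w hz hw => simp only [map_add, hz, hw, smul_add]; abel
  | tmul a b =>
    simp [conL, lam_ι_mul i hv, TensorProduct.add_tmul, TensorProduct.smul_tmul']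

theorem conL_mulR (i : Idx n) (s : ZMod 2) (v : V k n) (z : S k n ⊗[k] S k n) :
    conL k i (mulR s v z) = koszul k i.parity s • mulR s v (conL k i z) := by
  induction z using TensorProduct.induction_on with
  | zero => simp
  | add z w hz hw => simp only [map_add, hz, hw, smul_add]
  | tmul a b =>
    simp [conL, lam_twist, TensorProduct.smul_tmul', koszul_comm k s]

theorem conR_mulL (i : Idx n) {s : ZMod 2} {v : V k n} (hv : v ∈ vPart k n s)
    (z : S k n ⊗[k] S k n) :
    conR k i (mulL v z) = koszul k i.parity s • mulL v (conR k i z) := by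
  induction z using TensorProduct.induction_on with
  | zero => simp
  | add z w hz hw => simp only [map_add, hz, hw, smul_add]
  | tmul a b => simp [conR, twist_ι hv, TensorProduct.smul_tmul']

theorem conR_mulR (i : Idx n) {s : ZMod 2} {v : V k n} (hv : v ∈ vPart k n s)
    (z : S k n ⊗[k] S k n) :
    conR k i (mulR s v z) = v i • z + koszul k i.parity s • mulR s v (conR k i z) := by
  induction z using TensorProduct.induction_on with
  | zero => simp
  | add z w hz hw => simp only [map_add, hz, hw, smul_add]; abel
  | tmul a b =>
    simp only [conR, mulR_tmul, TensorProduct.map_tmul, AlgHom.toLinearMap_apply, lam_ι_mul i hv,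
      TensorProduct.tmul_add, TensorProduct.tmul_smul, twist_twist_comm, add_comm s]
    congr 1
    by_cases h : v i = 0
    · simp [h]
    · rw [eq_parity hv h, ← two_mul, show (2 : ZMod 2) = 0 from rfl, zero_mul, twist_zero]

theorem conL_one (i : Idx n) : conL k i (1 ⊗ₜ (1 : S k n)) = 0 := by simp [conL, lam_one]
theorem conR_one (i : Idx n) : conR k i (1 ⊗ₜ (1 : S k n)) = 0 := by simp [conR, lam_one]

/-- The total rung sends `v ⊗ 1` to `v ⊗ 1 + 1 ⊗ v` and fixes `1 ⊗ v`. Comparing derivations on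
these generators, `conL i` is unchanged under it and `conR i` becomes `conR i + conL i`; the lemmas
here sort this by thickness. For `rungF` the two sides are exchanged. -/
theorem conL_rungE (i : Idx n) (r : ℤ) (z : S k n ⊗[k] S k n) :
    conL k i (rungE r z) = rungE r (conL k i z) := by
  revert r
  induction z using tensor_induction with
  | one =>
    intro r
    rw [rungE_one, conL_one, map_zero]
    split_ifs <;> simp [conL_one]
  | smul c z hz => intro r; simp only [map_smul, hz]
  | add z w hz hw => intro r; simp only [map_add, hz, hw]
  | mulL s v hv z hz =>
    intro r
    simp only [rungE_mulL _ hv, map_add, conL_mulL i hv, conL_mulR, hz, map_smul]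
    module
  | mulR s v hv z hz =>
    intro r
    simp only [rungE_mulR _ hv, conL_mulR, hz, map_smul]

theorem conR_rungE (i : Idx n) (r : ℤ) (z : S k n ⊗[k] S k n) :
    conR k i (rungE r z) = rungE r (conR k i z) + rungE (r - 1) (conL k i z) := by
  revert r
  induction z using tensor_induction with
  | one =>
    intro r
    rw [rungE_one, conL_one, conR_one, map_zero, map_zero, add_zero]
    split_ifs <;> simp [conR_one]
  | smul c z hz => intro r; simp only [map_smul, hz, smul_add]
  | add z w hz hw => intro r; simp only [map_add, hz, hw]; abel
  | mulL s v hv z hz =>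
    intro r
    simp only [rungE_mulL _ hv, map_add, conL_mulL i hv, conR_mulL i hv, conR_mulR i hv, hz,
      map_smul]
    module
  | mulR s v hv z hz =>
    intro r
    simp only [rungE_mulR _ hv, conL_mulR, conR_mulR i hv, hz, map_smul, map_add]
    module

theorem conR_rungF (i : Idx n) (r : ℤ) (z : S k n ⊗[k] S k n) :
    conR k i (rungF r z) = rungF r (conR k i z) := by
  revert r
  induction z using tensor_induction with
  | one =>
    intro r
    rw [rungF_one, conR_one, map_zero]
    split_ifs <;> simp [conR_one]
  | smul c z hz => intro r; simp only [map_smul, hz]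
  | add z w hz hw => intro r; simp only [map_add, hz, hw]
  | mulL s v hv z hz =>
    intro r
    simp only [rungF_mulL, conR_mulL i hv, hz, map_smul]
  | mulR s v hv z hz =>
    intro r
    simp only [rungF_mulR _ hv, map_add, conR_mulR i hv, conR_mulL i hv, hz, map_smul]
    module

theorem conL_rungF (i : Idx n) (r : ℤ) (z : S k n ⊗[k] S k n) :
    conL k i (rungF r z) = rungF r (conL k i z) + rungF (r - 1) (conR k i z) := by
  revert r
  induction z using tensor_induction with
  | one =>
    intro r
    rw [rungF_one, conL_one, conR_one, map_zero, map_zero, add_zero]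
    split_ifs <;> simp [conL_one]
  | smul c z hz => intro r; simp only [map_smul, hz, smul_add]
  | add z w hz hw => intro r; simp only [map_add, hz, hw]; abel
  | mulL s v hv z hz =>
    intro r
    simp only [rungF_mulL, conR_mulL i hv, conL_mulL i hv, hz, map_smul, map_add]
    module
  | mulR s v hv z hz =>
    intro r
    simp only [rungF_mulR _ hv, map_add, conL_mulL i hv, conR_mulR i hv, conL_mulR, hz,
      map_smul]
    module

/-! ### Caps and antennas through contractions; swaps of caps and cups with rungs -/

/-- The form on `S(V)` given by twice the antenna. -/
def antForm : S k n →ₗ[k] k := capForm k n ∘ₗ comul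

/-- Contraction of `x₁ ⊗ x₂ ⊗ x₃ ⊗ x₄ ↦ ± x₁ ⊗ (x₂, x₃) x₄`. -/
def capOp : S k n ⊗[k] S k n →ₗ[k] S k n ⊗[k] S k n :=
  TensorProduct.map (twist k n 1).toLinearMap ((TensorProduct.lid k _).toLinearMap ∘ₗ
      TensorProduct.map (capForm k n) LinearMap.id ∘ₗ
      (TensorProduct.assoc k _ _ _).symm.toLinearMap) ∘ₗ
    (TensorProduct.assoc k _ _ _).toLinearMap ∘ₗ TensorProduct.map comul comul

/-- The antenna split off the right of the first factor. -/
def antOpL : S k n ⊗[k] S k n →ₗ[k] S k n ⊗[k] S k n :=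
  TensorProduct.map (twist k n 1).toLinearMap ((TensorProduct.lid k _).toLinearMap ∘ₗ
      TensorProduct.map antForm LinearMap.id) ∘ₗ
    (TensorProduct.assoc k _ _ _).toLinearMap ∘ₗ TensorProduct.map comul LinearMap.id

/-- The antenna split off the left of the second factor. -/
def antOpR : S k n ⊗[k] S k n →ₗ[k] S k n ⊗[k] S k n :=
  TensorProduct.map (twist k n 1).toLinearMap ((TensorProduct.lid k _).toLinearMap ∘ₗ
      TensorProduct.map antForm LinearMap.id ∘ₗ comul)

/-- Expanding the form in coordinates separates the two uprights: the left one is contracted from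
the right by `rho i`, the right one from the left by `lam (-i)`. Rewriting `rho` by `lam`
contributes a twist by `|i|`, which combines with the twist of the odd cap to the twist by `|-i|`
built into `conR`. -/
theorem capOp_eq (z : S k n ⊗[k] S k n) :
    capOp z = ∑ i : Idx n, conR k i.swap (conL k i z) := by
  have key : ∀ p q : S k n ⊗[k] S k n,
      TensorProduct.map (twist k n 1).toLinearMap ((TensorProduct.lid k _).toLinearMap ∘ₗ
        TensorProduct.map (capForm k n) LinearMap.id ∘ₗ
        (TensorProduct.assoc k _ _ _).symm.toLinearMap) (TensorProduct.assoc k _ _ _ (p ⊗ₜ q)) =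
      ∑ i : Idx n, twist k n 1 (TensorProduct.rid k _
        (TensorProduct.map LinearMap.id (coord k i) p)) ⊗ₜ[k]
        TensorProduct.lid k _ (TensorProduct.map (coord k i.swap) LinearMap.id q) := by
    intro p q
    induction p using TensorProduct.induction_on with
    | zero => simp
    | add p p' hp hp' =>
      simp only [TensorProduct.add_tmul, map_add, hp, hp', Finset.sum_add_distrib]
    | tmul a b =>
      induction q using TensorProduct.induction_on with
      | zero => simp
      | add q q' hq hq' =>
        simp only [TensorProduct.tmul_add, map_add, hq, hq', Finset.sum_add_distrib]
      | tmul c d =>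
        simp [capForm_eq_sum, -Fintype.sum_sum_type, Finset.sum_smul, TensorProduct.tmul_sum,
          TensorProduct.smul_tmul', TensorProduct.tmul_smul, smul_smul, mul_comm]
  induction z using TensorProduct.induction_on with
  | zero => simp
  | add z w hz hw => simp only [map_add, hz, hw, Finset.sum_add_distrib]
  | tmul a b =>
    refine (key (comul a) (comul b)).trans (Finset.sum_congr rfl fun i _ => ?_)
    change twist k n 1 (rho k i a) ⊗ₜ[k] lam k i.swap b = _
    rw [rho_eq, twist_twist_comm, ← Idx.parity_swap]
    rfl

/-- By coassociativity, applying the form to the last two legs of the iterated coproduct amounts to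
two successive contractions from the right. After rewriting both by `lam`, all twists cancel,
because `|i| + |-i| = 1` also cancels the twist of the odd antenna. -/
theorem antOpL_eq (z : S k n ⊗[k] S k n) :
    antOpL z = ∑ i : Idx n, conL k i (conL k i.swap z) := by
  have h₁ : ∀ z : S k n ⊗[k] S k n,
      TensorProduct.rid k _ (TensorProduct.map LinearMap.id (capForm k n)
        (TensorProduct.assoc k _ _ _ (TensorProduct.map comul LinearMap.id z))) =
      ∑ i : Idx n, rho k i (TensorProduct.rid k _ (TensorProduct.map LinearMap.id
        (coord k i.swap) z)) := by
    intro z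
    induction z using TensorProduct.induction_on with
    | zero => simp
    | add z w hz hw => simp only [map_add, hz, hw, Finset.sum_add_distrib]
    | tmul a b =>
      simp only [TensorProduct.map_tmul, LinearMap.id_apply, TensorProduct.rid_tmul, map_smul, rho,
        LinearMap.comp_apply, LinearEquiv.coe_coe]
      generalize comul a = w
      induction w using TensorProduct.induction_on with
      | zero => simp
      | add z w hz hw =>
        simp only [map_add, TensorProduct.add_tmul, hz, hw, Finset.sum_add_distrib, smul_add]
      | tmul c d =>
        simp [capForm_eq_sum, -Fintype.sum_sum_type, Finset.sum_smul, smul_smul, mul_comm]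
  have h₂ : ∀ (w : S k n ⊗[k] S k n) (b : S k n),
      TensorProduct.map (twist k n 1).toLinearMap ((TensorProduct.lid k _).toLinearMap ∘ₗ
        TensorProduct.map antForm LinearMap.id) (TensorProduct.assoc k _ _ _ (w ⊗ₜ b)) =
      twist k n 1 (TensorProduct.rid k _ (TensorProduct.map LinearMap.id antForm w)) ⊗ₜ[k] b := by
    intro w b
    induction w using TensorProduct.induction_on with
    | zero => simp
    | add z w hz hw => simp only [TensorProduct.add_tmul, map_add, hz, hw]
    | tmul a b => simp [TensorProduct.smul_tmul', TensorProduct.tmul_smul]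
  induction z using TensorProduct.induction_on with
  | zero => simp
  | add z w hz hw => simp only [map_add, hz, hw, Finset.sum_add_distrib]
  | tmul a b =>
    refine (h₂ (comul a) b).trans ?_
    have h₃ := h₁ (comul a)
    rw [comul_coassoc, ← LinearMap.comp_apply, ← TensorProduct.map_comp, LinearMap.id_comp] at h₃
    rw [antForm, h₃, map_sum, TensorProduct.sum_tmul]
    refine Finset.sum_congr rfl fun i _ => ?_
    change twist k n 1 (rho k i (rho k i.swap a)) ⊗ₜ[k] b = lam k i (lam k i.swap a) ⊗ₜ[k] b
    rw [rho_eq, rho_eq, lam_twist, map_smul, map_smul, koszul_swap', one_smul, twist_twist_comm,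
      twist_twist_comm, Idx.parity_swap, add_assoc, ← add_assoc i.parity, add_comm i.parity 1,
      add_assoc 1, ← two_mul, show (2 : ZMod 2) = 0 from rfl, zero_mul, add_zero,
      zmod2_one_add_one, twist_zero]

/-- Here coassociativity gives two contractions from the left on the second factor. The twist by 1
on the first factor is the product of the two twists contained in `conR i` and `conR (-i)`. -/
theorem antOpR_eq (z : S k n ⊗[k] S k n) :
    antOpR z = ∑ i : Idx n, conR k i.swap (conR k i z) := by
  have h₁ : ∀ z : S k n ⊗[k] S k n,
      TensorProduct.lid k _ (TensorProduct.map (capForm k n) LinearMap.id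
        ((TensorProduct.assoc k _ _ _).symm (TensorProduct.map LinearMap.id comul z))) =
      ∑ i : Idx n, lam k i.swap (TensorProduct.lid k _ (TensorProduct.map
        (coord k i) LinearMap.id z)) := by
    intro z
    induction z using TensorProduct.induction_on with
    | zero => simp
    | add z w hz hw => simp only [map_add, hz, hw, Finset.sum_add_distrib]
    | tmul a b =>
      simp only [TensorProduct.map_tmul, LinearMap.id_apply, TensorProduct.lid_tmul, map_smul, lam,
        LinearMap.comp_apply, LinearEquiv.coe_coe]
      generalize comul b = w
      induction w using TensorProduct.induction_on with
      | zero => simp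
      | add z w hz hw =>
        simp only [map_add, TensorProduct.tmul_add, hz, hw, Finset.sum_add_distrib, smul_add]
      | tmul c d => simp [capForm_eq_sum, -Fintype.sum_sum_type, Finset.sum_smul, smul_smul]
  induction z using TensorProduct.induction_on with
  | zero => simp
  | add z w hz hw => simp only [map_add, hz, hw, Finset.sum_add_distrib]
  | tmul a b =>
    have h₃ := h₁ (comul b)
    rw [← comul_coassoc, LinearEquiv.symm_apply_apply, ← LinearMap.comp_apply,
      ← TensorProduct.map_comp, LinearMap.id_comp] at h₃
    change twist k n 1 a ⊗ₜ[k] TensorProduct.lid k _ (TensorProduct.map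
      (capForm k n ∘ₗ comul) LinearMap.id (comul b)) = _
    rw [h₃, TensorProduct.tmul_sum]
    refine Finset.sum_congr rfl fun i _ => ?_
    change twist k n 1 a ⊗ₜ[k] lam k i.swap (lam k i b) =
      twist k n (Idx.parity i.swap) (twist k n i.parity a) ⊗ₜ[k] lam k i.swap (lam k i b)
    rw [twist_twist_comm, Idx.parity_swap, add_assoc, ← two_mul,
      show (2 : ZMod 2) = 0 from rfl, zero_mul, add_zero]

/-- Only `conR` fails to commute with `rungE`, and the defect turns `conR (-i)` into `conL (-i)` at
thickness `r - 1`. After the reindexing `i ↦ -i` the defects add up to `antOpL`, which is twice the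
antenna; this is the factor 2 in the relation. -/
theorem capOp_rungE (r : ℤ) (z : S k n ⊗[k] S k n) :
    capOp (rungE r z) = rungE r (capOp z) + rungE (r - 1) (antOpL z) := by
  rw [capOp_eq, capOp_eq, antOpL_eq, map_sum, map_sum,
    ← (Equiv.sumComm (Fin n) (Fin n)).sum_comp fun i : Idx n =>
      rungE (r - 1) (conL k i (conL k i.swap z)), ← Finset.sum_add_distrib]
  refine Finset.sum_congr rfl fun i _ => ?_
  rw [conL_rungE, conR_rungE]
  simp

theorem capOp_rungF (r : ℤ) (z : S k n ⊗[k] S k n) :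
    capOp (rungF r z) = rungF r (capOp z) + rungF (r - 1) (antOpR z) := by
  rw [capOp_eq, capOp_eq, antOpR_eq, map_sum, map_sum, ← Finset.sum_add_distrib]
  refine Finset.sum_congr rfl fun i _ => ?_
  rw [conL_rungF, map_add, conR_rungF, conR_rungF]

/-- The defect is `∑ (-1)^{|i|} R_i R_{-i}` applied to the rung of thickness `r - 1`. The product of
multiplications is symmetric under `i ↦ -i` and the sign is antisymmetric, so the sum vanishes by
`sum_anti`. -/
theorem rungE_cupOp (r : ℤ) (z : S k n ⊗[k] S k n) :
    rungE r (cupOp z) = cupOp (rungE r z) := by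
  rw [cupOp_eq, cupOp_eq, map_sum]
  simp only [map_smul, rungE_mulL _ (single_mem _), rungE_mulR _ (single_mem _), smul_add,
    Finset.sum_add_distrib]
  rw [add_eq_left]
  refine sum_anti fun i => ?_
  rw [koszul_parity_swap, Sum.swap_swap, neg_smul, mulR_mulR_swap]

theorem rungF_cupOp (r : ℤ) (z : S k n ⊗[k] S k n) :
    rungF r (cupOp z) = cupOp (rungF r z) := by
  rw [cupOp_eq, cupOp_eq, map_sum]
  simp only [map_smul, rungF_mulL, rungF_mulR _ (single_mem _), smul_add, map_add,
    Finset.sum_add_distrib]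
  rw [add_eq_left]
  refine sum_anti fun i => ?_
  rw [koszul_parity_swap, Sum.swap_swap, neg_smul, mulL_mulL_swap]

end contractions
end S
end
end PWebs

namespace PWebs
noncomputable section

/-! ## Equivariance of the structure maps -/

section equivariance
variable {k : Type u} [Field k] {n : ℕ}

theorem S.der_twist {p : ZMod 2} (x : pn k n p) (s : ZMod 2) (a : S k n) :
    S.der x (S.twist k n s a) = koszul k p s • S.twist k n s (S.der x a) := by
  rcases zmod2_cases s with rfl | rfl
  · simp [S.twist_zero]
  · rw [S.twist_der, smul_smul, koszul_comm k p 1, koszul_mul_self, one_smul]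

variable (k n) in
/-- The action of `𝔭(n)` on `S(V) ⊗ S(V)`. -/
def S.derTensor {p : ZMod 2} (x : pn k n p) : S k n ⊗[k] S k n →ₗ[k] S k n ⊗[k] S k n :=
  TensorProduct.map (S.der x) LinearMap.id +
    TensorProduct.map (S.twist k n p).toLinearMap (S.der x)

theorem S.derTensor_mulL {p s : ZMod 2} (x : pn k n p) {v : V k n} (hv : v ∈ vPart k n s)
    (z : S k n ⊗[k] S k n) : S.derTensor k n x (S.mulL v z) =
      S.mulL (x.1 v) z + koszul k p s • S.mulL v (S.derTensor k n x z) := by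
  induction z using TensorProduct.induction_on with
  | zero => simp
  | add z w hz hw => simp only [map_add, hz, hw, smul_add]; abel
  | tmul a b =>
    simp only [S.derTensor, LinearMap.add_apply, S.mulL_tmul, TensorProduct.map_tmul, map_add,
      LinearMap.id_apply, S.der_ι_mul x hv, TensorProduct.add_tmul, AlgHom.toLinearMap_apply,
      map_mul, S.twist_ι hv, ← TensorProduct.smul_tmul', smul_mul_assoc, smul_add]
    abel

theorem S.derTensor_mulR {p s : ZMod 2} (x : pn k n p) {v : V k n} (hv : v ∈ vPart k n s)
    (z : S k n ⊗[k] S k n) : S.derTensor k n x (S.mulR s v z) =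
      S.mulR (p + s) (x.1 v) z + koszul k p s • S.mulR s v (S.derTensor k n x z) := by
  induction z using TensorProduct.induction_on with
  | zero => simp
  | add z w hz hw => simp only [map_add, hz, hw, smul_add]; abel
  | tmul a b =>
    simp only [S.derTensor, LinearMap.add_apply, S.mulR_tmul, TensorProduct.map_tmul, map_add,
      LinearMap.id_apply, S.der_ι_mul x hv, TensorProduct.tmul_add, AlgHom.toLinearMap_apply,
      S.der_twist, S.twist_twist_comm, ← TensorProduct.smul_tmul', TensorProduct.tmul_smul,
      smul_add, add_comm s p]
    abel

theorem S.counit_der {p : ZMod 2} (x : pn k n p) (a : S k n) : S.counit (S.der x a) = 0 := by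
  induction a using S.induction_left with
  | one => simp [S.der_one]
  | smul c a ha => simp only [map_smul, ha, smul_zero]
  | add a b ha hb => simp only [map_add, ha, hb, add_zero]
  | mul s v hv a ha =>
    rw [S.der_ι_mul x hv, map_add, map_smul, S.counit_ι_mul, S.counit_ι_mul, smul_zero, add_zero]

theorem S.vProj_der {p : ZMod 2} (x : pn k n p) (a : S k n) :
    S.vProj k n (S.der x a) = x.1 (S.vProj k n a) := by
  induction a using S.induction_left with
  | one => simp [S.der_one]
  | smul c a ha => simp only [map_smul, ha]
  | add a b ha hb => simp only [map_add, ha, hb]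
  | mul s v hv a ha =>
    rw [S.der_ι_mul x hv, map_add, map_smul, S.vProj_ι_mul, S.vProj_ι_mul, S.vProj_ι_mul,
      map_smul, S.counit_der, zero_smul, smul_zero, add_zero]

/-! ### Invariance of the cup -/

theorem form_single_left (i : Idx n) (v : V k n) : form k n (Pi.single i 1) v = v i.swap := by
  change ∑ j, (Pi.single i 1 : V k n) j * v (Sum.swap j) = _
  rw [Finset.sum_eq_single i]
  · simp
  · intro j _ hj; rw [Pi.single_eq_of_ne hj, zero_mul]
  · simp

theorem form_single_right (i : Idx n) (v : V k n) : form k n v (Pi.single i 1) = v i.swap := by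
  change ∑ j, v j * (Pi.single i 1 : V k n) (Sum.swap j) = _
  rw [Finset.sum_eq_single i.swap]
  · simp
  · intro j _ hj
    rw [Pi.single_eq_of_ne, mul_zero]
    rintro rfl
    simp at hj
  · simp

/-- This is the defining identity of `𝔭(n)` for the vectors `v_{-i}` and `v_{-m}`, with its signs
rearranged. The entries vanish unless `|i| = p + |-m|`, and under this condition the two sign
conventions agree because `p (p + 1)` is even. -/
theorem pn_matrix {p : ZMod 2} (x : pn k n p) (i m : Idx n) :
    koszul k 1 (Idx.parity i.swap) * x.1 (Pi.single i.swap 1) m +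
      koszul k 1 m.parity * (koszul k p m.parity * x.1 (Pi.single m.swap 1) i) = 0 := by
  have h := (x.2 _ _ (S.single_mem (k := k) i.swap)).2 (Pi.single m.swap 1)
  rw [form_single_right, form_single_left, Sum.swap_swap, Sum.swap_swap, smul_eq_mul] at h
  have h' := (x.2 _ _ (S.single_mem (k := k) m.swap)).1 i
  by_cases hi : i.parity = p + Idx.parity m.swap
  · rw [Idx.parity_swap] at hi h ⊢
    rw [hi] at h ⊢
    generalize x.1 (Pi.single i.swap 1) m = A at *
    generalize x.1 (Pi.single m.swap 1) i = B at *
    generalize m.parity = q at *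
    rw [eq_neg_of_add_eq_zero_left h]
    rcases zmod2_cases p with rfl | rfl <;> rcases zmod2_cases q with rfl | rfl <;>
      simp [zmod2_one_add_one]
  · rw [h' hi] at h ⊢
    simp only [mul_zero, add_zero] at h ⊢
    rw [h, mul_zero]

/-- After expansion in the basis, the coefficient of `v_m ⊗ v_i` is the left-hand side of
`pn_matrix`. The invariance of the cup is thus the transpose of that of the form. -/
theorem derTensor_cupVec {p : ZMod 2} (x : pn k n p) : S.derTensor k n x (S.cupVec k n) = 0 := by
  have expand : ∀ u : V k n, S.ι k n u = ∑ m : Idx n, u m • S.ι k n (Pi.single m 1) := fun u => by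
    conv_lhs => rw [pi_eq_sum_univ' u, map_sum]
    refine Finset.sum_congr rfl fun m _ => ?_
    rw [map_smul]
  have h₁ : ∑ i : Idx n, koszul k 1 i.parity •
      S.ι k n (x.1 (Pi.single i 1)) ⊗ₜ[k] S.ι k n (Pi.single i.swap 1) =
      ∑ i : Idx n, ∑ m : Idx n, (koszul k 1 (Idx.parity i.swap) * x.1 (Pi.single i.swap 1) m) •
        S.ι k n (Pi.single m 1) ⊗ₜ[k] S.ι k n (Pi.single i 1) := by
    rw [← (Equiv.sumComm (Fin n) (Fin n)).sum_comp]
    refine Finset.sum_congr rfl fun i _ => ?_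
    rw [expand (x.1 _), TensorProduct.sum_tmul, Finset.smul_sum]
    refine Finset.sum_congr rfl fun m _ => ?_
    simp [TensorProduct.smul_tmul', smul_smul]
  have h₂ : ∑ i : Idx n, (koszul k 1 i.parity * koszul k p i.parity) •
      S.ι k n (Pi.single i 1) ⊗ₜ[k] S.ι k n (x.1 (Pi.single i.swap 1)) =
      ∑ i : Idx n, ∑ m : Idx n,
        (koszul k 1 m.parity * (koszul k p m.parity * x.1 (Pi.single m.swap 1) i)) •
        S.ι k n (Pi.single m 1) ⊗ₜ[k] S.ι k n (Pi.single i 1) := by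
    rw [Finset.sum_comm]
    refine Finset.sum_congr rfl fun i _ => ?_
    rw [expand (x.1 _), TensorProduct.tmul_sum, Finset.smul_sum]
    refine Finset.sum_congr rfl fun m _ => ?_
    simp [TensorProduct.tmul_smul, smul_smul, mul_assoc]
  have e : S.derTensor k n x (S.cupVec k n) = ∑ i : Idx n, koszul k 1 i.parity •
      S.ι k n (x.1 (Pi.single i 1)) ⊗ₜ[k] S.ι k n (Pi.single i.swap 1) +
      ∑ i : Idx n, (koszul k 1 i.parity * koszul k p i.parity) •
      S.ι k n (Pi.single i 1) ⊗ₜ[k] S.ι k n (x.1 (Pi.single i.swap 1)) := by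
    simp only [S.derTensor, S.cupVec, LinearMap.add_apply, map_sum, map_smul,
      TensorProduct.map_tmul, S.der_ι, LinearMap.id_apply, AlgHom.toLinearMap_apply,
      S.twist_ι (S.single_mem _), ← TensorProduct.smul_tmul', smul_smul, smul_add,
      Finset.sum_add_distrib]
  rw [e, h₁, h₂, ← Finset.sum_add_distrib]
  refine Finset.sum_eq_zero fun i _ => ?_
  rw [← Finset.sum_add_distrib]
  refine Finset.sum_eq_zero fun m _ => ?_
  rw [← add_smul, pn_matrix, zero_smul]

theorem form_mem {s t : ZMod 2} {v w : V k n} (hv : v ∈ vPart k n s) (hw : w ∈ vPart k n t)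
    (h : t ≠ 1 + s) : form k n v w = 0 := by
  change ∑ i, v i * w (Sum.swap i) = 0
  refine Finset.sum_eq_zero fun i _ => ?_
  by_cases hi : i.parity = s
  · rw [hw i.swap (by rw [Idx.parity_swap, hi]; exact h.symm), mul_zero]
  · rw [hv i hi, zero_mul]

variable [NeZero (2 : k)]

/-! ### `S(V)` as a supermodule; the structure maps as homomorphisms -/

variable (k n) in
/-- The symmetric superalgebra as a `𝔭(n)`-supermodule. -/
abbrev SMod : PMod k n where
  carrier := S k n
  part := S.part k n
  isCompl := S.isCompl_part
  act _ :=
    { toFun := fun x => S.der x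
      map_add' := fun x y => LinearMap.ext fun a => S.der_add x y a
      map_smul' := fun c x => LinearMap.ext fun a => S.der_smul c x a }
  act_mem x _ ha := S.der_mem_part x ha
  act_bracket x y a := S.der_bracket x y a

theorem SMod_twist (p : ZMod 2) : (SMod k n).twist p = (S.twist k n p).toLinearMap :=
  PMod.ext_part (M := SMod k n) fun _ _ hm =>
    (PMod.twist_of_mem (M := SMod k n) hm).trans (S.twist_of_mem hm).symm

/-- As 2 is invertible, parity in a tensor product is an eigenvalue condition for the tensor product
of the parity involutions. It can therefore be read off from `comul_twist` without decomposing
`Δ(a)` into homogeneous tensors. -/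
theorem PMod.mem_tensorPart {M N : PMod k n} {s : ZMod 2} {z : M.carrier ⊗[k] N.carrier}
    (hz : TensorProduct.map (M.twist 1) (N.twist 1) z = koszul k 1 s • z) :
    z ∈ PMod.tensorPart M N s := by
  have h2 : (2 : k) ≠ 0 := two_ne_zero
  have h : ∀ t, ∀ w ∈ PMod.tensorPart M N t,
      TensorProduct.map (M.twist 1) (N.twist 1) w = koszul k 1 t • w := by
    intro t w hw
    refine (PMod.tensorPart_le (W := LinearMap.eqLocus
      (TensorProduct.map (M.twist 1) (N.twist 1)) (koszul k 1 t • LinearMap.id)) ?_) hw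
    rintro i j rfl m hm m' hm'
    rw [LinearMap.mem_eqLocus, TensorProduct.map_tmul, PMod.twist_of_mem hm,
      PMod.twist_of_mem hm', TensorProduct.smul_tmul_smul, ← koszul_add_right]
    simp
  obtain ⟨z₀, h₀, z₁, h₁, rfl⟩ := PMod.exists_split (M := PMod.tensor M N) z
  change z₀ ∈ PMod.tensorPart M N 0 at h₀
  change z₁ ∈ PMod.tensorPart M N 1 at h₁
  rw [map_add, h _ _ h₀, h _ _ h₁] at hz
  rcases zmod2_cases s with rfl | rfl
  · have e : (2 : k) • z₁ = 0 := by
      simp only [koszul_zero_right, koszul_one_one, one_smul, neg_smul] at hz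
      rw [two_smul]
      have := add_left_cancel hz
      nth_rewrite 1 [← this]
      exact neg_add_cancel z₁
    rw [(smul_eq_zero.mp e).resolve_left h2]
    exact Submodule.add_mem _ h₀ (zero_mem _)
  · have e : (2 : k) • z₀ = 0 := by
      simp only [koszul_zero_right, koszul_one_one, one_smul, neg_smul] at hz
      rw [two_smul]
      have e' : z₀ = -z₀ := by
        rw [neg_add] at hz
        exact add_right_cancel hz
      nth_rewrite 1 [e']
      exact neg_add_cancel z₀
    rw [(smul_eq_zero.mp e).resolve_left h2]
    exact Submodule.add_mem _ (zero_mem _) h₁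

theorem SMod_tensorAct {p : ZMod 2} (x : pn k n p) :
    PMod.tensorAct (SMod k n) (SMod k n) p x = S.derTensor k n x := by
  change TensorProduct.map _ _ + TensorProduct.map ((SMod k n).twist p) _ = _
  rw [SMod_twist]
  rfl

/-- The action on the super tensor product is again by superderivations, so both sides follow the
same recursion under left multiplication by vectors. -/
theorem S.comul_der {p : ZMod 2} (x : pn k n p) (a : S k n) :
    S.comul (S.der x a) = S.derTensor k n x (S.comul a) := by
  induction a using S.induction_left with
  | one => simp [S.der_one, S.comul_one, S.derTensor]
  | smul c a ha => simp only [map_smul, ha]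
  | add a b ha hb => simp only [map_add, ha, hb]
  | mul s v hv a ha =>
    rw [S.der_ι_mul x hv, map_add, map_smul, S.comul_ι_mul (x.2 s v hv).1, S.comul_ι_mul hv,
      S.comul_ι_mul hv, map_add, S.derTensor_mulL x hv, S.derTensor_mulR x hv, ha]
    module

theorem comul_mem_homs :
    (S.comul : S k n →ₗ[k] _) ∈ PMod.homs (SMod k n) (PMod.tensor (SMod k n) (SMod k n)) 0 := by
  refine ⟨fun s a ha => ?_, fun q x a => ?_⟩
  · rw [zero_add]
    refine PMod.mem_tensorPart ?_
    rw [SMod_twist]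
    refine (S.comul_twist 1 a).symm.trans ?_
    rw [S.twist_of_mem ha, map_smul]
  · rw [koszul_zero_right, one_smul]
    refine (S.comul_der x a).trans ?_
    rw [← SMod_tensorAct]

theorem mul_mem_homs : LinearMap.mul' k (S k n) ∈
    PMod.homs (PMod.tensor (SMod k n) (SMod k n)) (SMod k n) 0 := by
  constructor
  · intro s z hz
    refine (PMod.tensorPart_le (M := SMod k n) (N := SMod k n)
      (W := (S.part k n (0 + s)).comap (LinearMap.mul' k (S k n))) ?_) hz
    rintro i j rfl a ha b hb
    rw [zero_add]
    exact SetLike.mul_mem_graded ha hb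
  · intro q x z
    rw [koszul_zero_right, one_smul]
    suffices h : LinearMap.mul' k (S k n) ∘ₗ S.derTensor k n x =
        S.der x ∘ₗ LinearMap.mul' k (S k n) by
      refine Eq.trans ?_ (DFunLike.congr_fun h z)
      rw [← SMod_tensorAct]
      rfl
    refine TensorProduct.ext' fun a b => ?_
    simp [S.derTensor, S.der_mul]

theorem S.vProj_mem {s : ZMod 2} {a : S k n} (ha : a ∈ S.part k n s) :
    S.vProj k n a ∈ vPart k n s := by
  intro i hi
  have h := congrFun (S.vProj_twist 1 a) i
  rw [S.twist_of_mem ha, map_smul] at h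
  simp only [Pi.smul_apply, smul_eq_mul, S.vTwist, LinearMap.pi_apply, LinearMap.smul_apply,
    LinearMap.proj_apply] at h
  have h2 : (2 : k) ≠ 0 := two_ne_zero
  rcases zmod2_cases s with rfl | rfl <;> rcases zmod2_cases i.parity with h' | h' <;>
    simp only [h', ne_eq, not_true_eq_false, koszul_zero_right, koszul_one_one] at h hi
  · exact (mul_eq_zero.mp (by linear_combination h : (2 : k) * S.vProj k n a i = 0)).resolve_left h2
  · exact (mul_eq_zero.mp (by linear_combination -h :
      (2 : k) * S.vProj k n a i = 0)).resolve_left h2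

/-- The action on `k` is zero, so equivariance means that the form kills `x.z`. Since the projection
of `S(V)` to `V` is equivariant (`vProj_der`), this is the defining identity of `𝔭(n)`. -/
theorem capForm_mem_homs : S.capForm k n ∈
    PMod.homs (PMod.tensor (SMod k n) (SMod k n)) (PMod.trivial k n) 1 := by
  constructor
  · intro s z hz
    refine (PMod.tensorPart_le (M := SMod k n) (N := SMod k n)
      (W := ((PMod.trivial k n).part (1 + s)).comap (S.capForm k n)) ?_) hz
    rintro i j rfl a ha b hb
    change S.capForm k n (a ⊗ₜ b) ∈ (if 1 + (i + j) = 0 then ⊤ else ⊥ : Submodule k k)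
    split_ifs with h
    · trivial
    · rw [S.capForm_tmul, form_mem (S.vProj_mem ha) (S.vProj_mem hb)]
      · exact zero_mem _
      · rintro rfl
        exact h ((by decide : ∀ i : ZMod 2, 1 + (i + (1 + i)) = 0) i)
  · intro q x z
    suffices h : S.capForm k n ∘ₗ PMod.tensorAct (SMod k n) (SMod k n) q x = 0 by
      refine (DFunLike.congr_fun h z).trans ?_
      change (0 : k) = _ • (0 : k)
      rw [smul_zero]
    refine PMod.ext_part₂ (M := SMod k n) (N := SMod k n) fun s a ha t b hb => ?_
    rw [LinearMap.comp_apply, PMod.tensorAct_tmul (M := SMod k n) (N := SMod k n) x ha, map_add,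
      map_smul]
    change form k n (S.vProj k n (S.der x a)) (S.vProj k n b) + koszul k q s •
      form k n (S.vProj k n a) (S.vProj k n (S.der x b)) = 0
    rw [S.vProj_der, S.vProj_der]
    exact (x.2 s _ (S.vProj_mem ha)).2 _

variable (k n) in
/-- The cup, as a map to `S(V) ⊗ S(V)`. -/
def cupMap : k →ₗ[k] S k n ⊗[k] S k n := LinearMap.toSpanSingleton k _ (S.cupVec k n)

theorem cupMap_mem_homs : cupMap k n ∈
    PMod.homs (PMod.trivial k n) (PMod.tensor (SMod k n) (SMod k n)) 1 := by
  have h : S.cupVec k n ∈ PMod.tensorPart (SMod k n) (SMod k n) 1 := by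
    refine Submodule.sum_mem _ fun i _ => Submodule.smul_mem _ _ ?_
    refine PMod.tmul_mem' (M := SMod k n) (N := SMod k n) ?_ (S.ι_mem_part (S.single_mem i))
      (S.ι_mem_part (S.single_mem i.swap))
    rw [Idx.parity_swap, add_left_comm, ← two_mul, show (2 : ZMod 2) = 0 from rfl, zero_mul,
      add_zero]
  constructor
  · intro s c hc
    rcases zmod2_cases s with rfl | rfl
    · exact Submodule.smul_mem _ c h
    · have : c = 0 := hc
      rw [this, map_zero]
      exact zero_mem _
  · intro q x c
    have e : PMod.tensorAct (SMod k n) (SMod k n) q x (cupMap k n c) = 0 := by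
      rw [SMod_tensorAct, cupMap, LinearMap.toSpanSingleton_apply, map_smul, derTensor_cupVec,
        smul_zero]
    refine Eq.trans ?_ (congrArg (koszul k q 1 • ·) e).symm
    rw [smul_zero]
    exact map_zero (cupMap k n)

end equivariance
end
end PWebs

namespace PWebs
noncomputable section

/-! ## Symmetric powers as summands of `S(V)` -/

section summands
variable {k : Type u} [Field k] {n : ℕ}

theorem S.pdeg_der (r : ℤ) {p : ZMod 2} (x : pn k n p) (a : S k n) :
    S.pdeg k n r (S.der x a) = S.der x (S.pdeg k n r a) := by
  refine DFunLike.congr_fun (f := S.pdeg k n r ∘ₗ S.der x)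
    (g := S.der x ∘ₗ S.pdeg k n r) (S.ext_deg fun d a ha => ?_) a
  simp only [LinearMap.comp_apply, S.pdeg_of_mem ha, S.pdeg_of_mem (S.der_mem_deg x ha)]
  split_ifs <;> simp

theorem S.algebraMap_mem_deg (c : k) : algebraMap k (S k n) c ∈ S.deg k n 0 := by
  rw [Algebra.algebraMap_eq_smul_one]
  exact Submodule.smul_mem _ _ S.one_mem_deg

variable [NeZero (2 : k)]

theorem symIncl_mem_deg (d : ℕ) (a : (Sym k n d).carrier) : symIncl k n d a ∈ S.deg k n d := by
  rcases d with - | d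
  · exact S.algebraMap_mem_deg (k := k) (n := n) a
  · exact Subtype.prop (p := (· ∈ S.deg k n (d + 1))) _

/-- The trivial module in degree zero and the submodules in positive degree are defined differently;
through `pdeg` both cases are handled uniformly. -/
theorem symIncl_symProj (d : ℕ) (a : S k n) :
    symIncl k n d (symProj k n d a) = S.pdeg k n d a := by
  rcases d with - | d
  · exact (S.pdeg_zero a).symm
  · exact (S.pdeg_natCast (d + 1) a).symm

theorem symProj_symIncl (d : ℕ) (a : (Sym k n d).carrier) :
    symProj k n d (symIncl k n d a) = a := by
  rcases d with - | d
  · exact (S.counit (k := k) (n := n)).commutes (show k from a)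
  · exact Subtype.ext ((S.projDeg_of_mem (symIncl_mem_deg (d + 1) a)).trans (if_pos rfl))

theorem symIncl_mem_homs (d : ℕ) : symIncl k n d ∈ PMod.homs (Sym k n d) (SMod k n) 0 := by
  rcases d with - | d
  · refine ⟨fun s (c : k) hc => ?_, fun q x (c : k) => ?_⟩
    · rcases zmod2_cases s with rfl | rfl
      · change algebraMap k (S k n) c ∈ S.part k n (0 + 0)
        rw [S.mem_part, AlgHom.commutes, add_zero, koszul_zero_right, one_smul]
      · have : c = (0 : k) := hc
        subst this
        exact (map_zero (algebraMap k (S k n))).symm ▸ zero_mem _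
    · rw [koszul_zero_right, one_smul]
      refine (map_zero (algebraMap k (S k n))).trans (Eq.symm ?_)
      change S.der x (algebraMap k (S k n) c) = 0
      rw [Algebra.algebraMap_eq_smul_one, map_smul, S.der_one, smul_zero]
  · refine ⟨fun s a ha => ?_, fun q x a => ?_⟩
    · rw [zero_add]; exact ha
    · rw [koszul_zero_right, one_smul]; rfl

theorem symProj_mem_homs (d : ℕ) : symProj k n d ∈ PMod.homs (SMod k n) (Sym k n d) 0 := by
  rcases d with - | d
  · refine ⟨fun s (a : S k n) ha => ?_, fun q x (a : S k n) => ?_⟩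
    · rcases zmod2_cases s with rfl | rfl
      · exact (Submodule.mem_top : S.counit a ∈ (⊤ : Submodule k k))
      · have h := S.counit_twist 1 a
        rw [S.twist_of_mem ha, koszul_one_one, neg_one_smul, map_neg] at h
        have e : S.counit a = 0 := by
          have h2 : (2 : k) ≠ 0 := two_ne_zero
          exact (mul_eq_zero.mp (by linear_combination -h : 2 * S.counit a = 0)).resolve_left h2
        exact ((Submodule.mem_bot k).mpr e : S.counit a ∈ (⊥ : Submodule k k))
    · exact (S.counit_der x a).trans (smul_zero (A := k) (koszul k q 0)).symm
  · refine ⟨fun s a ha => ?_, fun q x a => ?_⟩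
    · rw [zero_add]
      change (S.projDeg k n (d + 1) a : S k n) ∈ S.part k n s
      rw [← S.pdeg_natCast, S.mem_part, ← S.pdeg_twist, S.twist_of_mem ha, map_smul]
    · rw [koszul_zero_right, one_smul]
      refine Subtype.ext ?_
      change (S.projDeg k n (d + 1) (S.der x a) : S k n) = S.der x (S.projDeg k n (d + 1) a)
      rw [← S.pdeg_natCast, ← S.pdeg_natCast, S.pdeg_der]

end summands

/-! ## Tensor products of even maps -/

namespace PMod
section even
variable {k : Type u} [Field k] {n : ℕ} {M N M' N' L : PMod k n}

theorem comp_mem_zero {p : ZMod 2} {f : L.carrier →ₗ[k] M.carrier}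
    {g : M.carrier →ₗ[k] N.carrier} (hf : f ∈ homs L M p) (hg : g ∈ homs M N 0) :
    g ∘ₗ f ∈ homs L N p := by
  simpa using comp_mem hf hg

theorem zero_comp_mem {p : ZMod 2} {f : L.carrier →ₗ[k] M.carrier}
    {g : M.carrier →ₗ[k] N.carrier} (hf : f ∈ homs L M 0) (hg : g ∈ homs M N p) :
    g ∘ₗ f ∈ homs L N p := by
  simpa using comp_mem hf hg

/-- Tensoring with an odd map on the right. -/
theorem sTensor_eq_map_twist (f : M.carrier →ₗ[k] N.carrier) {g : M'.carrier →ₗ[k] N'.carrier}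
    (hg : IsHomogeneous 1 g) : sTensor f g = TensorProduct.map (f ∘ₗ M.twist 1) g := by
  refine ext_part₂ fun s m hm t m' hm' => ?_
  rw [sTensor_tmul f hg hm, TensorProduct.map_tmul, LinearMap.comp_apply, twist_of_mem hm,
    map_smul, TensorProduct.smul_tmul']

variable [NeZero (2 : k)]

theorem map_mem_homs {f : M.carrier →ₗ[k] N.carrier} {g : M'.carrier →ₗ[k] N'.carrier}
    (hf : f ∈ homs M N 0) (hg : g ∈ homs M' N' 0) :
    TensorProduct.map f g ∈ homs (tensor M M') (tensor N N') 0 := by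
  have := sTensor_mem hf hg
  rwa [sTensor_eq_map _ hg, add_zero] at this

theorem congr_mem_homs {e : M.carrier ≃ₗ[k] N.carrier} {e' : M'.carrier ≃ₗ[k] N'.carrier}
    (he : e.toLinearMap ∈ homs M N 0) (he' : e'.toLinearMap ∈ homs M' N' 0) :
    (TensorProduct.congr e e').toLinearMap ∈ homs (tensor M M') (tensor N N') 0 :=
  map_mem_homs he he'

end even
end PMod

/-! ## The objects of the functor -/

section objects
variable {k : Type u} [Field k] {n : ℕ}

/-- The transport along an equality of indices in a family of supermodules. -/
def castEquiv (O : List ℕ+ → PMod k n) {X Y : List ℕ+} (h : X = Y) :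
    (O X).carrier ≃ₗ[k] (O Y).carrier :=
  h ▸ LinearEquiv.refl k (O X).carrier

theorem castEquiv_mem (O : List ℕ+ → PMod k n) {X Y : List ℕ+} (h : X = Y) :
    (castEquiv O h).toLinearMap ∈ PMod.homs (O X) (O Y) 0 := by
  subst h
  exact PMod.id_mem

variable [NeZero (2 : k)]

variable (k n)

/-- The right nested tensor product `S^{a₁}(V) ⊗ (S^{a₂}(V) ⊗ (⋯ ⊗ k))`. -/
def nested : List ℕ+ → PMod k n
  | [] => PMod.trivial k n
  | a :: X => PMod.tensor (Sym k n a) (nested X)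

/-- The tensor product `S^{a₁}(V) ⊗ (S^{a₂}(V) ⊗ ⋯)`, without a final factor `k` unless the
sequence is empty. -/
def webObj : List ℕ+ → PMod k n
  | [] => PMod.trivial k n
  | [a] => Sym k n a
  | a :: b :: X => PMod.tensor (Sym k n a) (webObj (b :: X))

variable {k n}

theorem isSymTensor_webObj : ∀ X : List ℕ+, IsSymTensor k n (webObj k n X)
  | [] => .sym 0
  | [a] => .sym a
  | a :: b :: X => .tensor (.sym a) (isSymTensor_webObj (b :: X))

theorem nested_nil_induction {P : (nested k n []).carrier → Prop} (h : ∀ c : k, P c)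
    (x : (nested k n []).carrier) : P x := h x

theorem nested_cons_induction {a : ℕ+} {X : List ℕ+}
    {P : (nested k n (a :: X)).carrier → Prop} (zero : P 0)
    (add : ∀ x y, P x → P y → P (x + y))
    (tmul : ∀ (s : (Sym k n a).carrier) (x : (nested k n X).carrier), P (s ⊗ₜ[k] x))
    (x : (nested k n (a :: X)).carrier) : P x :=
  TensorProduct.induction_on x zero tmul add

/-- Associativity and unitality of concatenation hold for lists only up to propositional equality.
Transport along an equality of tails affects the last tensor factor alone, which lets inductions on
the list pass through it. -/
theorem castEquiv_nested_cons (a : ℕ+) {X Y : List ℕ+} (h : X = Y) (h' : a :: X = a :: Y)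
    (s : (Sym k n a).carrier) (x : (nested k n X).carrier) :
    castEquiv (nested k n) h' (s ⊗ₜ[k] x) = s ⊗ₜ[k] castEquiv (nested k n) h x := by
  subst h
  rfl

variable (k n) in
/-- Concatenation of nested tensor products. -/
def nestedAppend : (X Y : List ℕ+) →
    (nested k n X).carrier ⊗[k] (nested k n Y).carrier ≃ₗ[k] (nested k n (X ++ Y)).carrier
  | [], Y => TensorProduct.lid k (nested k n Y).carrier
  | a :: X, Y => TensorProduct.assoc k (Sym k n a).carrier _ _ ≪≫ₗ
      TensorProduct.congr (LinearEquiv.refl k _) (nestedAppend X Y)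

theorem nestedAppend_mem : ∀ X Y : List ℕ+, (nestedAppend k n X Y).toLinearMap ∈
    PMod.homs (PMod.tensor (nested k n X) (nested k n Y)) (nested k n (X ++ Y)) 0
  | [], _ => PMod.lid_mem
  | _ :: X, Y => PMod.comp_mem_zero PMod.assoc_mem
      (PMod.congr_mem_homs PMod.id_mem (nestedAppend_mem X Y))

/-- Keeping a final factor `k` makes the recursion uniform in the list, so that each induction step
peels off one factor and one associator. -/
theorem nestedAppend_assoc (X Y Z : List ℕ+) (x : (nested k n X).carrier)
    (y : (nested k n Y).carrier) (z : (nested k n Z).carrier) :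
    castEquiv (nested k n) (List.append_assoc X Y Z)
      (nestedAppend k n (X ++ Y) Z (nestedAppend k n X Y (x ⊗ₜ y) ⊗ₜ z)) =
    nestedAppend k n X (Y ++ Z) (x ⊗ₜ nestedAppend k n Y Z (y ⊗ₜ z)) := by
  induction X with
  | nil =>
    induction x using nested_nil_induction with | _ c => 
    change nestedAppend k n Y Z ((c • y) ⊗ₜ z) = c • nestedAppend k n Y Z (y ⊗ₜ z)
    rw [← TensorProduct.smul_tmul', map_smul]
  | cons a X ih =>
    induction x using nested_cons_induction with
    | zero => simp only [TensorProduct.zero_tmul, map_zero]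
    | add x x' hx hx' => simp only [TensorProduct.add_tmul, map_add, hx, hx']
    | tmul s x =>
      exact (castEquiv_nested_cons a (List.append_assoc X Y Z) _ s _).trans
        (congrArg (fun t => s ⊗ₜ[k] t) (ih x))

theorem nestedAppend_right_nil (X : List ℕ+) (x : (nested k n X).carrier) (c : k) :
    castEquiv (nested k n) (List.append_nil X) (nestedAppend k n X []
      (TensorProduct.tmul k (N := (nested k n []).carrier) x c)) = c • x := by
  induction X with
  | nil =>
    induction x using nested_nil_induction with | _ d => 
    exact mul_comm d c
  | cons a X ih =>
    refine DFunLike.congr_fun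
      (f := (castEquiv (nested k n) (List.append_nil (a :: X))).toLinearMap ∘ₗ
      (nestedAppend k n (a :: X) []).toLinearMap ∘ₗ
        (TensorProduct.mk k (nested k n (a :: X)).carrier (nested k n []).carrier).flip c)
      (g := c • LinearMap.id) (TensorProduct.ext' fun s x => ?_) x
    exact (castEquiv_nested_cons a (List.append_nil X) _ s _).trans
      ((congrArg (fun t => s ⊗ₜ[k] t) (ih x)).trans (TensorProduct.tmul_smul c s x))

variable (k n) in
/-- The comparison between the two families of tensor products. -/
def webNested : (X : List ℕ+) → (webObj k n X).carrier ≃ₗ[k] (nested k n X).carrier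
  | [] => LinearEquiv.refl k _
  | [a] => (TensorProduct.rid k (Sym k n a).carrier).symm
  | _ :: b :: X => TensorProduct.congr (LinearEquiv.refl k _) (webNested (b :: X))

theorem webNested_mem : ∀ X : List ℕ+,
    (webNested k n X).toLinearMap ∈ PMod.homs (webObj k n X) (nested k n X) 0
  | [] => PMod.id_mem
  | [a] => PMod.symm_mem (M := PMod.tensor (Sym k n a) (PMod.trivial k n)) (N := Sym k n a)
      _ PMod.rid_mem
  | _ :: b :: X => PMod.congr_mem_homs PMod.id_mem (webNested_mem (b :: X))

theorem webNested_castEquiv {X Y : List ℕ+} (h : X = Y) (x : (webObj k n X).carrier) :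
    webNested k n Y (castEquiv (webObj k n) h x) =
      castEquiv (nested k n) h (webNested k n X x) := by
  subst h
  rfl

variable (k n) in
/-- The tensor constraint of the functor. -/
def webAppend (X Y : List ℕ+) :
    (webObj k n X).carrier ⊗[k] (webObj k n Y).carrier ≃ₗ[k] (webObj k n (X ++ Y)).carrier :=
  TensorProduct.congr (webNested k n X) (webNested k n Y) ≪≫ₗ nestedAppend k n X Y ≪≫ₗ
    (webNested k n (X ++ Y)).symm

theorem webAppend_mem (X Y : List ℕ+) : (webAppend k n X Y).toLinearMap ∈
    PMod.homs (PMod.tensor (webObj k n X) (webObj k n Y)) (webObj k n (X ++ Y)) 0 :=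
  PMod.comp_mem_zero (PMod.comp_mem_zero
    (PMod.congr_mem_homs (webNested_mem X) (webNested_mem Y)) (nestedAppend_mem X Y))
    (PMod.symm_mem _ (webNested_mem _))

theorem webAppend_symm_mem (X Y : List ℕ+) : (webAppend k n X Y).symm.toLinearMap ∈
    PMod.homs (webObj k n (X ++ Y)) (PMod.tensor (webObj k n X) (webObj k n Y)) 0 :=
  PMod.symm_mem (M := PMod.tensor (webObj k n X) (webObj k n Y)) _ (webAppend_mem X Y)

theorem webNested_webAppend (X Y : List ℕ+) (x : (webObj k n X).carrier)
    (y : (webObj k n Y).carrier) : webNested k n (X ++ Y) (webAppend k n X Y (x ⊗ₜ y)) =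
      nestedAppend k n X Y (webNested k n X x ⊗ₜ webNested k n Y y) := by
  simp [webAppend]

/-- Coherence is proved for `nested`, where concatenation is a plain recursion, and transported
along `webNested`. The family `webObj` is the one used for the functor because its value on a single
label is the symmetric power itself. -/
theorem webAppend_assoc (X Y Z : List ℕ+) (x : (webObj k n X).carrier)
    (y : (webObj k n Y).carrier) (z : (webObj k n Z).carrier) :
    castEquiv (webObj k n) (List.append_assoc X Y Z)
      (webAppend k n (X ++ Y) Z (webAppend k n X Y (x ⊗ₜ y) ⊗ₜ z)) =
    webAppend k n X (Y ++ Z) (x ⊗ₜ webAppend k n Y Z (y ⊗ₜ z)) := by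
  apply (webNested k n _).injective
  rw [webNested_castEquiv, webNested_webAppend, webNested_webAppend, webNested_webAppend,
    webNested_webAppend, nestedAppend_assoc]

theorem webAppend_nil (Y : List ℕ+) (c : k) (y : (webObj k n Y).carrier) :
    webAppend k n [] Y
    (TensorProduct.tmul k (M := (webObj k n []).carrier) c y) = c • y := by
  apply (webNested k n _).injective
  refine (webNested_webAppend [] Y c y).trans ?_
  rw [map_smul]
  rfl

theorem webAppend_right_nil (X : List ℕ+) (x : (webObj k n X).carrier) (c : k) :
    castEquiv (webObj k n) (List.append_nil X) (webAppend k n X []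
      (TensorProduct.tmul k (N := (webObj k n []).carrier) x c)) = c • x := by
  apply (webNested k n _).injective
  rw [webNested_castEquiv]
  refine (congrArg _ (webNested_webAppend X [] x c)).trans ?_
  rw [map_smul]
  exact nestedAppend_right_nil X _ c

end objects
end
end PWebs

namespace PWebs
noncomputable section

/-! ## The interpretation of web expressions -/

section interpretation
variable {k : Type u} [Field k] [NeZero (2 : k)] {n : ℕ}

variable (k n) in
/-- The object assigned to a strand of thickness `a` is `S^a(V)`. -/
def strandEquiv : (a : ℕ) → (Sym k n a).carrier ≃ₗ[k] (webObj k n (st a)).carrier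
  | 0 => LinearEquiv.refl k (Sym k n 0).carrier
  | a + 1 => LinearEquiv.refl k (Sym k n (a + 1)).carrier

theorem strandEquiv_mem : ∀ a : ℕ,
    (strandEquiv k n a).toLinearMap ∈ PMod.homs (Sym k n a) (webObj k n (st a)) 0
  | 0 => PMod.id_mem (M := Sym k n 0)
  | a + 1 => PMod.id_mem (M := Sym k n (a + 1))

variable (k n) in
/-- The inclusion of the value on a strand in `S(V)`. -/
def strandIncl (a : ℕ) : (webObj k n (st a)).carrier →ₗ[k] S k n :=
  symIncl k n a ∘ₗ (strandEquiv k n a).symm.toLinearMap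

variable (k n) in
/-- The projection of `S(V)` onto the value on a strand. -/
def strandProj (a : ℕ) : S k n →ₗ[k] (webObj k n (st a)).carrier :=
  (strandEquiv k n a).toLinearMap ∘ₗ symProj k n a

theorem strandIncl_mem (a : ℕ) :
    strandIncl k n a ∈ PMod.homs (webObj k n (st a)) (SMod k n) 0 :=
  PMod.comp_mem_zero (PMod.symm_mem _ (strandEquiv_mem a)) (symIncl_mem_homs a)

theorem strandProj_mem (a : ℕ) :
    strandProj k n a ∈ PMod.homs (SMod k n) (webObj k n (st a)) 0 :=
  PMod.comp_mem_zero (symProj_mem_homs a) (strandEquiv_mem a)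

theorem strandIncl_comp_strandProj (a : ℕ) :
    strandIncl k n a ∘ₗ strandProj k n a = S.pdeg k n a := by
  ext x
  simp [strandIncl, strandProj, symIncl_symProj]

theorem strandProj_strandIncl (a : ℕ) (x : (webObj k n (st a)).carrier) :
    strandProj k n a (strandIncl k n a x) = x := by
  simp [strandIncl, strandProj, symProj_symIncl]

theorem strandIncl_injective (a : ℕ) : Function.Injective (strandIncl k n a) :=
  Function.LeftInverse.injective (strandProj_strandIncl a)

theorem strandIncl_mem_deg (a : ℕ) (x : (webObj k n (st a)).carrier) :
    strandIncl k n a x ∈ S.deg k n a :=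
  symIncl_mem_deg a _

variable (k n) in
/-- The linear map assigned to a split. -/
def splitMap (a b c : ℕ) :
    (webObj k n (st c)).carrier →ₗ[k] (webObj k n (st a ++ st b)).carrier :=
  (webAppend k n (st a) (st b)).toLinearMap ∘ₗ
    TensorProduct.map (strandProj k n a) (strandProj k n b) ∘ₗ S.comul ∘ₗ strandIncl k n c

variable (k n) in
/-- The linear map assigned to a merge. -/
def mergeMap (a b c : ℕ) :
    (webObj k n (st a ++ st b)).carrier →ₗ[k] (webObj k n (st c)).carrier :=
  strandProj k n c ∘ₗ LinearMap.mul' k (S k n) ∘ₗ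
    TensorProduct.map (strandIncl k n a) (strandIncl k n b) ∘ₗ
      (webAppend k n (st a) (st b)).symm.toLinearMap

variable (k n) in
/-- The linear map assigned to the cap. -/
def capMap : (webObj k n (st 1 ++ st 1)).carrier →ₗ[k] (webObj k n []).carrier :=
  S.capForm k n ∘ₗ TensorProduct.map (strandIncl k n 1) (strandIncl k n 1) ∘ₗ
      (webAppend k n (st 1) (st 1)).symm.toLinearMap

variable (k n) in
/-- The linear map assigned to the cup. -/
def cupMap' : (webObj k n []).carrier →ₗ[k] (webObj k n (st 1 ++ st 1)).carrier :=
  (webAppend k n (st 1) (st 1)).toLinearMap ∘ₗ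
    TensorProduct.map (strandProj k n 1) (strandProj k n 1) ∘ₗ cupMap k n

variable (n) in
/-- The linear map assigned to a web expression. -/
def interp : {X Y : List ℕ+} → Diag k X Y →
    ((webObj k n X).carrier →ₗ[k] (webObj k n Y).carrier)
  | _, _, .zero _ _ => 0
  | _, _, .add f g => interp f + interp g
  | _, _, .smul c f => c • interp f
  | _, _, .id h => (castEquiv (webObj k n) h).toLinearMap
  | _, _, .comp f g => interp g ∘ₗ interp f
  | _, _, .tensor (X := X) (Y := Y) (X' := X') (Y' := Y') f g =>
    (webAppend k n Y Y').toLinearMap ∘ₗ PMod.sTensor (interp f) (interp g) ∘ₗ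
      (webAppend k n X X').symm.toLinearMap
  | _, _, .split a b c _ => splitMap k n a b c
  | _, _, .merge a b c _ => mergeMap k n a b c
  | _, _, .cap => capMap k n
  | _, _, .cup => cupMap' k n

theorem splitMap_mem (a b c : ℕ) :
    splitMap k n a b c ∈ PMod.homs (webObj k n (st c)) (webObj k n (st a ++ st b)) 0 :=
  PMod.comp_mem_zero (PMod.comp_mem_zero (PMod.comp_mem_zero (strandIncl_mem c)
    comul_mem_homs) (PMod.map_mem_homs (strandProj_mem a) (strandProj_mem b)))
    (webAppend_mem (st a) (st b))

theorem mergeMap_mem (a b c : ℕ) :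
    mergeMap k n a b c ∈ PMod.homs (webObj k n (st a ++ st b)) (webObj k n (st c)) 0 :=
  PMod.comp_mem_zero (PMod.comp_mem_zero (PMod.comp_mem_zero (webAppend_symm_mem (st a) (st b))
    (PMod.map_mem_homs (strandIncl_mem a) (strandIncl_mem b))) mul_mem_homs) (strandProj_mem c)

theorem capMap_mem :
    capMap k n ∈ PMod.homs (webObj k n (st 1 ++ st 1)) (webObj k n []) 1 :=
  PMod.zero_comp_mem (PMod.comp_mem_zero (webAppend_symm_mem (st 1) (st 1))
    (PMod.map_mem_homs (strandIncl_mem 1) (strandIncl_mem 1))) capForm_mem_homs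

theorem cupMap'_mem :
    cupMap' k n ∈ PMod.homs (webObj k n []) (webObj k n (st 1 ++ st 1)) 1 :=
  PMod.comp_mem_zero (PMod.comp_mem_zero cupMap_mem_homs
    (PMod.map_mem_homs (strandProj_mem 1) (strandProj_mem 1))) (webAppend_mem (st 1) (st 1))

theorem interp_mem {X Y : List ℕ+} {f : Diag k X Y} {p : ZMod 2} (h : Diag.HasParity f p) :
    interp n f ∈ PMod.homs (webObj k n X) (webObj k n Y) p := by
  induction h with
  | zero => exact zero_mem _
  | add _ _ hf hg => exact add_mem hf hg
  | smul c _ hf => exact Submodule.smul_mem _ c hf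
  | id h => exact castEquiv_mem _ h
  | comp _ _ hf hg => exact PMod.comp_mem hf hg
  | tensor _ _ hf hg =>
    exact PMod.comp_mem_zero (PMod.zero_comp_mem (webAppend_symm_mem _ _)
      (PMod.sTensor_mem hf hg)) (webAppend_mem _ _)
  | split a b c => exact splitMap_mem a b c
  | merge a b c => exact mergeMap_mem a b c
  | cap => exact capMap_mem
  | cup => exact cupMap'_mem

theorem interp_mem_allHoms {X Y : List ℕ+} (f : Diag k X Y) :
    interp n f ∈ PMod.allHoms (webObj k n X) (webObj k n Y) := by
  induction f with
  | zero => exact zero_mem _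
  | add f g hf hg => exact add_mem hf hg
  | smul c f hf => exact Submodule.smul_mem _ c hf
  | id h => exact PMod.homs_le 0 (castEquiv_mem _ h)
  | comp f g hf hg => exact PMod.comp_mem_allHoms hf hg
  | tensor f g hf hg =>
    exact PMod.comp_mem_allHoms (PMod.comp_mem_allHoms (PMod.homs_le 0 (webAppend_symm_mem _ _))
      (PMod.sTensor_mem_allHoms hf hg)) (PMod.homs_le 0 (webAppend_mem _ _))
  | split a b c => exact PMod.homs_le 0 (splitMap_mem a b c)
  | merge a b c => exact PMod.homs_le 0 (mergeMap_mem a b c)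
  | cap => exact PMod.homs_le 1 capMap_mem
  | cup => exact PMod.homs_le 1 cupMap'_mem

end interpretation

theorem castEquiv_symm_apply {k : Type u} [Field k] {n : ℕ} (O : List ℕ+ → PMod k n)
    {X Y : List ℕ+} (h : X = Y) (x : (O X).carrier) :
    castEquiv O h.symm (castEquiv O h x) = x := by
  subst h
  rfl

/-! ## Web expressions as operators on tensor powers of `S(V)` -/

section operators
variable {k : Type u} [Field k] [NeZero (2 : k)] {n : ℕ}

/-- The linear map on the value of a concatenation given by linear maps on both parts. -/
def juxt {X Y : List ℕ+} {A B : Type u} [AddCommGroup A] [Module k A] [AddCommGroup B]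
    [Module k B] (i : (webObj k n X).carrier →ₗ[k] A) (j : (webObj k n Y).carrier →ₗ[k] B) :
    (webObj k n (X ++ Y)).carrier →ₗ[k] A ⊗[k] B :=
  TensorProduct.map i j ∘ₗ (webAppend k n X Y).symm.toLinearMap

/-- `Rep i j f f₀`: the web expression `f` acts as `f₀` under the comparison maps `i` and `j`. -/
def Rep {X Y : List ℕ+} {A B : Type u} [AddCommGroup A] [Module k A] [AddCommGroup B]
    [Module k B] (i : (webObj k n X).carrier →ₗ[k] A) (j : (webObj k n Y).carrier →ₗ[k] B)
    (f : Diag k X Y) (f₀ : A →ₗ[k] B) : Prop :=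
  j ∘ₗ interp n f = f₀ ∘ₗ i

variable (k n) in
/-- The comparison map of the empty sequence. -/
def emptyIncl : (webObj k n []).carrier →ₗ[k] k := LinearMap.id

variable (k n) in
/-- The comparison map of a pair of strands. -/
abbrev pairIncl (a b : ℕ) : (webObj k n (st a ++ st b)).carrier →ₗ[k] S k n ⊗[k] S k n :=
  juxt (strandIncl k n a) (strandIncl k n b)

variable {X Y Z X' Y' X'' : List ℕ+} {A B C A' B' A'' : Type u}
  [AddCommGroup A] [Module k A] [AddCommGroup B] [Module k B] [AddCommGroup C] [Module k C]
  [AddCommGroup A'] [Module k A'] [AddCommGroup B'] [Module k B'] [AddCommGroup A'']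
  [Module k A'']
  {i : (webObj k n X).carrier →ₗ[k] A} {j : (webObj k n Y).carrier →ₗ[k] B}
  {l : (webObj k n Z).carrier →ₗ[k] C} {i' : (webObj k n X').carrier →ₗ[k] A'}
  {j' : (webObj k n Y').carrier →ₗ[k] B'} {i'' : (webObj k n X'').carrier →ₗ[k] A''}

/-! ### Calculus of comparison maps -/

theorem juxt_webAppend (x : (webObj k n X).carrier) (y : (webObj k n Y).carrier) :
    juxt i j (webAppend k n X Y (x ⊗ₜ y)) = i x ⊗ₜ j y := by
  simp [juxt]

/-- Over a field all modules are flat, so tensor products of injective maps are injective. -/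
theorem juxt_injective (hi : Function.Injective i) (hj : Function.Injective j) :
    Function.Injective (juxt i j) :=
  (TensorProduct.map_injective_of_flat_flat i j hi hj).comp (webAppend k n X Y).symm.injective

theorem pairIncl_injective (a b : ℕ) : Function.Injective (pairIncl k n a b) :=
  juxt_injective (strandIncl_injective a) (strandIncl_injective b)

theorem ext_juxt {f g : A ⊗[k] B →ₗ[k] C} (h : ∀ x y, f (i x ⊗ₜ j y) = g (i x ⊗ₜ j y)) :
    f ∘ₗ juxt i j = g ∘ₗ juxt i j := by
  suffices e : f ∘ₗ TensorProduct.map i j = g ∘ₗ TensorProduct.map i j by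
    rw [juxt, ← LinearMap.comp_assoc, e, LinearMap.comp_assoc]
  exact TensorProduct.ext' h

/-- The comparison map of a pair of strands lands in bidegree `(a, b)`, so operator identities are
needed there only. The rung swap is such an identity, its coefficients depending on `a - b`. -/
theorem ext_pairIncl {a b : ℕ} {f g : S k n ⊗[k] S k n →ₗ[k] C}
    (h : ∀ x ∈ S.deg k n a, ∀ y ∈ S.deg k n b, f (x ⊗ₜ y) = g (x ⊗ₜ y)) :
    f ∘ₗ pairIncl k n a b = g ∘ₗ pairIncl k n a b :=
  ext_juxt fun _ _ => h _ (strandIncl_mem_deg a _) _ (strandIncl_mem_deg b _)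

theorem Rep.comp {f : Diag k X Y} {g : Diag k Y Z} {f₀ : A →ₗ[k] B} {g₀ : B →ₗ[k] C}
    (hg : Rep j l g g₀) (hf : Rep i j f f₀) : Rep i l (.comp f g) (g₀ ∘ₗ f₀) := by
  have h₁ : l ∘ₗ interp n g = g₀ ∘ₗ j := hg
  have h₂ : j ∘ₗ interp n f = f₀ ∘ₗ i := hf
  change l ∘ₗ interp n g ∘ₗ interp n f = _
  rw [← LinearMap.comp_assoc, h₁, LinearMap.comp_assoc, h₂, LinearMap.comp_assoc]

/-- A composition whose first factor vanishes. -/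
theorem Rep.comp_of_eq_zero {f : Diag k X Y} {g : Diag k Y Z} {f₀ : A →ₗ[k] B} {g₀ : B →ₗ[k] C}
    (hf : interp n f = 0) (h₀ : f₀ ∘ₗ i = 0) : Rep i l (.comp f g) (g₀ ∘ₗ f₀) := by
  change l ∘ₗ interp n g ∘ₗ interp n f = _
  rw [hf, LinearMap.comp_assoc, h₀, LinearMap.comp_zero, LinearMap.comp_zero, LinearMap.comp_zero]

theorem Rep.add {f g : Diag k X Y} {f₀ g₀ : A →ₗ[k] B} (hf : Rep i j f f₀) (hg : Rep i j g g₀) :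
    Rep i j (.add f g) (f₀ + g₀) := by
  change j ∘ₗ (interp n f + interp n g) = _
  rw [LinearMap.comp_add, LinearMap.add_comp]
  exact congrArg₂ _ hf hg

theorem Rep.smul (c : k) {f : Diag k X Y} {f₀ : A →ₗ[k] B} (hf : Rep i j f f₀) :
    Rep i j (.smul c f) (c • f₀) := by
  change j ∘ₗ (c • interp n f) = _
  rw [LinearMap.comp_smul, LinearMap.smul_comp]
  exact congrArg _ hf

theorem Rep.zero : Rep i j (.zero X Y) 0 := by
  change j ∘ₗ 0 = _
  rw [LinearMap.comp_zero, LinearMap.zero_comp]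

theorem Rep.sumUpTo {f : ℕ → Diag k X Y} {f₀ : ℕ → A →ₗ[k] B} : ∀ (N : ℕ),
    (∀ t ≤ N, Rep i j (f t) (f₀ t)) →
      Rep i j (Diag.sumUpTo f N) (∑ t ∈ Finset.range (N + 1), f₀ t)
  | 0, h => by
    rw [Finset.sum_range_one]
    exact h 0 le_rfl
  | N + 1, h => by
    rw [Finset.sum_range_succ]
    exact (Rep.sumUpTo N fun t ht => h t (ht.trans N.le_succ)).add (h _ le_rfl)

theorem Rep.congr {f : Diag k X Y} {f₀ f₁ : A →ₗ[k] B} (hf : Rep i j f f₀)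
    (h : f₀ ∘ₗ i = f₁ ∘ₗ i) : Rep i j f f₁ :=
  Eq.trans hf h

/-- This is the criterion by which most defining relations are verified: the comparison map on the
target is injective, so operators that agree on the image of the comparison map of the source give
equal interpretations. -/
theorem Rep.eq {f g : Diag k X Y} {f₀ g₀ : A →ₗ[k] B} (hj : Function.Injective j)
    (hf : Rep i j f f₀) (hg : Rep i j g g₀) (h : f₀ ∘ₗ i = g₀ ∘ₗ i) : interp n f = interp n g := by
  have e : j ∘ₗ interp n f = j ∘ₗ interp n g := Eq.trans hf (h.trans (Eq.symm hg))
  exact LinearMap.ext fun x => hj (DFunLike.congr_fun e x)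

theorem Rep.id : Rep i i (.id (rfl : X = X)) LinearMap.id := rfl

/-- The Koszul sign in `f ⊗ g` involves the parity of `g` only, so for even `g` the super tensor
product of maps is the ordinary one. -/
theorem Rep.tensor {f : Diag k X Y} {g : Diag k X' Y'} {f₀ : A →ₗ[k] B} {g₀ : A' →ₗ[k] B'}
    (hf : Rep i j f f₀) (hg : Rep i' j' g g₀) (h : Diag.HasParity g 0) :
    Rep (juxt i i') (juxt j j') (.tensor f g) (TensorProduct.map f₀ g₀) := by
  have h₁ : j ∘ₗ interp n f = f₀ ∘ₗ i := hf
  have h₂ : j' ∘ₗ interp n g = g₀ ∘ₗ i' := hg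
  change juxt j j' ∘ₗ (webAppend k n Y Y').toLinearMap ∘ₗ PMod.sTensor (interp n f) (interp n g)
    ∘ₗ (webAppend k n X X').symm.toLinearMap = _
  rw [PMod.sTensor_eq_map _ (interp_mem h), juxt, juxt, LinearMap.comp_assoc,
    ← LinearMap.comp_assoc _ (webAppend k n Y Y').toLinearMap
      (webAppend k n Y Y').symm.toLinearMap, LinearEquiv.symm_comp,
    LinearMap.id_comp, ← LinearMap.comp_assoc, ← LinearMap.comp_assoc, ← TensorProduct.map_comp,
    ← TensorProduct.map_comp, h₁, h₂]

theorem strandIncl_twist (a : ℕ) (x : (webObj k n (st a)).carrier) :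
    strandIncl k n a ((webObj k n (st a)).twist 1 x) = S.twist k n 1 (strandIncl k n a x) := by
  refine DFunLike.congr_fun (f := strandIncl k n a ∘ₗ (webObj k n (st a)).twist 1)
    (g := (S.twist k n 1).toLinearMap ∘ₗ strandIncl k n a) (PMod.ext_part fun s m hm => ?_) x
  have h : strandIncl k n a m ∈ S.part k n (0 + s) :=
    (strandIncl_mem (k := k) (n := n) a).1 s m hm
  rw [zero_add] at h
  change strandIncl k n a (PMod.twist _ 1 m) = S.twist k n 1 (strandIncl k n a m)
  rw [PMod.twist_of_mem hm, map_smul, S.mem_part.mp h]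

/-- Juxtaposition of a strand with an odd diagram. -/
theorem Rep.strand_tensor (a : ℕ) {g : Diag k X' Y'} {g₀ : A' →ₗ[k] B'}
    (hg : Rep i' j' g g₀) (h : Diag.HasParity g 1) :
    Rep (juxt (strandIncl k n a) i') (juxt (strandIncl k n a) j') (.tensor (.id rfl) g)
      (TensorProduct.map (S.twist k n 1).toLinearMap g₀) := by
  have h₂ : j' ∘ₗ interp n g = g₀ ∘ₗ i' := hg
  have h₁ : strandIncl k n a ∘ₗ (webObj k n (st a)).twist 1 =
      (S.twist k n 1).toLinearMap ∘ₗ strandIncl k n a := LinearMap.ext (strandIncl_twist a)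
  change juxt (strandIncl k n a) j' ∘ₗ (webAppend k n (st a) Y').toLinearMap ∘ₗ
    PMod.sTensor LinearMap.id (interp n g) ∘ₗ (webAppend k n (st a) X').symm.toLinearMap = _
  rw [PMod.sTensor_eq_map_twist _ (interp_mem h).1, juxt, juxt, LinearMap.comp_assoc,
    ← LinearMap.comp_assoc _ (webAppend k n (st a) Y').toLinearMap
      (webAppend k n (st a) Y').symm.toLinearMap, LinearEquiv.symm_comp,
    LinearMap.id_comp, ← LinearMap.comp_assoc, ← LinearMap.comp_assoc, ← TensorProduct.map_comp,
    ← TensorProduct.map_comp, LinearMap.id_comp, h₁, h₂]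

theorem Rep.assoc : Rep (juxt (juxt i i') i'') (juxt i (juxt i' i''))
    (.id (List.append_assoc X X' X'')) (TensorProduct.assoc k A A' A'').toLinearMap := by
  -- The constraint `webAppend` is invertible, so every element of the source comes from the
  -- threefold tensor product, where pure tensors suffice.
  suffices h : ∀ z : ((webObj k n X).carrier ⊗[k] (webObj k n X').carrier) ⊗[k]
      (webObj k n X'').carrier,
      juxt i (juxt i' i'') (castEquiv (webObj k n) (List.append_assoc X X' X'')
        (webAppend k n (X ++ X') X'' (TensorProduct.map (webAppend k n X X').toLinearMap
          LinearMap.id z))) = TensorProduct.assoc k A A' A''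
            (juxt (juxt i i') i'' (webAppend k n (X ++ X') X''
              (TensorProduct.map (webAppend k n X X').toLinearMap LinearMap.id z))) by
    refine LinearMap.ext fun x => ?_
    have := h (TensorProduct.map (webAppend k n X X').symm.toLinearMap LinearMap.id
      ((webAppend k n (X ++ X') X'').symm x))
    rw [← LinearMap.comp_apply (TensorProduct.map _ _), ← TensorProduct.map_comp,
      LinearEquiv.comp_symm, LinearMap.id_comp, TensorProduct.map_id, LinearMap.id_apply,
      LinearEquiv.apply_symm_apply] at this
    exact this
  intro z
  induction z using TensorProduct.induction_on with
  | zero => simp only [map_zero]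
  | add z w hz hw => simp only [map_add, hz, hw]
  | tmul z t =>
    induction z using TensorProduct.induction_on with
    | zero => simp only [TensorProduct.zero_tmul, map_zero]
    | add z w hz hw => simp only [TensorProduct.add_tmul, map_add, hz, hw]
    | tmul x y =>
      simp only [TensorProduct.map_tmul, LinearEquiv.coe_coe, LinearMap.id_apply]
      rw [webAppend_assoc, juxt_webAppend, juxt_webAppend, juxt_webAppend, juxt_webAppend,
        TensorProduct.assoc_tmul]

theorem Rep.symm {h : X = Y} {e : A ≃ₗ[k] B} (hf : Rep i j (.id h) e.toLinearMap) :
    Rep j i (.id h.symm) e.symm.toLinearMap := by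
  subst h
  have h₁ : j = e.toLinearMap ∘ₗ i := hf
  change i = e.symm.toLinearMap ∘ₗ j
  rw [h₁, ← LinearMap.comp_assoc, LinearEquiv.symm_comp, LinearMap.id_comp]

theorem Rep.assoc_symm : Rep (juxt i (juxt i' i'')) (juxt (juxt i i') i'')
    (.id (List.append_assoc X X' X'').symm) (TensorProduct.assoc k A A' A'').symm.toLinearMap :=
  Rep.assoc.symm

/-- The comparison maps out of the same module may be composed with a linear map. -/
theorem Rep.map_left {f : Diag k X Y} {t : A' →ₗ[k] A} {i₀ : (webObj k n X).carrier →ₗ[k] A'}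
    {f₀ : A →ₗ[k] B} (hi : i = t ∘ₗ i₀) (h : Rep i j f f₀) : Rep i₀ j f (f₀ ∘ₗ t) := by
  subst hi
  exact h

theorem Rep.map_right {f : Diag k X Y} {t : B →ₗ[k] B'} {j₀ : (webObj k n Y).carrier →ₗ[k] B'}
    {f₀ : A →ₗ[k] B} (hj : j₀ = t ∘ₗ j) (h : Rep i j f f₀) : Rep i j₀ f (t ∘ₗ f₀) := by
  subst hj
  have h' : j ∘ₗ interp n f = f₀ ∘ₗ i := h
  change (t ∘ₗ j) ∘ₗ interp n f = _
  rw [LinearMap.comp_assoc, h', LinearMap.comp_assoc]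

theorem juxt_emptyIncl (x : (webObj k n X).carrier) :
    juxt (emptyIncl k n) i x = (1 : k) ⊗ₜ[k] i x := by
  have h := webAppend_nil X (1 : k) x
  rw [one_smul] at h
  refine (congrArg (juxt (emptyIncl k n) i) h.symm).trans ?_
  exact juxt_webAppend (i := emptyIncl k n) (j := i) (X := []) _ _

theorem castEquiv_append_nil_symm (X : List ℕ+) (x : (webObj k n X).carrier) :
    castEquiv (webObj k n) (List.append_nil X).symm x = webAppend k n X []
      (TensorProduct.tmul k (N := (webObj k n []).carrier) x (1 : k)) := by
  have h := webAppend_right_nil X x (1 : k)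
  rw [one_smul] at h
  conv_lhs => rw [← h]
  exact castEquiv_symm_apply _ (List.append_nil X) _

theorem juxt_right_emptyIncl (x : (webObj k n X).carrier) :
    juxt i (emptyIncl k n) (castEquiv (webObj k n) (List.append_nil X).symm x) =
      i x ⊗ₜ[k] (1 : k) := by
  rw [castEquiv_append_nil_symm]
  exact juxt_webAppend (i := i) (j := emptyIncl k n) (Y := []) _ _

end operators
end
end PWebs

namespace PWebs
noncomputable section

namespace S

/-! ## Degrees in the coproduct -/

section degrees
variable {k : Type u} [Field k] {n : ℕ}

theorem map_pdeg_mulL (i j : ℤ) (v : V k n) (z : S k n ⊗[k] S k n) :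
    TensorProduct.map (pdeg k n i) (pdeg k n j) (mulL v z) =
      mulL v (TensorProduct.map (pdeg k n (i - 1)) (pdeg k n j) z) := by
  induction z using TensorProduct.induction_on with
  | zero => simp
  | add z w hz hw => simp only [map_add, hz, hw]
  | tmul a b => simp [pdeg_ι_mul]

theorem map_pdeg_mulR (i j : ℤ) (s : ZMod 2) (v : V k n) (z : S k n ⊗[k] S k n) :
    TensorProduct.map (pdeg k n i) (pdeg k n j) (mulR s v z) =
      mulR s v (TensorProduct.map (pdeg k n i) (pdeg k n (j - 1)) z) := by
  induction z using TensorProduct.induction_on with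
  | zero => simp
  | add z w hz hw => simp only [map_add, hz, hw]
  | tmul a b => simp [pdeg_ι_mul, pdeg_twist]

theorem capForm_map_pdeg (z : S k n ⊗[k] S k n) :
    capForm k n (TensorProduct.map (pdeg k n 1) (pdeg k n 1) z) = capForm k n z := by
  induction z using TensorProduct.induction_on with
  | zero => simp
  | add z w hz hw => simp only [map_add, hz, hw]
  | tmul a b => simp only [TensorProduct.map_tmul, capForm_tmul, vProj_pdeg_one]

/-! ### The form and the cup on vectors: straightening -/

theorem exists_ι_eq {a : S k n} (ha : a ∈ deg k n 1) : ∃ v, ι k n v = a := by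
  rwa [deg, pow_one] at ha

/-- This is supersymmetry of the form. The form pairs `v_i` with `v_{-i}` only, of which one is
even, so the twist acts trivially on every coordinate that contributes. -/
theorem form_vTwist {s : ZMod 2} {v : V k n} (hv : v ∈ vPart k n s) (w : V k n) :
    form k n (vTwist k n s w) v = form k n v w := by
  change ∑ i : Idx n, (koszul k s i.parity * w i) * v i.swap = ∑ i : Idx n, v i * w i.swap
  rw [← (Equiv.sumComm (Fin n) (Fin n)).sum_comp fun i : Idx n => v i * w i.swap]
  refine Finset.sum_congr rfl fun i _ => ?_
  change _ = v i.swap * w (Sum.swap (Sum.swap i))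
  rw [Sum.swap_swap]
  by_cases h : v i.swap = 0
  · simp [h]
  · rw [← eq_parity hv h, koszul_swap']
    ring

/-- The sign `(-1)^{|i|}` of the cup cancels against the sign of moving the odd cap past `v_i`, and
what remains is the expansion of `a` in the basis `v_i`. -/
theorem contract_cupVec_left {a : S k n} (ha : a ∈ deg k n 1) :
    TensorProduct.map (twist k n 1).toLinearMap (capForm k n)
      (TensorProduct.assoc k _ _ _ (cupVec k n ⊗ₜ a)) = a ⊗ₜ 1 := by
  obtain ⟨w, rfl⟩ := exists_ι_eq ha
  rw [cupVec, TensorProduct.sum_tmul, map_sum, map_sum]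
  have e : ι k n w = ∑ i : Idx n, w i • ι k n (Pi.single i 1) := by
    conv_lhs => rw [← Finset.univ_sum_single w, map_sum]
    refine Finset.sum_congr rfl fun i _ => ?_
    rw [← map_smul, ← Pi.single_smul, smul_eq_mul, mul_one]
  conv_rhs => rw [e, TensorProduct.sum_tmul]
  refine Finset.sum_congr rfl fun i _ => ?_
  rw [← TensorProduct.smul_tmul', map_smul, map_smul, TensorProduct.assoc_tmul,
    TensorProduct.map_tmul, AlgHom.toLinearMap_apply, twist_ι (single_mem i), capForm_tmul,
    vProj_ι, vProj_ι,
    form_single_left, Sum.swap_swap, ← TensorProduct.smul_tmul', smul_smul, koszul_mul_self,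
    one_smul,
    ← TensorProduct.smul_tmul', ← TensorProduct.tmul_smul, smul_eq_mul, mul_one]

/-- Now the odd cup moves past `a`. The form of `a` with `v_i` selects the coordinate `-i`, whose
sign is `(-1)^{|-i|} = -(-1)^{|i|}`; this is the origin of the minus sign in the second
straightening relation. -/
theorem contract_cupVec_right {a : S k n} (ha : a ∈ deg k n 1) :
    TensorProduct.map (capForm k n) LinearMap.id
      ((TensorProduct.assoc k _ _ _).symm (twist k n 1 a ⊗ₜ cupVec k n)) = -((1 : k) ⊗ₜ a) := by
  obtain ⟨w, rfl⟩ := exists_ι_eq ha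
  rw [cupVec, TensorProduct.tmul_sum, map_sum, map_sum]
  have e : ι k n w = ∑ i : Idx n, w i.swap • ι k n (Pi.single i.swap 1) := by
    conv_lhs => rw [← Finset.univ_sum_single w, map_sum]
    rw [← (Equiv.sumComm (Fin n) (Fin n)).sum_comp]
    refine Finset.sum_congr rfl fun i _ => ?_
    change ι k n (Pi.single i.swap (w i.swap)) = _
    rw [← map_smul, ← Pi.single_smul, smul_eq_mul, mul_one]
  conv_rhs => rw [e, TensorProduct.tmul_sum, ← Finset.sum_neg_distrib]
  refine Finset.sum_congr rfl fun i _ => ?_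
  rw [TensorProduct.tmul_smul, map_smul, map_smul, TensorProduct.assoc_symm_tmul,
    TensorProduct.map_tmul, LinearMap.id_apply, capForm_tmul, vProj_twist, vProj_ι, vProj_ι,
    form_single_right]
  change koszul k 1 i.parity • ((koszul k 1 (Idx.parity i.swap) * w i.swap) ⊗ₜ[k] _) = _
  rw [koszul_parity_swap, neg_mul, TensorProduct.neg_tmul, smul_neg, TensorProduct.tmul_smul,
    TensorProduct.smul_tmul', TensorProduct.smul_tmul', smul_eq_mul, smul_eq_mul, ← mul_assoc,
    koszul_mul_self, one_mul, mul_one]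

variable [NeZero (2 : k)]

/-- `Δ` preserves the total degree. On degree `d` the degree of one factor therefore determines that
of the other, and a split, defined by two projections, can be computed with one. -/
theorem map_pdeg_comul {d : ℕ} {a : S k n} (ha : a ∈ deg k n d) (i j : ℤ) :
    TensorProduct.map (pdeg k n i) (pdeg k n j) (comul a) =
      if i + j = d then comulR j a else 0 := by
  revert i j
  refine deg_induction (P := fun d a => ∀ i j : ℤ,
    TensorProduct.map (pdeg k n i) (pdeg k n j) (comul a) = if i + j = d then comulR j a else 0)
    ?_ ?_ ?_ ?_ ha
  · intro i j
    rw [comul_one, TensorProduct.map_tmul, pdeg_one, pdeg_one, comulR_one]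
    split_ifs <;> first | rfl | (exfalso; push_cast at *; omega) | simp
  · intro d c a h i j
    rw [map_smul, map_smul, map_smul, h, smul_ite, smul_zero]
  · intro d a b h h' i j
    rw [map_add, map_add, map_add, h, h']
    split_ifs <;> simp
  · intro d s v hv a h i j
    rw [comul_ι_mul hv, map_add, map_pdeg_mulL, map_pdeg_mulR, h, h, comulR_ι_mul _ hv]
    split_ifs <;> first | (exfalso; push_cast at *; omega) | simp

theorem comulR_eq_comulL {d : ℕ} {a : S k n} (ha : a ∈ deg k n d) (i j : ℤ) (h : i + j = d) :
    comulR j a = comulL i a := by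
  revert i j
  refine deg_induction (P := fun d a => ∀ i j : ℤ, i + j = d → comulR j a = comulL i a)
    ?_ ?_ ?_ ?_ ha
  · intro i j h
    obtain rfl : i = -j := by push_cast at h; omega
    simp only [comulR_one, comulL_one, neg_eq_zero]
  · intro d c a h i j e
    rw [map_smul, map_smul, h i j e]
  · intro d a b h h' i j e
    rw [map_add, map_add, h i j e, h' i j e]
  · intro d s v hv a h i j e
    rw [comulR_ι_mul _ hv, comulL_ι_mul _ hv, h (i - 1) j (by push_cast at e; omega),
      h i (j - 1) (by push_cast at e; omega)]

/-- The left factor would have negative degree. -/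
theorem comulR_of_lt {d : ℕ} {a : S k n} (ha : a ∈ deg k n d) {r : ℤ} (h : d < r) :
    comulR r a = 0 := by
  have e := map_pdeg_comul ha (d - r) r
  rw [if_pos (by ring)] at e
  have h0 : pdeg k n (d - r) = 0 := if_neg (by omega)
  rw [← e, h0, TensorProduct.map_zero_left, LinearMap.zero_apply]

theorem comulL_of_lt {d : ℕ} {a : S k n} (ha : a ∈ deg k n d) {r : ℤ} (h : d < r) :
    comulL r a = 0 := by
  have e := map_pdeg_comul ha r (d - r)
  rw [if_pos (by ring), comulR_eq_comulL ha r (d - r) (by ring)] at e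
  have h0 : pdeg k n (d - r) = 0 := if_neg (by omega)
  rw [← e, h0, TensorProduct.map_zero_right, LinearMap.zero_apply]

theorem rungE_of_lt {d : ℕ} {a : S k n} (ha : a ∈ deg k n d) (b : S k n) {r : ℤ} (h : d < r) :
    rungE r (a ⊗ₜ b) = 0 := by
  rw [rungE_tmul, comulR_of_lt ha h, map_zero]

theorem rungF_of_lt (a : S k n) {d : ℕ} {b : S k n} (hb : b ∈ deg k n d) {r : ℤ} (h : d < r) :
    rungF r (a ⊗ₜ b) = 0 := by
  rw [rungF_tmul, comulL_of_lt hb h, map_zero]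

/-- The form sees only the component of `Δ` in `V ⊗ V`, and `Δ` preserves the total degree. -/
theorem antForm_comp_pdeg : antForm ∘ₗ pdeg k n 2 = antForm := by
  refine ext_deg fun d a ha => ?_
  rw [LinearMap.comp_apply, pdeg_of_mem ha]
  split_ifs with h
  · rfl
  · rw [map_zero, antForm, LinearMap.comp_apply, ← capForm_map_pdeg, map_pdeg_comul ha,
      if_neg (by omega), map_zero]

/-- Contractions are convenient with the full coproduct, whereas the diagram contains splits of a
strand labelled 1. The two agree because the form factors through the projections to degree one. -/
theorem capOp_eq_comulR_comulL : (capOp : S k n ⊗[k] S k n →ₗ[k] S k n ⊗[k] S k n) =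
    TensorProduct.map (twist k n 1).toLinearMap ((TensorProduct.lid k _).toLinearMap ∘ₗ
        TensorProduct.map (capForm k n) LinearMap.id ∘ₗ
        (TensorProduct.assoc k _ _ _).symm.toLinearMap) ∘ₗ
      (TensorProduct.assoc k _ _ _).toLinearMap ∘ₗ TensorProduct.map (comulR 1) (comulL 1) := by
  have key : TensorProduct.map (twist k n 1).toLinearMap ((TensorProduct.lid k _).toLinearMap ∘ₗ
        TensorProduct.map (capForm k n) LinearMap.id ∘ₗ
        (TensorProduct.assoc k _ _ _).symm.toLinearMap) ∘ₗ
      (TensorProduct.assoc k (S k n) (S k n) (S k n ⊗[k] S k n)).toLinearMap =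
      TensorProduct.map (twist k n 1).toLinearMap ((TensorProduct.lid k _).toLinearMap ∘ₗ
        TensorProduct.map (capForm k n) LinearMap.id ∘ₗ
        (TensorProduct.assoc k _ _ _).symm.toLinearMap) ∘ₗ
      (TensorProduct.assoc k (S k n) (S k n) (S k n ⊗[k] S k n)).toLinearMap ∘ₗ
      TensorProduct.map (TensorProduct.map LinearMap.id (pdeg k n 1))
        (TensorProduct.map (pdeg k n 1) LinearMap.id) := by
    refine TensorProduct.ext (TensorProduct.ext' fun a b => TensorProduct.ext' fun c d => ?_)
    simp [capForm_tmul, vProj_pdeg_one]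
  rw [capOp, ← LinearMap.comp_assoc, key, LinearMap.comp_assoc, LinearMap.comp_assoc,
    ← TensorProduct.map_comp]
  rfl

theorem antOpL_eq_comulR : (antOpL : S k n ⊗[k] S k n →ₗ[k] S k n ⊗[k] S k n) =
    TensorProduct.map (twist k n 1).toLinearMap ((TensorProduct.lid k _).toLinearMap ∘ₗ
      TensorProduct.map antForm LinearMap.id) ∘ₗ
    (TensorProduct.assoc k _ _ _).toLinearMap ∘ₗ TensorProduct.map (comulR 2) LinearMap.id := by
  have key : TensorProduct.map (twist k n 1).toLinearMap ((TensorProduct.lid k _).toLinearMap ∘ₗ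
      TensorProduct.map antForm LinearMap.id) ∘ₗ
      (TensorProduct.assoc k (S k n) (S k n) (S k n)).toLinearMap =
      TensorProduct.map (twist k n 1).toLinearMap ((TensorProduct.lid k _).toLinearMap ∘ₗ
        TensorProduct.map antForm LinearMap.id) ∘ₗ
      (TensorProduct.assoc k (S k n) (S k n) (S k n)).toLinearMap ∘ₗ
      TensorProduct.map (TensorProduct.map LinearMap.id (pdeg k n 2)) LinearMap.id := by
    refine TensorProduct.ext_threefold fun a b c => ?_
    have h : antForm (pdeg k n 2 b) = antForm b := DFunLike.congr_fun antForm_comp_pdeg b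
    simp [h]
  rw [antOpL, ← LinearMap.comp_assoc, key, LinearMap.comp_assoc, LinearMap.comp_assoc,
    ← TensorProduct.map_comp]
  rfl

theorem antOpR_eq_comulL : (antOpR : S k n ⊗[k] S k n →ₗ[k] S k n ⊗[k] S k n) =
    TensorProduct.map (twist k n 1).toLinearMap ((TensorProduct.lid k _).toLinearMap ∘ₗ
      TensorProduct.map antForm LinearMap.id) ∘ₗ
    TensorProduct.map LinearMap.id (comulL 2) := by
  have key : TensorProduct.map antForm LinearMap.id ∘ₗ comul (k := k) (n := n) =
      TensorProduct.map antForm LinearMap.id ∘ₗ comulL 2 := by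
    rw [comulL, ← LinearMap.comp_assoc, ← TensorProduct.map_comp, antForm_comp_pdeg,
      LinearMap.id_comp]
  rw [antOpR, key, ← TensorProduct.map_comp, LinearMap.comp_id, LinearMap.comp_assoc]

/-! ## The form and the cup on vectors -/

/-- The part of `Δ(vw)` in `V ⊗ V` is `v ⊗ w` plus the signed `w ⊗ v`. By `form_vTwist` both terms
contribute `(v, w)`, which is why the antenna carries the factor one half. -/
theorem antForm_mul {a b : S k n} (ha : a ∈ deg k n 1) (hb : b ∈ deg k n 1) :
    antForm (a * b) = 2 * capForm k n (a ⊗ₜ b) := by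
  obtain ⟨v, rfl⟩ := exists_ι_eq ha
  obtain ⟨w, rfl⟩ := exists_ι_eq hb
  have hw : comul (ι k n w) = ι k n w ⊗ₜ[k] 1 + 1 ⊗ₜ[k] ι k n w := by
    obtain ⟨w₀, h₀, w₁, h₁, rfl⟩ := vSplit w
    have e₀ := comul_ι_mul h₀ 1
    have e₁ := comul_ι_mul h₁ 1
    rw [mul_one, comul_one, mulL_tmul, mulR_tmul, map_one, mul_one] at e₀ e₁
    rw [map_add, map_add, e₀, e₁, TensorProduct.add_tmul, TensorProduct.tmul_add]
    abel
  have key : ∀ s, ∀ v ∈ vPart k n s, antForm (ι k n v * ι k n w) =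
      2 * capForm k n (ι k n v ⊗ₜ ι k n w) := fun s v hv => by
    rw [antForm, LinearMap.comp_apply, comul_ι_mul hv, hw]
    simp only [map_add, mulL_tmul, mulR_tmul, map_one, mul_one, capForm_tmul, vProj_one,
      vProj_twist, vProj_ι, map_zero, LinearMap.zero_apply, form_vTwist hv]
    ring
  obtain ⟨v₀, h₀, v₁, h₁, rfl⟩ := vSplit v
  rw [map_add, add_mul, map_add, key 0 v₀ h₀, key 1 v₁ h₁, TensorProduct.add_tmul, map_add]
  ring

end degrees
end S
end
end PWebs

namespace PWebs
noncomputable section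

/-! ## The operators of the generators and of the ladder diagrams -/

theorem lid_comp_map_smul {k : Type u} [Field k] {n : ℕ} (c : k) (f : S k n →ₗ[k] k) :
    (TensorProduct.lid k (S k n)).toLinearMap ∘ₗ TensorProduct.map (c • f) LinearMap.id =
      c • ((TensorProduct.lid k (S k n)).toLinearMap ∘ₗ TensorProduct.map f LinearMap.id) := by
  rw [TensorProduct.map_smul_left, LinearMap.comp_smul]

section ladders
variable {k : Type u} [Field k] [NeZero (2 : k)] {n : ℕ}

theorem pairIncl_comp_proj (a b : ℕ) :
    pairIncl k n a b ∘ₗ (webAppend k n (st a) (st b)).toLinearMap ∘ₗ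
      TensorProduct.map (strandProj k n a) (strandProj k n b) =
        TensorProduct.map (S.pdeg k n a) (S.pdeg k n b) := by
  rw [pairIncl, juxt, LinearMap.comp_assoc,
    ← LinearMap.comp_assoc _ (webAppend k n (st a) (st b)).toLinearMap
      (webAppend k n (st a) (st b)).symm.toLinearMap, LinearEquiv.symm_comp,
    LinearMap.id_comp, ← TensorProduct.map_comp,
    strandIncl_comp_strandProj, strandIncl_comp_strandProj]

theorem Rep.split (a b c : ℕ) (h : a + b = c) :
    Rep (strandIncl k n c) (pairIncl k n a b) (.split a b c h) (S.comulR b) := by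
  refine (congrArg (· ∘ₗ S.comul ∘ₗ strandIncl k n c) (pairIncl_comp_proj a b)).trans
    (LinearMap.ext fun x => ?_)
  exact (S.map_pdeg_comul (strandIncl_mem_deg c x) a b).trans (if_pos (by exact_mod_cast h))

/-- A split can be represented by projecting either factor. In the ladder diagrams the form is
chosen that projects the strand leaving the upright. -/
theorem Rep.split_left (a b c : ℕ) (h : a + b = c) :
    Rep (strandIncl k n c) (pairIncl k n a b) (.split a b c h) (S.comulL a) :=
  (Rep.split a b c h).congr <| LinearMap.ext fun x =>
    S.comulR_eq_comulL (strandIncl_mem_deg c x) a b (by exact_mod_cast h)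

theorem Rep.merge (a b c : ℕ) (h : a + b = c) :
    Rep (pairIncl k n a b) (strandIncl k n c) (.merge a b c h) (LinearMap.mul' k (S k n)) := by
  have e : strandIncl k n c ∘ₗ mergeMap k n a b c =
      (S.pdeg k n c ∘ₗ LinearMap.mul' k (S k n)) ∘ₗ pairIncl k n a b := by
    rw [← strandIncl_comp_strandProj]
    rfl
  refine Eq.trans e (ext_pairIncl fun x hx y hy => ?_)
  rw [LinearMap.comp_apply, LinearMap.mul'_apply, S.pdeg_of_mem (SetLike.mul_mem_graded hx hy),
    if_pos (by exact_mod_cast h.symm)]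

theorem Rep.cap : Rep (pairIncl k n 1 1) (emptyIncl k n) .cap (S.capForm k n) := rfl

theorem Rep.cup : Rep (emptyIncl k n) (pairIncl k n 1 1) .cup (cupMap k n) := by
  refine (congrArg (· ∘ₗ cupMap k n) (pairIncl_comp_proj 1 1)).trans (LinearMap.ext_ring ?_)
  have hι : ∀ v : V k n, S.pdeg k n (1 : ℕ) (S.ι k n v) = S.ι k n v := fun v => by
    have h := S.ι_mul_mem_deg v (S.one_mem_deg (k := k) (n := n))
    rw [mul_one] at h
    rw [S.pdeg_of_mem h, if_pos rfl]
  change TensorProduct.map _ _ ((1 : k) • S.cupVec k n) = (1 : k) • S.cupVec k n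
  rw [one_smul, S.cupVec, map_sum]
  exact Finset.sum_congr rfl fun i _ => by rw [map_smul, TensorProduct.map_tmul, hι, hι]

theorem Rep.antenna :
    Rep (strandIncl k n 2) (emptyIncl k n) Diag.antenna ((2 : k)⁻¹ • S.antForm) := by
  refine ((Rep.cap.comp (Rep.split 1 1 2 rfl)).smul _).congr
    (LinearMap.ext fun x => congrArg ((2 : k)⁻¹ * ·) ?_)
  have h := S.map_pdeg_comul (strandIncl_mem_deg 2 x) 1 1
  rw [if_pos (by norm_num)] at h
  change S.capForm k n (S.comulR ((1 : ℕ) : ℤ) _) = S.capForm k n (S.comul _)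
  rw [Nat.cast_one, ← h, S.capForm_map_pdeg]

section absorb
variable {X Y : List ℕ+} {A B : Type u} [AddCommGroup A] [Module k A] [AddCommGroup B]
  [Module k B] {i : (webObj k n X).carrier →ₗ[k] A} {j : (webObj k n Y).carrier →ₗ[k] B}

/-- Prepending the empty sequence does not change a list, but it adds a tensor factor `k` on the
side of the comparison maps. This removes the factor. -/
theorem lid_comp_juxt : j = (TensorProduct.lid k B).toLinearMap ∘ₗ juxt (emptyIncl k n) j :=
  LinearMap.ext fun x => by
    change j x = TensorProduct.lid k B (juxt (X := []) (emptyIncl k n) j x)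
    rw [juxt_emptyIncl, TensorProduct.lid_tmul, one_smul]

/-- Juxtaposition with a diagram ending at the empty sequence. -/
theorem Rep.tensor_id_of_empty_target {f : Diag k X []} {f₀ : A →ₗ[k] k}
    (hf : Rep i (emptyIncl k n) f f₀) :
    Rep (juxt i j) j (.tensor f (.id (rfl : Y = Y)))
      ((TensorProduct.lid k B).toLinearMap ∘ₗ TensorProduct.map f₀ LinearMap.id) :=
  (hf.tensor Rep.id (.id rfl)).map_right lid_comp_juxt

/-- Juxtaposition with a diagram starting at the empty sequence. -/
theorem Rep.tensor_id_of_empty_source {f : Diag k [] X} {f₀ : k →ₗ[k] A}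
    (hf : Rep (emptyIncl k n) i f f₀) :
    Rep (X := Y) j (juxt i j) (.tensor f (.id (rfl : Y = Y)))
      (TensorProduct.map f₀ LinearMap.id ∘ₗ TensorProduct.mk k k B 1) :=
  (hf.tensor Rep.id (.id rfl)).map_left (LinearMap.ext fun x => juxt_emptyIncl x)

theorem juxt_one_juxt_one (j : (webObj k n Y).carrier →ₗ[k] B) :
    juxt (X := st 1) (Y := st 1 ++ Y) (strandIncl k n 1) (juxt (strandIncl k n 1) j) =
      (TensorProduct.assoc k _ _ _).toLinearMap ∘ₗ
        juxt (X := st 1 ++ st 1) (pairIncl k n 1 1) j :=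
  (LinearMap.comp_id _).symm.trans
    (Rep.assoc (i := strandIncl k n 1) (i' := strandIncl k n 1) (i'' := j))

theorem juxt_pairIncl_one (j : (webObj k n Y).carrier →ₗ[k] B) :
    juxt (X := st 1 ++ st 1) (pairIncl k n 1 1) j =
      (TensorProduct.assoc k _ _ _).symm.toLinearMap ∘ₗ
        juxt (X := st 1) (Y := st 1 ++ Y) (strandIncl k n 1) (juxt (strandIncl k n 1) j) :=
  (LinearMap.comp_id _).symm.trans
    (Rep.assoc_symm (i := strandIncl k n 1) (i' := strandIncl k n 1) (i'' := j))

end absorb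

/-! ### Operators of the ladder diagrams, and their vanishing for negative labels -/

theorem Rep.rungR {r a b a' b' : ℕ} (h₁ : a' + r = a) (h₂ : r + b = b') :
    Rep (pairIncl k n a b) (pairIncl k n a' b') (Diag.rungR r a b a' b') (S.rungE r) := by
  rw [Diag.rungR, dif_pos ⟨h₁, h₂⟩]
  exact ((Rep.id.tensor (Rep.merge r b b' h₂) (.merge ..)).comp Rep.assoc).comp
    ((Rep.split a' r a h₁).tensor Rep.id (.id rfl))

theorem Rep.rungL {r a b a' b' : ℕ} (h₁ : a + r = a') (h₂ : r + b' = b) :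
    Rep (pairIncl k n a b) (pairIncl k n a' b') (Diag.rungL r a b a' b') (S.rungF r) := by
  rw [Diag.rungL, dif_pos ⟨h₁, h₂⟩]
  exact (((Rep.merge a r a' h₁).tensor Rep.id (.id rfl)).comp Rep.assoc_symm).comp
    (Rep.id.tensor (Rep.split_left r b' b h₂) (.split ..))

theorem Rep.capAt {a b a' b' : ℕ} (h₁ : a' + 1 = a) (h₂ : 1 + b' = b) :
    Rep (pairIncl k n a b) (pairIncl k n a' b') (Diag.capAt a b a' b') S.capOp := by
  rw [show Diag.capAt a b a' b' = (_ : Diag k _ _) from dif_pos ⟨h₁, h₂⟩, S.capOp_eq_comulR_comulL]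
  have hcap : Rep (X := st 1 ++ (st 1 ++ st b')) (juxt (strandIncl k n 1) (pairIncl k n 1 b'))
      (strandIncl k n b') (.tensor .cap (.id (rfl : st b' = st b'))) _ :=
    Rep.map_left (juxt_pairIncl_one _) (Rep.tensor_id_of_empty_target Rep.cap)
  exact ((Rep.strand_tensor a' hcap ((Diag.HasParity.tensor .cap (.id rfl)).congr
    (add_zero 1))).comp Rep.assoc).comp
    ((Rep.split a' 1 a h₁).tensor (Rep.split_left 1 b' b h₂) (.split ..))

theorem Rep.cupAt {a b a' b' : ℕ} (h₁ : a + 1 = a') (h₂ : 1 + b = b') :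
    Rep (pairIncl k n a b) (pairIncl k n a' b') (Diag.cupAt a b a' b') S.cupOp := by
  rw [show Diag.cupAt a b a' b' = (_ : Diag k _ _) from dif_pos ⟨h₁, h₂⟩]
  have hcup : Rep (Y := st 1 ++ (st 1 ++ st b)) (strandIncl k n b)
      (juxt (strandIncl k n 1) (pairIncl k n 1 b)) (.tensor .cup (.id (rfl : st b = st b))) _ :=
    Rep.map_right (juxt_one_juxt_one _) (Rep.tensor_id_of_empty_source Rep.cup)
  refine ((((Rep.merge a 1 a' h₁).tensor (Rep.merge 1 b b' h₂) (.merge ..)).comp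
    Rep.assoc_symm).comp (Rep.strand_tensor a hcup ((Diag.HasParity.tensor .cup (.id rfl)).congr
    (add_zero 1)))).congr (congrArg (· ∘ₗ pairIncl k n a b) ?_)
  refine congrArg (fun t => (TensorProduct.map (LinearMap.mul' k (S k n))
    (LinearMap.mul' k (S k n)) ∘ₗ (TensorProduct.assoc k _ _ _).symm.toLinearMap) ∘ₗ
    TensorProduct.map (S.twist k n 1).toLinearMap ((TensorProduct.assoc k _ _ _).toLinearMap ∘ₗ t))
    (LinearMap.ext fun x => ?_)
  change (1 : k) • S.cupVec k n ⊗ₜ[k] x = S.cupVec k n ⊗ₜ[k] x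
  rw [one_smul]

theorem Rep.antR {a b a' : ℕ} (h : a' + 2 = a) :
    Rep (pairIncl k n a b) (pairIncl k n a' b) (Diag.antR a b a') ((2 : k)⁻¹ • S.antOpL) := by
  rw [show Diag.antR a b a' = (_ : Diag k _ _) from dif_pos h, S.antOpL_eq_comulR]
  have e := ((Rep.strand_tensor a' (Rep.tensor_id_of_empty_target (j := strandIncl k n b)
    Rep.antenna) ((Diag.HasParity.tensor Diag.hasParity_antenna (.id rfl)).congr
    (add_zero 1))).comp Rep.assoc).comp ((Rep.split a' 2 a h).tensor Rep.id (.id rfl))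
  rw [lid_comp_map_smul, TensorProduct.map_smul_right, LinearMap.smul_comp,
    LinearMap.smul_comp] at e
  exact e

theorem Rep.antL {a b b' : ℕ} (h : 2 + b' = b) :
    Rep (pairIncl k n a b) (pairIncl k n a b') (Diag.antL a b b') ((2 : k)⁻¹ • S.antOpR) := by
  rw [show Diag.antL a b b' = (_ : Diag k _ _) from dif_pos h, S.antOpR_eq_comulL]
  have e := (Rep.strand_tensor a (Rep.tensor_id_of_empty_target (j := strandIncl k n b')
    Rep.antenna) ((Diag.HasParity.tensor Diag.hasParity_antenna (.id rfl)).congr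
    (add_zero 1))).comp (Rep.id.tensor (Rep.split_left 2 b' b h) (.split ..))
  rw [lid_comp_map_smul, TensorProduct.map_smul_right, LinearMap.smul_comp] at e
  exact e

theorem interp_rungR_of_lt {r a b a' b' : ℕ} (h : a < r) :
    interp n (Diag.rungR r a b a' b' : Diag k _ _) = 0 := by
  rw [Diag.rungR, dif_neg (by omega)]
  rfl

theorem interp_rungL_of_lt {r a b a' b' : ℕ} (h : b < r) :
    interp n (Diag.rungL r a b a' b' : Diag k _ _) = 0 := by
  rw [Diag.rungL, dif_neg (by omega)]
  rfl

theorem interp_capAt_of_eq_zero {a b a' b' : ℕ} (h : a = 0 ∨ b = 0) :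
    interp n (Diag.capAt a b a' b' : Diag k _ _) = 0 := by
  rw [show Diag.capAt a b a' b' = (_ : Diag k _ _) from dif_neg (by omega)]
  rfl

/-- A rung thicker than its upright is the zero diagram by convention (`interp_rungR_of_lt`), and
the operator vanishes in that bidegree too. The operator identities thus cover the boundary cases of
the relations. -/
theorem rungE_comp_pairIncl {a b r : ℕ} (h : a < r) : S.rungE r ∘ₗ pairIncl k n a b = 0 :=
  (ext_pairIncl (g := 0) fun _ hx y _ => S.rungE_of_lt hx y (by exact_mod_cast h)).trans
    (LinearMap.zero_comp _)

theorem rungF_comp_pairIncl {a b r : ℕ} (h : b < r) : S.rungF r ∘ₗ pairIncl k n a b = 0 :=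
  (ext_pairIncl (g := 0) fun x _ _ hy => S.rungF_of_lt x hy (by exact_mod_cast h)).trans
    (LinearMap.zero_comp _)

theorem capOp_comp_pairIncl {a b : ℕ} (h : a = 0 ∨ b = 0) : S.capOp ∘ₗ pairIncl k n a b = 0 := by
  refine (ext_pairIncl (g := 0) fun x hx y hy => ?_).trans (LinearMap.zero_comp _)
  have e : S.comulR 1 x ⊗ₜ[k] S.comulL 1 y = 0 := by
    rcases h with rfl | rfl
    · rw [S.comulR_of_lt hx (by norm_num), TensorProduct.zero_tmul]
    · rw [S.comulL_of_lt hy (by norm_num), TensorProduct.tmul_zero]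
  rw [S.capOp_eq_comulR_comulL, LinearMap.comp_apply, LinearMap.comp_apply, TensorProduct.map_tmul,
    e, map_zero, map_zero, LinearMap.zero_apply]

end ladders
end
end PWebs

namespace PWebs
noncomputable section

/-! ## The defining relations -/

section relations
variable {k : Type u} [Field k] [NeZero (2 : k)] {n : ℕ}

theorem pairIncl_zero_left {b c : ℕ} (h : b = c) (h' : st c = st 0 ++ st b)
    (x : (webObj k n (st c)).carrier) :
    pairIncl k n 0 b (castEquiv (webObj k n) h' x) = 1 ⊗ₜ strandIncl k n c x := by
  subst h
  have e := webAppend_nil (st b) (1 : k) x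
  rw [one_smul] at e
  have e₂ := juxt_webAppend (i := strandIncl k n 0) (j := strandIncl k n b)
    (show (webObj k n (st 0)).carrier from (1 : k)) x
  refine (congrArg (pairIncl k n 0 b) e.symm).trans (e₂.trans ?_)
  exact congrArg (· ⊗ₜ[k] strandIncl k n b x) (map_one (algebraMap k (S k n)))

theorem pairIncl_zero_right {a c : ℕ} (h : a = c) (h' : st c = st a ++ st 0)
    (x : (webObj k n (st c)).carrier) :
    pairIncl k n a 0 (castEquiv (webObj k n) h' x) = strandIncl k n c x ⊗ₜ 1 := by
  subst h
  have e₂ := juxt_webAppend (i := strandIncl k n a) (j := strandIncl k n 0) x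
    (show (webObj k n (st 0)).carrier from (1 : k))
  refine (congrArg (pairIncl k n a 0) (castEquiv_append_nil_symm (st a) x)).trans (e₂.trans ?_)
  exact congrArg (strandIncl k n a x ⊗ₜ[k] ·) (map_one (algebraMap k (S k n)))

theorem Rep.id_zero_left {b c : ℕ} (h : b = c) (h' : st c = st 0 ++ st b) :
    Rep (strandIncl k n c) (pairIncl k n 0 b) (.id h') (TensorProduct.mk k _ _ 1) :=
  LinearMap.ext fun x => pairIncl_zero_left h h' x

theorem Rep.id_zero_right {a c : ℕ} (h : a = c) (h' : st c = st a ++ st 0) :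
    Rep (strandIncl k n c) (pairIncl k n a 0) (.id h') ((TensorProduct.mk k _ _).flip 1) :=
  LinearMap.ext fun x => pairIncl_zero_right h h' x

/-- The projection to degree zero is the counit, so this is a counit axiom. It makes a split with a
leg labelled 0 the identity. -/
theorem comulL_zero (x : S k n) : S.comulL 0 x = 1 ⊗ₜ x := by
  have h : S.pdeg k n 0 = Algebra.linearMap k (S k n) ∘ₗ S.counit.toLinearMap :=
    LinearMap.ext S.pdeg_zero
  have e := S.counit_comul x
  conv_rhs => rw [← e]
  rw [S.comulL, LinearMap.comp_apply, h]
  generalize S.comul x = z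
  induction z using TensorProduct.induction_on with
  | zero => simp
  | add z w hz hw => simp only [map_add, hz, hw, TensorProduct.tmul_add]
  | tmul a b => simp [Algebra.algebraMap_eq_smul_one, TensorProduct.smul_tmul']

theorem comulR_zero (x : S k n) : S.comulR 0 x = x ⊗ₜ 1 := by
  have h : S.pdeg k n 0 = Algebra.linearMap k (S k n) ∘ₗ S.counit.toLinearMap :=
    LinearMap.ext S.pdeg_zero
  have e := S.comul_counit x
  conv_rhs => rw [← e]
  rw [S.comulR, LinearMap.comp_apply, h]
  generalize S.comul x = z
  induction z using TensorProduct.induction_on with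
  | zero => simp
  | add z w hz hw => simp only [map_add, hz, hw, TensorProduct.add_tmul]
  | tmul a b => simp [Algebra.algebraMap_eq_smul_one, TensorProduct.smul_tmul]

/-- An identity diagram is invertible, so precomposing with it loses nothing. For merges with a
strand labelled 0 the source becomes a single strand in this way, and the claim becomes `1 * x = x`
or `x * 1 = x`. -/
theorem interp_id_comp_symm {X Y : List ℕ+} {f : Diag k Y X} (h : X = Y)
    (e : interp n (.comp (.id h) f) = LinearMap.id) : interp n f = interp n (.id h.symm) := by
  subst h
  exact e

theorem interp_split_zero_left (b c : ℕ) (h : 0 + b = c) (h' : st c = st 0 ++ st b) :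
    interp n (.split 0 b c h : Diag k _ _) = interp n (.id h') :=
  Rep.eq (pairIncl_injective 0 b) (Rep.split_left 0 b c h) (Rep.id_zero_left (by omega) h')
    (congrArg (· ∘ₗ strandIncl k n c) (LinearMap.ext comulL_zero))

theorem interp_split_zero_right (a c : ℕ) (h : a + 0 = c) (h' : st c = st a ++ st 0) :
    interp n (.split a 0 c h : Diag k _ _) = interp n (.id h') :=
  Rep.eq (pairIncl_injective a 0) (Rep.split a 0 c h) (Rep.id_zero_right (by omega) h')
    (congrArg (· ∘ₗ strandIncl k n c) (LinearMap.ext comulR_zero))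

theorem interp_merge_zero_left (b c : ℕ) (h : 0 + b = c) (h' : st 0 ++ st b = st c) :
    interp n (.merge 0 b c h : Diag k _ _) = interp n (.id h') :=
  interp_id_comp_symm h'.symm <| Rep.eq (strandIncl_injective c)
    ((Rep.merge 0 b c h).comp (Rep.id_zero_left (by omega) h'.symm)) Rep.id
    (congrArg (· ∘ₗ strandIncl k n c) (LinearMap.ext one_mul))

theorem interp_merge_zero_right (a c : ℕ) (h : a + 0 = c) (h' : st a ++ st 0 = st c) :
    interp n (.merge a 0 c h : Diag k _ _) = interp n (.id h') :=
  interp_id_comp_symm h'.symm <| Rep.eq (strandIncl_injective c)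
    ((Rep.merge a 0 c h).comp (Rep.id_zero_right (by omega) h'.symm)) Rep.id
    (congrArg (· ∘ₗ strandIncl k n c) (LinearMap.ext mul_one))

/-- This is coassociativity with the two outer legs projected to fixed degrees. In a fixed total
degree the middle leg needs no projection. -/
theorem comulL_comulR (i j : ℤ) : (TensorProduct.assoc k _ _ _).toLinearMap ∘ₗ
    TensorProduct.map (S.comulL i) LinearMap.id ∘ₗ (S.comulR j : S k n →ₗ[k] _) =
      TensorProduct.map LinearMap.id (S.comulR j) ∘ₗ S.comulL i := by
  have e₁ : ∀ z : (S k n ⊗[k] S k n) ⊗[k] S k n, TensorProduct.assoc k _ _ _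
      (TensorProduct.map (TensorProduct.map (S.pdeg k n i) LinearMap.id) (S.pdeg k n j) z) =
      TensorProduct.map (S.pdeg k n i) (TensorProduct.map LinearMap.id (S.pdeg k n j))
        (TensorProduct.assoc k _ _ _ z) := fun z =>
    (TensorProduct.map_map_assoc (S.pdeg k n i) LinearMap.id (S.pdeg k n j) z).symm
  refine LinearMap.ext fun x => ?_
  have h := congrArg (TensorProduct.map (S.pdeg k n i)
    (TensorProduct.map LinearMap.id (S.pdeg k n j))) (S.comul_coassoc x)
  rw [← e₁] at h
  rw [← LinearMap.comp_apply (TensorProduct.map _ _) (TensorProduct.map _ _),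
    ← TensorProduct.map_comp, ← LinearMap.comp_apply (TensorProduct.map _ _)
      (TensorProduct.map _ _) (S.comul x), ← TensorProduct.map_comp] at h
  simp only [S.comulR, S.comulL, LinearMap.comp_apply, LinearEquiv.coe_coe]
  rw [← LinearMap.comp_apply (TensorProduct.map _ _) (TensorProduct.map _ _),
    ← TensorProduct.map_comp, ← LinearMap.comp_apply (TensorProduct.map _ _)
      (TensorProduct.map _ _) (S.comul x), ← TensorProduct.map_comp]
  exact h

theorem interp_split_assoc (a b c : ℕ) :
    interp n (.comp (.comp (.split (a + b) c (a + b + c) rfl)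
        (.tensor (.split a b (a + b) rfl) (.id (rfl : st c = st c))))
      (.id (List.append_assoc (st a) (st b) (st c))) : Diag k _ _) =
    interp n (.comp (.split a (b + c) (a + b + c) (Nat.add_assoc a b c).symm)
      (.tensor (.id (rfl : st a = st a)) (.split b c (b + c) rfl))) :=
  Rep.eq (juxt_injective (strandIncl_injective a) (pairIncl_injective b c))
    (Rep.assoc.comp (((Rep.split_left a b (a + b) rfl).tensor Rep.id (.id rfl)).comp
      (Rep.split (a + b) c _ rfl)))
    ((Rep.id.tensor (Rep.split b c (b + c) rfl) (.split ..)).comp (Rep.split_left a (b + c) _ _))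
    (congrArg (· ∘ₗ strandIncl k n (a + b + c)) (comulL_comulR a c))

theorem interp_merge_assoc (a b c : ℕ) :
    interp n (.comp (.tensor (.merge a b (a + b) rfl) (.id (rfl : st c = st c)))
      (.merge (a + b) c (a + b + c) rfl) : Diag k _ _) =
    interp n (.comp (.id (List.append_assoc (st a) (st b) (st c)))
      (.comp (.tensor (.id (rfl : st a = st a)) (.merge b c (b + c) rfl))
        (.merge a (b + c) (a + b + c) (Nat.add_assoc a b c).symm))) := by
  refine Rep.eq (strandIncl_injective _)
    ((Rep.merge (a + b) c _ rfl).comp ((Rep.merge a b (a + b) rfl).tensor Rep.id (.id rfl)))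
    (((Rep.merge a (b + c) _ _).comp (Rep.id.tensor (Rep.merge b c (b + c) rfl) (.merge ..))).comp
      Rep.assoc) (congrArg (· ∘ₗ juxt (pairIncl k n a b) (strandIncl k n c)) ?_)
  exact TensorProduct.ext_threefold fun x y z => mul_assoc x y z

theorem interp_rung_swap (a b r s : ℕ) (h₁ : s ≤ a + r) (h₂ : r ≤ b + s) :
    interp n (.comp (Diag.rungR s a b (a - s) (b + s))
      (Diag.rungL r (a - s) (b + s) (a + r - s) (b + s - r)) : Diag k _ _) =
    interp n (Diag.sumUpTo (fun t => .smul ((Ring.choose ((a : ℤ) - b + r - s) t : ℤ) : k)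
      (.comp (Diag.rungL (r - t) a b (a + (r - t)) (b - (r - t)))
        (Diag.rungR (s - t) (a + (r - t)) (b - (r - t)) (a + r - s) (b + s - r)))) (min r s)) := by
  -- For `s > a` the subtraction `a - s` is truncated. The first rung is then the zero diagram, and
  -- the operator `rungE s` vanishes on this pair of strands.
  have hl : Rep (pairIncl k n a b) (pairIncl k n (a + r - s) (b + s - r))
      (.comp (Diag.rungR s a b (a - s) (b + s))
        (Diag.rungL r (a - s) (b + s) (a + r - s) (b + s - r))) (S.rungF r ∘ₗ S.rungE s) := by
    rcases le_or_gt s a with h | h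
    · exact (Rep.rungL (by omega) (by omega)).comp (Rep.rungR (by omega) (by omega))
    · exact Rep.comp_of_eq_zero (interp_rungR_of_lt h) (rungE_comp_pairIncl h)
  have hr : ∀ t ≤ min r s, Rep (pairIncl k n a b) (pairIncl k n (a + r - s) (b + s - r))
      (.smul ((Ring.choose ((a : ℤ) - b + r - s) t : ℤ) : k)
        (.comp (Diag.rungL (r - t) a b (a + (r - t)) (b - (r - t)))
          (Diag.rungR (s - t) (a + (r - t)) (b - (r - t)) (a + r - s) (b + s - r))))
      (((Ring.choose ((a : ℤ) - b + r - s) t : ℤ) : k) •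
        (S.rungE ((s - t : ℕ) : ℤ) ∘ₗ S.rungF ((r - t : ℕ) : ℤ))) := by
    intro t ht
    refine Rep.smul _ ?_
    rcases le_or_gt (r - t) b with h | h
    · exact (Rep.rungR (by omega) (by omega)).comp (Rep.rungL (by omega) (by omega))
    · exact Rep.comp_of_eq_zero (interp_rungL_of_lt h) (rungF_comp_pairIncl h)
  refine Rep.eq (pairIncl_injective _ _) hl (Rep.sumUpTo _ hr) (ext_pairIncl fun x hx y hy => ?_)
  -- The bound `min r s + 1` exceeds `r` or `s`, so it is admissible, and it is the number of
  -- summands in the relation.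
  rw [LinearMap.comp_apply, S.rungF_rungE hx hy r s (min r s + 1) (by omega), LinearMap.sum_apply]
  refine Finset.sum_congr rfl fun t ht => ?_
  have ht' := Finset.mem_range.mp ht
  rw [LinearMap.smul_apply, LinearMap.comp_apply, Nat.cast_sub (by omega), Nat.cast_sub (by omega)]

theorem interp_straighten_left :
    interp n (.comp (.tensor .cup (.id (rfl : st 1 = st 1)))
      (.comp (.id (List.append_assoc (st 1) (st 1) (st 1)))
        (.tensor (.id (rfl : st 1 = st 1)) .cap)) : Diag k _ _) =
    interp n (.id (List.append_nil (st 1)).symm) := by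
  have hr : Rep (strandIncl k n 1) (juxt (strandIncl k n 1) (emptyIncl k n))
      (.id (List.append_nil (st 1)).symm) ((TensorProduct.mk k (S k n) k).flip 1) :=
    LinearMap.ext fun x => juxt_right_emptyIncl x
  refine Rep.eq (juxt_injective (strandIncl_injective 1) Function.injective_id)
    (((Rep.strand_tensor 1 Rep.cap .cap).comp Rep.assoc).comp
      (Rep.tensor_id_of_empty_source (j := strandIncl k n 1) Rep.cup)) hr
    (LinearMap.ext fun x => ?_)
  refine Eq.trans ?_ (S.contract_cupVec_left (strandIncl_mem_deg 1 x))
  change TensorProduct.map _ _ (TensorProduct.assoc k _ _ _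
    (((1 : k) • S.cupVec k n) ⊗ₜ[k] strandIncl k n 1 x)) = _
  rw [one_smul]

theorem interp_straighten_right :
    interp n (.comp (.tensor (.id (rfl : st 1 = st 1)) .cup)
      (.comp (.id (List.append_assoc (st 1) (st 1) (st 1)).symm)
        (.tensor .cap (.id (rfl : st 1 = st 1)))) : Diag k _ _) =
    interp n (.smul (-1) (.id (List.append_nil (st 1)))) := by
  have hl : Rep (juxt (strandIncl k n 1) (emptyIncl k n)) (strandIncl k n 1)
      (.comp (.tensor (.id (rfl : st 1 = st 1)) .cup)
        (.comp (.id (List.append_assoc (st 1) (st 1) (st 1)).symm)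
          (.tensor .cap (.id (rfl : st 1 = st 1))))) _ :=
    ((Rep.tensor_id_of_empty_target (j := strandIncl k n 1) Rep.cap).comp Rep.assoc_symm).comp
      (Rep.strand_tensor 1 Rep.cup .cup)
  -- The lists `st 1 ++ []` and `st 1` agree by computation, so the transport is the identity and
  -- `x` can be read as an element of either module.
  have hr : ∀ x : (webObj k n (st 1)).carrier, juxt (strandIncl k n 1) (emptyIncl k n)
      (show (webObj k n (st 1 ++ [])).carrier from x) = strandIncl k n 1 x ⊗ₜ[k] (1 : k) :=
    fun x => juxt_right_emptyIncl x
  refine LinearMap.ext fun x => strandIncl_injective 1 ?_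
  refine (DFunLike.congr_fun hl x).trans ?_
  have e := congrArg (TensorProduct.lid k (S k n))
    (S.contract_cupVec_right (strandIncl_mem_deg 1 (show (webObj k n (st 1)).carrier from x)))
  rw [map_neg, TensorProduct.lid_tmul, one_smul] at e
  refine Eq.trans ?_ (e.trans ?_)
  · refine congrArg (fun z => TensorProduct.lid k (S k n) (TensorProduct.map (S.capForm k n)
      LinearMap.id ((TensorProduct.assoc k _ _ _).symm (TensorProduct.map
        (S.twist k n 1).toLinearMap (cupMap k n) z)))) (hr x) |>.trans ?_
    change TensorProduct.lid k (S k n) (TensorProduct.map (S.capForm k n) LinearMap.id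
      ((TensorProduct.assoc k _ _ _).symm (S.twist k n 1 _ ⊗ₜ[k] ((1 : k) • S.cupVec k n)))) = _
    rw [one_smul]
  · refine Eq.trans ?_ (map_smul (strandIncl k n 1) (-1 : k)
      (show (webObj k n (st 1)).carrier from x)).symm
    rw [neg_one_smul]

theorem interp_antenna_retraction :
    interp n (.comp (.merge 1 1 2 rfl) Diag.antenna : Diag k _ _) = interp n .cap := by
  refine Rep.eq (j := emptyIncl k n) Function.injective_id
    (Rep.antenna.comp (Rep.merge 1 1 2 rfl)) Rep.cap (ext_pairIncl fun x hx y hy => ?_)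
  change (2 : k)⁻¹ * S.antForm (x * y) = _
  rw [S.antForm_mul hx hy, inv_mul_cancel_left₀ two_ne_zero]

theorem interp_cap_rung_right (a b r : ℕ) (h₁ : r + 1 ≤ a) (h₂ : 1 ≤ b + r) :
    interp n (.comp (Diag.rungR r a b (a - r) (b + r))
      (Diag.capAt (a - r) (b + r) (a - r - 1) (b + r - 1)) : Diag k _ _) =
    interp n (.add
      (.comp (Diag.capAt a b (a - 1) (b - 1))
        (Diag.rungR r (a - 1) (b - 1) (a - r - 1) (b + r - 1)))
      (if r = 0 then .zero _ _ else .smul 2 (.comp (Diag.antR a b (a - 2))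
        (Diag.rungR (r - 1) (a - 2) b (a - r - 1) (b + r - 1))))) := by
  have hl : Rep (pairIncl k n a b) (pairIncl k n (a - r - 1) (b + r - 1)) _ _ :=
    (Rep.capAt (by omega) (by omega)).comp (Rep.rungR (a' := a - r) (b' := b + r) (r := r)
      (by omega) (by omega))
  have hr₁ : Rep (pairIncl k n a b) (pairIncl k n (a - r - 1) (b + r - 1))
      (.comp (Diag.capAt a b (a - 1) (b - 1))
        (Diag.rungR r (a - 1) (b - 1) (a - r - 1) (b + r - 1))) (S.rungE r ∘ₗ S.capOp) := by
    -- For `b = 0`, which is possible when `r > 0`, there is no strand on the right upright to cap: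
    -- both the diagram and the operator are zero.
    rcases Nat.eq_zero_or_pos b with h | h
    · exact Rep.comp_of_eq_zero (interp_capAt_of_eq_zero (.inr h)) (capOp_comp_pairIncl (.inr h))
    · exact (Rep.rungR (by omega) (by omega)).comp (Rep.capAt (by omega) (by omega))
  have hr₂ : Rep (pairIncl k n a b) (pairIncl k n (a - r - 1) (b + r - 1))
      (if r = 0 then .zero _ _ else .smul 2 (.comp (Diag.antR a b (a - 2))
        (Diag.rungR (r - 1) (a - 2) b (a - r - 1) (b + r - 1))))
      (S.rungE (r - 1) ∘ₗ S.antOpL) := by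
    -- For `r = 0` the integer `r - 1` is negative and the operator `rungE (r - 1)` is zero, as the
    -- omitted summand requires. Otherwise the coefficient 2 cancels the one half in the antenna.
    split_ifs with h
    · have e : (S.rungE (r - 1) : S k n ⊗[k] S k n →ₗ[k] _) = 0 :=
        LinearMap.ext fun z => S.rungE_of_neg (by omega) z
      rw [e, LinearMap.zero_comp]
      exact Rep.zero
    · have e := (((Rep.rungR (n := n) (r := r - 1) (by omega) (by omega)).comp
        (Rep.antR (a := a) (b := b) (a' := a - 2) (by omega))).smul (2 : k) :
        Rep (pairIncl k n a b) (pairIncl k n (a - r - 1) (b + r - 1)) _ _)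
      rwa [LinearMap.comp_smul, smul_smul, mul_inv_cancel₀ two_ne_zero, one_smul,
        Nat.cast_sub (by omega), Nat.cast_one] at e
  exact Rep.eq (pairIncl_injective _ _) hl (hr₁.add hr₂)
    (congrArg (· ∘ₗ pairIncl k n a b) (LinearMap.ext (S.capOp_rungE r)))

theorem interp_cap_rung_left (a b r : ℕ) (h₁ : r + 1 ≤ b) (h₂ : 1 ≤ a + r) :
    interp n (.comp (Diag.rungL r a b (a + r) (b - r))
      (Diag.capAt (a + r) (b - r) (a + r - 1) (b - r - 1)) : Diag k _ _) =
    interp n (.add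
      (.comp (Diag.capAt a b (a - 1) (b - 1))
        (Diag.rungL r (a - 1) (b - 1) (a + r - 1) (b - r - 1)))
      (if r = 0 then .zero _ _ else .smul 2 (.comp (Diag.antL a b (b - 2))
        (Diag.rungL (r - 1) a (b - 2) (a + r - 1) (b - r - 1))))) := by
  have hl : Rep (pairIncl k n a b) (pairIncl k n (a + r - 1) (b - r - 1)) _ _ :=
    (Rep.capAt (by omega) (by omega)).comp (Rep.rungL (a' := a + r) (b' := b - r) (r := r)
      (by omega) (by omega))
  have hr₁ : Rep (pairIncl k n a b) (pairIncl k n (a + r - 1) (b - r - 1))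
      (.comp (Diag.capAt a b (a - 1) (b - 1))
        (Diag.rungL r (a - 1) (b - 1) (a + r - 1) (b - r - 1))) (S.rungF r ∘ₗ S.capOp) := by
    rcases Nat.eq_zero_or_pos a with h | h
    · exact Rep.comp_of_eq_zero (interp_capAt_of_eq_zero (.inl h)) (capOp_comp_pairIncl (.inl h))
    · exact (Rep.rungL (by omega) (by omega)).comp (Rep.capAt (by omega) (by omega))
  have hr₂ : Rep (pairIncl k n a b) (pairIncl k n (a + r - 1) (b - r - 1))
      (if r = 0 then .zero _ _ else .smul 2 (.comp (Diag.antL a b (b - 2))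
        (Diag.rungL (r - 1) a (b - 2) (a + r - 1) (b - r - 1))))
      (S.rungF (r - 1) ∘ₗ S.antOpR) := by
    split_ifs with h
    · have e : (S.rungF (r - 1) : S k n ⊗[k] S k n →ₗ[k] _) = 0 :=
        LinearMap.ext fun z => S.rungF_of_neg (by omega) z
      rw [e, LinearMap.zero_comp]
      exact Rep.zero
    · have e := (((Rep.rungL (n := n) (r := r - 1) (by omega) (by omega)).comp
        (Rep.antL (a := a) (b := b) (b' := b - 2) (by omega))).smul (2 : k) :
        Rep (pairIncl k n a b) (pairIncl k n (a + r - 1) (b - r - 1)) _ _)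
      rwa [LinearMap.comp_smul, smul_smul, mul_inv_cancel₀ two_ne_zero, one_smul,
        Nat.cast_sub (by omega), Nat.cast_one] at e
  exact Rep.eq (pairIncl_injective _ _) hl (hr₁.add hr₂)
    (congrArg (· ∘ₗ pairIncl k n a b) (LinearMap.ext (S.capOp_rungF r)))

theorem interp_cup_rung_right (a b r : ℕ) (h : r ≤ a + 1) :
    interp n (.comp (Diag.cupAt a b (a + 1) (b + 1))
      (Diag.rungR r (a + 1) (b + 1) (a + 1 - r) (b + r + 1)) : Diag k _ _) =
    interp n (.comp (Diag.rungR r a b (a - r) (b + r))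
      (Diag.cupAt (a - r) (b + r) (a + 1 - r) (b + r + 1))) := by
  have hl : Rep (pairIncl k n a b) (pairIncl k n (a + 1 - r) (b + r + 1)) _ _ :=
    (Rep.rungR (r := r) (by omega) (by omega)).comp (Rep.cupAt (a' := a + 1) (b' := b + 1)
      (by omega) (by omega))
  have hr : Rep (pairIncl k n a b) (pairIncl k n (a + 1 - r) (b + r + 1))
      (.comp (Diag.rungR r a b (a - r) (b + r))
        (Diag.cupAt (a - r) (b + r) (a + 1 - r) (b + r + 1))) (S.cupOp ∘ₗ S.rungE r) := by
    -- The excluded case is `r = a + 1`: the rung below the cup has a negative label, so this side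
    -- of the relation is zero, and so is its operator.
    rcases le_or_gt r a with h | h
    · exact (Rep.cupAt (by omega) (by omega)).comp (Rep.rungR (by omega) (by omega))
    · exact Rep.comp_of_eq_zero (interp_rungR_of_lt h) (rungE_comp_pairIncl h)
  exact Rep.eq (pairIncl_injective _ _) hl hr
    (congrArg (· ∘ₗ pairIncl k n a b) (LinearMap.ext (S.rungE_cupOp r)))

theorem interp_cup_rung_left (a b r : ℕ) (h : r ≤ b + 1) :
    interp n (.comp (Diag.cupAt a b (a + 1) (b + 1))
      (Diag.rungL r (a + 1) (b + 1) (a + r + 1) (b + 1 - r)) : Diag k _ _) =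
    interp n (.comp (Diag.rungL r a b (a + r) (b - r))
      (Diag.cupAt (a + r) (b - r) (a + r + 1) (b + 1 - r))) := by
  have hl : Rep (pairIncl k n a b) (pairIncl k n (a + r + 1) (b + 1 - r)) _ _ :=
    (Rep.rungL (r := r) (by omega) (by omega)).comp (Rep.cupAt (a' := a + 1) (b' := b + 1)
      (by omega) (by omega))
  have hr : Rep (pairIncl k n a b) (pairIncl k n (a + r + 1) (b + 1 - r))
      (.comp (Diag.rungL r a b (a + r) (b - r))
        (Diag.cupAt (a + r) (b - r) (a + r + 1) (b + 1 - r))) (S.cupOp ∘ₗ S.rungF r) := by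
    rcases le_or_gt r b with h | h
    · exact (Rep.cupAt (by omega) (by omega)).comp (Rep.rungL (by omega) (by omega))
    · exact Rep.comp_of_eq_zero (interp_rungL_of_lt h) (rungF_comp_pairIncl h)
  exact Rep.eq (pairIncl_injective _ _) hl hr
    (congrArg (· ∘ₗ pairIncl k n a b) (LinearMap.ext (S.rungF_cupOp r)))

theorem interp_defRel {X Y : List ℕ+} {f g : Diag k X Y} (h : Diag.DefRel f g) :
    interp n f = interp n g := by
  cases h with
  | split_zero_left b c h => exact interp_split_zero_left b c h _
  | split_zero_right a c h => exact interp_split_zero_right a c h _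
  | merge_zero_left b c h => exact interp_merge_zero_left b c h _
  | merge_zero_right a c h => exact interp_merge_zero_right a c h _
  | split_assoc a b c => exact interp_split_assoc a b c
  | merge_assoc a b c => exact interp_merge_assoc a b c
  | rung_swap a b r s h₁ h₂ => exact interp_rung_swap a b r s h₁ h₂
  | straighten_left => exact interp_straighten_left
  | straighten_right => exact interp_straighten_right
  | antenna_retraction => exact interp_antenna_retraction
  | cap_rung_right a b r h₁ h₂ => exact interp_cap_rung_right a b r h₁ h₂
  | cap_rung_left a b r h₁ h₂ => exact interp_cap_rung_left a b r h₁ h₂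
  | cup_rung_right a b r h => exact interp_cup_rung_right a b r h
  | cup_rung_left a b r h => exact interp_cup_rung_left a b r h

end relations
end
end PWebs

namespace PWebs
noncomputable section

namespace PMod
section even
variable {k : Type u} [Field k] {n : ℕ} {M N M' N' L L' : PMod k n}

/-- Even maps pass through the super tensor product without signs, even when the other map is not
homogeneous. The constraints of the functor are even, and this lets them be moved past `sTensor`. -/
theorem sTensor_comp_map {f : M.carrier →ₗ[k] N.carrier} (f' : N.carrier →ₗ[k] L.carrier)
    {g : M'.carrier →ₗ[k] N'.carrier} {g' : N'.carrier →ₗ[k] L'.carrier} (hf : f ∈ homs M N 0)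
    (hg : g ∈ homs M' N' 0) (hg' : g' ∈ allHoms N' L') :
    sTensor f' g' ∘ₗ TensorProduct.map f g = sTensor (f' ∘ₗ f) (g' ∘ₗ g) := by
  refine allHoms_induction (P := fun g' => sTensor f' g' ∘ₗ TensorProduct.map f g =
    sTensor (f' ∘ₗ f) (g' ∘ₗ g)) (fun q g' hg' => ?_) (fun g' h' e e' => ?_) hg'
  · rw [← sTensor_eq_map f hg, sTensor_comp f' hf (homs_le 0 hg) hg', koszul_zero_right, one_smul]
  · rw [sTensor_add_right, LinearMap.add_comp, e, e', LinearMap.add_comp, sTensor_add_right]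

theorem map_comp_sTensor (f : M.carrier →ₗ[k] N.carrier) (f' : N.carrier →ₗ[k] L.carrier)
    {g : M'.carrier →ₗ[k] N'.carrier} {g' : N'.carrier →ₗ[k] L'.carrier}
    (hg : g ∈ allHoms M' N') (hg' : g' ∈ homs N' L' 0) :
    TensorProduct.map f' g' ∘ₗ sTensor f g = sTensor (f' ∘ₗ f) (g' ∘ₗ g) := by
  refine allHoms_induction (P := fun g => TensorProduct.map f' g' ∘ₗ sTensor f g =
    sTensor (f' ∘ₗ f) (g' ∘ₗ g)) (fun q g hg => ?_) (fun g h e e' => ?_) hg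
  · refine ext_part₂ fun s m hm t m' hm' => ?_
    rw [LinearMap.comp_apply, sTensor_tmul f hg.1 hm, map_smul, TensorProduct.map_tmul,
      sTensor_tmul _ (comp_mem_zero hg hg').1 hm, LinearMap.comp_apply, LinearMap.comp_apply]
  · rw [sTensor_add_right, LinearMap.comp_add, e, e', LinearMap.comp_add, sTensor_add_right]

end even
end PMod

/-! ## Invariance under the relations -/

section invariance
variable {k : Type u} [Field k] [NeZero (2 : k)] {n : ℕ} {X Y Z X' Y' Z' X'' Y'' : List ℕ+}

/-- This is naturality of the tensor constraint. It holds because `interp` of a juxtaposition is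
defined by conjugating with that constraint. -/
theorem interp_tensor_comp_webAppend (f : Diag k X Y) (g : Diag k X' Y') :
    interp n (.tensor f g) ∘ₗ (webAppend k n X X').toLinearMap =
      (webAppend k n Y Y').toLinearMap ∘ₗ PMod.sTensor (interp n f) (interp n g) := by
  change ((webAppend k n Y Y').toLinearMap ∘ₗ PMod.sTensor (interp n f) (interp n g) ∘ₗ
      (webAppend k n X X').symm.toLinearMap) ∘ₗ (webAppend k n X X').toLinearMap = _
  rw [LinearMap.comp_assoc, LinearMap.comp_assoc, LinearEquiv.symm_comp, LinearMap.comp_id]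

theorem webAppend_assoc_comp (X X' X'' : List ℕ+) :
    (castEquiv (webObj k n) (List.append_assoc X X' X'')).toLinearMap ∘ₗ
      (webAppend k n (X ++ X') X'').toLinearMap ∘ₗ
        TensorProduct.map (webAppend k n X X').toLinearMap LinearMap.id =
    (webAppend k n X (X' ++ X'')).toLinearMap ∘ₗ
      TensorProduct.map LinearMap.id (webAppend k n X' X'').toLinearMap ∘ₗ
        (TensorProduct.assoc k _ _ _).toLinearMap :=
  TensorProduct.ext_threefold fun x y z => webAppend_assoc X X' X'' x y z

theorem webAppend_nil_eq (Y : List ℕ+) : (webAppend k n [] Y).toLinearMap =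
    (TensorProduct.lid k (webObj k n Y).carrier).toLinearMap :=
  TensorProduct.ext (LinearMap.ext fun (c : k) => LinearMap.ext fun y => webAppend_nil Y c y)

theorem webAppend_right_nil_eq (X : List ℕ+) :
    (castEquiv (webObj k n) (List.append_nil X)).toLinearMap ∘ₗ
      (webAppend k n X []).toLinearMap = (TensorProduct.rid k (webObj k n X).carrier).toLinearMap :=
  TensorProduct.ext (LinearMap.ext fun x => LinearMap.ext fun (c : k) => webAppend_right_nil X x c)

/-- By naturality the constraints are moved to the outside (`e₁`, `e₂`), where they match by the
coherence `webAppend_assoc_comp`. What is left is naturality of the associator for `sTensor`. -/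
theorem interp_tensor_assoc (f : Diag k X Y) (g : Diag k X' Y') (h : Diag k X'' Y'') :
    interp n (.comp (.tensor (.tensor f g) h) (.id (List.append_assoc Y Y' Y''))) =
      interp n (.comp (.id (List.append_assoc X X' X'')) (.tensor f (.tensor g h))) := by
  have hg := interp_mem_allHoms (n := n) g
  have hh := interp_mem_allHoms (n := n) h
  have e₁ : PMod.sTensor (interp n (.tensor f g)) (interp n h) ∘ₗ
      TensorProduct.map (webAppend k n X X').toLinearMap LinearMap.id =
      TensorProduct.map (webAppend k n Y Y').toLinearMap LinearMap.id ∘ₗ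
        PMod.sTensor (M := PMod.tensor (webObj k n X) (webObj k n X'))
          (N := PMod.tensor (webObj k n Y) (webObj k n Y'))
          (PMod.sTensor (interp n f) (interp n g)) (interp n h) := by
    rw [PMod.sTensor_comp_map (M := PMod.tensor (webObj k n X) (webObj k n X')) _
      (webAppend_mem X X') PMod.id_mem hh, PMod.map_comp_sTensor
      (M := PMod.tensor (webObj k n X) (webObj k n X'))
      (N := PMod.tensor (webObj k n Y) (webObj k n Y')) (L := webObj k n (Y ++ Y')) _ _ hh
      PMod.id_mem, interp_tensor_comp_webAppend]
    rfl
  have e₂ : PMod.sTensor (interp n f) (interp n (.tensor g h)) ∘ₗ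
      TensorProduct.map LinearMap.id (webAppend k n X' X'').toLinearMap =
      TensorProduct.map LinearMap.id (webAppend k n Y' Y'').toLinearMap ∘ₗ
        PMod.sTensor (M' := PMod.tensor (webObj k n X') (webObj k n X''))
          (N' := PMod.tensor (webObj k n Y') (webObj k n Y''))
          (interp n f) (PMod.sTensor (interp n g) (interp n h)) := by
    rw [PMod.sTensor_comp_map (M' := PMod.tensor (webObj k n X') (webObj k n X'')) _
      PMod.id_mem (webAppend_mem X' X'') (interp_mem_allHoms _), PMod.map_comp_sTensor
      (M' := PMod.tensor (webObj k n X') (webObj k n X''))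
      (N' := PMod.tensor (webObj k n Y') (webObj k n Y'')) (L' := webObj k n (Y' ++ Y'')) _ _
      (PMod.sTensor_mem_allHoms hg hh) (webAppend_mem Y' Y''), interp_tensor_comp_webAppend]
    rfl
  have key : ∀ z, interp n (.comp (.tensor (.tensor f g) h) (.id (List.append_assoc Y Y' Y'')))
      (webAppend k n (X ++ X') X''
        (TensorProduct.map (webAppend k n X X').toLinearMap LinearMap.id z)) =
      interp n (.comp (.id (List.append_assoc X X' X'')) (.tensor f (.tensor g h)))
      (webAppend k n (X ++ X') X''
        (TensorProduct.map (webAppend k n X X').toLinearMap LinearMap.id z)) := fun z => by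
    have a₁ := DFunLike.congr_fun (interp_tensor_comp_webAppend (n := n) (.tensor f g) h)
      (TensorProduct.map (webAppend k n X X').toLinearMap LinearMap.id z)
    have a₂ := DFunLike.congr_fun e₁ z
    have a₃ := DFunLike.congr_fun (webAppend_assoc_comp (k := k) (n := n) Y Y' Y'')
      (PMod.sTensor (M := PMod.tensor (webObj k n X) (webObj k n X'))
        (N := PMod.tensor (webObj k n Y) (webObj k n Y'))
        (PMod.sTensor (interp n f) (interp n g)) (interp n h) z)
    have a₄ := DFunLike.congr_fun (PMod.sTensor_assoc (f := interp n f) hg hh) z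
    have b₁ := DFunLike.congr_fun (webAppend_assoc_comp (k := k) (n := n) X X' X'') z
    have b₂ := DFunLike.congr_fun (interp_tensor_comp_webAppend (n := n) f (.tensor g h))
      (TensorProduct.map LinearMap.id (webAppend k n X' X'').toLinearMap
        (TensorProduct.assoc k _ _ _ z))
    have b₃ := DFunLike.congr_fun e₂ (TensorProduct.assoc k _ _ _ z)
    refine (congrArg (castEquiv (webObj k n) (List.append_assoc Y Y' Y'')) (a₁.trans (congrArg
      (webAppend k n (Y ++ Y') Y'') a₂))).trans (a₃.trans ?_)
    refine Eq.trans ?_ (((congrArg (interp n (.tensor f (.tensor g h))) b₁).trans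
      (b₂.trans (congrArg (webAppend k n Y (Y' ++ Y'')) b₃))).symm)
    exact congrArg (fun t => webAppend k n Y (Y' ++ Y'') (TensorProduct.map LinearMap.id
      (webAppend k n Y' Y'').toLinearMap t)) a₄
  refine LinearMap.ext fun x => ?_
  have e := key (TensorProduct.map (webAppend k n X X').symm.toLinearMap LinearMap.id
    ((webAppend k n (X ++ X') X'').symm x))
  rwa [← LinearMap.comp_apply (TensorProduct.map _ _), ← TensorProduct.map_comp,
    LinearEquiv.comp_symm, LinearMap.id_comp, TensorProduct.map_id, LinearMap.id_apply,
    LinearEquiv.apply_symm_apply] at e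

theorem interp_nil_tensor (f : Diag k X Y) :
    interp n (.tensor (.id (rfl : [] = [])) f) = interp n f := by
  refine LinearMap.ext fun x => ?_
  obtain ⟨z, rfl⟩ := (webAppend k n [] X).surjective x
  refine (DFunLike.congr_fun (interp_tensor_comp_webAppend (n := n)
    (.id (rfl : [] = [])) f) z).trans ?_
  refine (DFunLike.congr_fun (webAppend_nil_eq (k := k) (n := n) Y) _).trans ?_
  refine (DFunLike.congr_fun (PMod.lid_sTensor (interp_mem_allHoms (n := n) f)) z).trans ?_
  exact congrArg (interp n f) (DFunLike.congr_fun (webAppend_nil_eq (k := k) (n := n) X) z).symm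

theorem interp_tensor_nil (f : Diag k X Y) :
    interp n (.comp (.tensor f (.id (rfl : [] = []))) (.id (List.append_nil Y))) =
      interp n (.comp (.id (List.append_nil X)) f) := by
  refine LinearMap.ext fun x => ?_
  obtain ⟨z, rfl⟩ := (webAppend k n X []).surjective x
  refine (congrArg (castEquiv (webObj k n) (List.append_nil Y)) (DFunLike.congr_fun
    (interp_tensor_comp_webAppend (n := n) f (.id (rfl : [] = []))) z)).trans ?_
  refine (DFunLike.congr_fun (webAppend_right_nil_eq (k := k) (n := n) Y) _).trans ?_
  refine (DFunLike.congr_fun (PMod.rid_sTensor (interp n f)) z).trans ?_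
  exact congrArg (interp n f)
    (DFunLike.congr_fun (webAppend_right_nil_eq (k := k) (n := n) X) z).symm

/-- Interpretation preserves parity, so the super-interchange law for linear maps applies to the
interpreted diagrams with the same sign. -/
theorem interp_interchange {p q : ZMod 2} {f : Diag k X Y} (f' : Diag k Y Z) (g : Diag k X' Y')
    {g' : Diag k Y' Z'} (hf : Diag.HasParity f p) (hg' : Diag.HasParity g' q) :
    interp n (.comp (.tensor f g) (.tensor f' g')) =
      interp n (.smul (koszul k q p) (.tensor (.comp f f') (.comp g g'))) := by
  have e := PMod.sTensor_comp (interp n f') (interp_mem (n := n) hf)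
    (interp_mem_allHoms (n := n) g) (interp_mem (n := n) hg')
  refine LinearMap.ext fun x => ?_
  obtain ⟨z, rfl⟩ := (webAppend k n X X').surjective x
  have a₁ := DFunLike.congr_fun (interp_tensor_comp_webAppend (n := n) f g) z
  have a₂ := DFunLike.congr_fun (interp_tensor_comp_webAppend (n := n) f' g')
    (PMod.sTensor (interp n f) (interp n g) z)
  have a₃ := DFunLike.congr_fun (interp_tensor_comp_webAppend (n := n) (.comp f f') (.comp g g')) z
  refine (congrArg (interp n (.tensor f' g')) a₁).trans (a₂.trans ?_)
  refine (congrArg (webAppend k n Z Z') (DFunLike.congr_fun e z)).trans ?_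
  exact (map_smul (webAppend k n Z Z') _ _).trans (congrArg (koszul k q p • ·) a₃.symm)

theorem interp_tensor_id (X X' : List ℕ+) :
    interp n (.tensor (.id (rfl : X = X)) (.id (rfl : X' = X')) : Diag k _ _) =
      interp n (.id rfl) := by
  refine LinearMap.ext fun x => ?_
  obtain ⟨z, rfl⟩ := (webAppend k n X X').surjective x
  refine (DFunLike.congr_fun (interp_tensor_comp_webAppend (k := k) (n := n)
    (.id (rfl : X = X)) (.id (rfl : X' = X'))) z).trans ?_
  exact congrArg (webAppend k n X X') (DFunLike.congr_fun PMod.sTensor_id z)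

theorem interp_rel {f g : Diag k X Y} (h : Diag.Rel f g) : interp n f = interp n g := by
  induction h with
  | of h => exact interp_defRel h
  | add_congr g _ ih => simp only [interp, ih]
  | smul_congr c _ ih => simp only [interp, ih]
  | comp_congr_left g _ ih => simp only [interp, ih]
  | comp_congr_right f _ ih => simp only [interp, ih]
  | tensor_congr_left g _ ih => simp only [interp, ih]
  | tensor_congr_right f _ ih => simp only [interp, ih]
  | add_assoc => simp only [interp, add_assoc]
  | add_comm => simp only [interp, add_comm]
  | zero_add => simp only [interp, zero_add]
  | neg_add => simp [interp]
  | one_smul => simp only [interp, one_smul]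
  | mul_smul => simp only [interp, mul_smul]
  | smul_add => simp only [interp, smul_add]
  | add_smul => simp only [interp, add_smul]
  | id_comp => rfl
  | comp_id => rfl
  | comp_assoc => rfl
  | add_comp => simp only [interp, LinearMap.comp_add]
  | comp_add => simp only [interp, LinearMap.add_comp]
  | smul_comp => simp only [interp, LinearMap.comp_smul]
  | comp_smul => simp only [interp, LinearMap.smul_comp]
  | add_tensor =>
    simp only [interp, PMod.sTensor_add_left, LinearMap.comp_add, LinearMap.add_comp]
  | tensor_add =>
    simp only [interp, PMod.sTensor_add_right, LinearMap.comp_add, LinearMap.add_comp]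
  | smul_tensor =>
    simp only [interp, PMod.sTensor_smul_left, LinearMap.comp_smul, LinearMap.smul_comp]
  | tensor_smul =>
    simp only [interp, PMod.sTensor_smul_right, LinearMap.comp_smul, LinearMap.smul_comp]
  | tensor_id X X' => exact interp_tensor_id X X'
  | interchange f f' g g' hf hg' => exact interp_interchange f' g hf hg'
  | tensor_assoc f g h => exact interp_tensor_assoc f g h
  | nil_tensor f => exact interp_nil_tensor f
  | tensor_nil f => exact interp_tensor_nil f

end invariance
end
end PWebs

namespace PWebs
noncomputable section

/-! ## The monoidal superfunctor -/

section functor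
variable (k : Type u) [Field k] [NeZero (2 : k)] (n : ℕ)

/-- The value of the functor on a sequence of labels. -/
def webFunctorObj (X : PWeb k) : PModS k n := ⟨webObj k n X.labels, isSymTensor_webObj _⟩

/-- The value of the functor on a morphism. -/
def webFunctorMap {X Y : PWeb k} (f : WebHom k X.labels Y.labels) :
    webFunctorObj k n X ⟶ webFunctorObj k n Y :=
  Quot.lift (fun d => (⟨interp n d, interp_mem_allHoms d⟩ :
    PMod.allHoms (webObj k n X.labels) (webObj k n Y.labels)))
    (fun _ _ h => Subtype.ext (interp_rel h)) f

/-- The tensor constraint of the functor. -/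
def webFunctorμ (X Y : PWeb k) : tensorObj k (webFunctorObj k n X) (webFunctorObj k n Y) ≅
    webFunctorObj k n (tensorObj k X Y) :=
  FullSub.isoMk (PMod.isoOfEquiv (M := PMod.tensor (webObj k n X.labels) (webObj k n Y.labels))
    (webAppend k n X.labels Y.labels) (webAppend_mem X.labels Y.labels))

/-- The unit constraint of the functor. -/
def webFunctorε : unit k (C := PModS k n) ≅ webFunctorObj k n (unit k) :=
  FullSub.isoMk (Iso.refl (PMod.trivial k n))

theorem webFunctor_associativity (X Y Z : List ℕ+) :
    (castEquiv (webObj k n) (List.append_assoc X Y Z)).toLinearMap ∘ₗ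
      (webAppend k n (X ++ Y) Z).toLinearMap ∘ₗ
        PMod.sTensor (M := PMod.tensor (webObj k n X) (webObj k n Y))
          (webAppend k n X Y).toLinearMap LinearMap.id =
    ((webAppend k n X (Y ++ Z)).toLinearMap ∘ₗ
      PMod.sTensor (M' := PMod.tensor (webObj k n Y) (webObj k n Z))
        LinearMap.id (webAppend k n Y Z).toLinearMap) ∘ₗ
        (TensorProduct.assoc k _ _ _).toLinearMap := by
  rw [PMod.sTensor_eq_map (M := PMod.tensor (webObj k n X) (webObj k n Y)) _ PMod.id_mem,
    PMod.sTensor_eq_map (M' := PMod.tensor (webObj k n Y) (webObj k n Z)) _ (webAppend_mem Y Z)]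
  exact webAppend_assoc_comp X Y Z

/-- The monoidal superfunctor from webs to `𝔭(n)`-supermodules. -/
def webFunctor : MonoidalSuperfunctor k (PWeb k) (PModS k n) where
  obj := webFunctorObj k n
  map := webFunctorMap k n
  map_id _ := rfl
  map_comp f g := by
    induction f using WebHom.ind
    induction g using WebHom.ind
    rfl
  map_add' f g := by
    induction f using WebHom.ind
    induction g using WebHom.ind
    rfl
  map_smul' c f := by
    induction f using WebHom.ind
    rfl
  map_mem' := by
    rintro X Y p _ ⟨d, hd, rfl⟩
    exact interp_mem hd
  μ := webFunctorμ k n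
  ε := webFunctorε k n
  μ_mem X Y := webAppend_mem X.labels Y.labels
  ε_mem := PMod.id_mem (M := PMod.trivial k n)
  μ_naturality f g := by
    induction f using WebHom.ind with | _ f
    induction g using WebHom.ind with | _ g
    exact Subtype.ext (interp_tensor_comp_webAppend f g).symm
  associativity X Y Z := Subtype.ext (webFunctor_associativity k n X.labels Y.labels Z.labels)
  left_unitality X := Subtype.ext (by
    -- The unit constraint is the identity, so its tensor product with an identity drops out.
    refine Eq.trans ?_ (webAppend_nil_eq X.labels)
    exact congrArg ((webAppend k n [] X.labels).toLinearMap ∘ₗ ·) PMod.sTensor_id)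
  right_unitality X := Subtype.ext (by
    refine Eq.trans ?_ (webAppend_right_nil_eq X.labels)
    exact congrArg (((castEquiv (webObj k n) (List.append_nil X.labels)).toLinearMap ∘ₗ
      (webAppend k n X.labels []).toLinearMap) ∘ₗ ·) PMod.sTensor_id)

/-- This is an equality of objects, not only an isomorphism, since `webObj` adds no unit factor to a
single label. The cases are needed because `st` computes on constructors only. -/
theorem webFunctor_strand : ∀ d : ℕ, (webFunctor k n).obj (PWeb.strand k d) = PModS.sym k n d
  | 0 => rfl
  | _ + 1 => rfl

variable {k n}

/-- In each case the morphism induced by the equality of objects is the identity, and so is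
`strandEquiv`. This replaces `eqToHom` by linear maps that can be composed with inclusions and
projections. -/
theorem lin_eqToHom_webFunctor_strand : ∀ (d : ℕ)
    (h : (webFunctor k n).obj (PWeb.strand k d) = PModS.sym k n d),
    PModS.lin (eqToHom h) = (strandEquiv k n d).symm.toLinearMap
  | 0, _ => rfl
  | _ + 1, _ => rfl

theorem lin_eqToHom_webFunctor_strand_symm : ∀ (d : ℕ)
    (h : PModS.sym k n d = (webFunctor k n).obj (PWeb.strand k d)),
    PModS.lin (eqToHom h) = (strandEquiv k n d).toLinearMap
  | 0, _ => rfl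
  | _ + 1, _ => rfl

theorem lin_tensorHom_eqToHom (a b : ℕ) :
    PModS.lin (tensorHom k (eqToHom (webFunctor_strand k n a)) (eqToHom (webFunctor_strand k n b)))
      = TensorProduct.map (strandEquiv k n a).symm.toLinearMap
        (strandEquiv k n b).symm.toLinearMap := by
  refine Eq.trans (congrArg₂ PMod.sTensor (lin_eqToHom_webFunctor_strand a _)
    (lin_eqToHom_webFunctor_strand b _)) ?_
  exact PMod.sTensor_eq_map _ (PMod.symm_mem _ (strandEquiv_mem b))

theorem lin_tensorHom_eqToHom_symm (a b : ℕ) :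
    PModS.lin (tensorHom k (eqToHom (webFunctor_strand k n a).symm)
      (eqToHom (webFunctor_strand k n b).symm))
      = TensorProduct.map (strandEquiv k n a).toLinearMap (strandEquiv k n b).toLinearMap := by
  refine Eq.trans (congrArg₂ PMod.sTensor (lin_eqToHom_webFunctor_strand_symm a _)
    (lin_eqToHom_webFunctor_strand_symm b _)) ?_
  exact PMod.sTensor_eq_map _ (strandEquiv_mem b)

theorem map_symm_comp_map_strandProj (a b : ℕ) :
    TensorProduct.map (strandEquiv k n a).symm.toLinearMap (strandEquiv k n b).symm.toLinearMap ∘ₗ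
      TensorProduct.map (strandProj k n a) (strandProj k n b) =
    TensorProduct.map (symProj k n a) (symProj k n b) := by
  rw [← TensorProduct.map_comp, strandProj, strandProj, ← LinearMap.comp_assoc,
    ← LinearMap.comp_assoc, LinearEquiv.symm_comp, LinearEquiv.symm_comp, LinearMap.id_comp,
    LinearMap.id_comp]

theorem map_strandIncl_comp_map (a b : ℕ) :
    TensorProduct.map (strandIncl k n a) (strandIncl k n b) ∘ₗ
      TensorProduct.map (strandEquiv k n a).toLinearMap (strandEquiv k n b).toLinearMap =
    TensorProduct.map (symIncl k n a) (symIncl k n b) := by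
  rw [← TensorProduct.map_comp, strandIncl, strandIncl, LinearMap.comp_assoc,
    LinearMap.comp_assoc, LinearEquiv.symm_comp, LinearEquiv.symm_comp, LinearMap.comp_id,
    LinearMap.comp_id]

theorem symProj_one_ι (v : V k n) : symProj k n 1 (S.ι k n v) = vIncl k n v :=
  symProj_symIncl 1 (vIncl k n v)

theorem webFunctor_split (a b : ℕ) :
    PModS.lin (eqToHom (webFunctor_strand k n (a + b)).symm ≫
      (webFunctor k n).map (PWeb.split k a b) ≫
        ((webFunctor k n).μ (PWeb.strand k a) (PWeb.strand k b)).inv ≫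
          tensorHom k (eqToHom (webFunctor_strand k n a)) (eqToHom (webFunctor_strand k n b))) =
      spl k n a b := by
  have e₁ := lin_eqToHom_webFunctor_strand_symm (k := k) (n := n) (a + b)
    (webFunctor_strand k n (a + b)).symm
  have e₂ := lin_tensorHom_eqToHom (k := k) (n := n) a b
  refine LinearMap.ext fun x => ?_
  refine (DFunLike.congr_fun e₂ _).trans ?_
  refine (congrArg (fun y => TensorProduct.map (strandEquiv k n a).symm.toLinearMap
    (strandEquiv k n b).symm.toLinearMap ((webAppend k n (st a) (st b)).symm
      (splitMap k n a b (a + b) y))) (DFunLike.congr_fun e₁ x)).trans ?_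
  -- The interpretation of a split ends with the tensor constraint, which the inverse constraint in
  -- the statement undoes.
  refine (congrArg _ ((webAppend k n (st a) (st b)).symm_apply_apply _)).trans ?_
  refine (DFunLike.congr_fun (map_symm_comp_map_strandProj (k := k) (n := n) a b) _).trans ?_
  exact congrArg (fun y => TensorProduct.map (symProj k n a) (symProj k n b)
    (S.comul (symIncl k n (a + b) y))) ((strandEquiv k n (a + b)).symm_apply_apply x)

theorem webFunctor_merge (a b : ℕ) :
    PModS.lin (tensorHom k (eqToHom (webFunctor_strand k n a).symm)
        (eqToHom (webFunctor_strand k n b).symm) ≫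
      ((webFunctor k n).μ (PWeb.strand k a) (PWeb.strand k b)).hom ≫
        (webFunctor k n).map (PWeb.merge k a b) ≫ eqToHom (webFunctor_strand k n (a + b))) =
      mer k n a b := by
  have e₁ := lin_eqToHom_webFunctor_strand (k := k) (n := n) (a + b)
    (webFunctor_strand k n (a + b))
  have e₂ := lin_tensorHom_eqToHom_symm (k := k) (n := n) a b
  refine LinearMap.ext fun x => ?_
  refine (DFunLike.congr_fun e₁ _).trans ?_
  refine (congrArg (fun y => (strandEquiv k n (a + b)).symm (mergeMap k n a b (a + b)
    (webAppend k n (st a) (st b) y))) (DFunLike.congr_fun e₂ x)).trans ?_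
  refine ((strandEquiv k n (a + b)).symm_apply_apply _).trans ?_
  refine congrArg (fun y => symProj k n (a + b) (LinearMap.mul' k (S k n) y)) ?_
  refine (congrArg _ ((webAppend k n (st a) (st b)).symm_apply_apply _)).trans ?_
  exact DFunLike.congr_fun (map_strandIncl_comp_map (k := k) (n := n) a b) x

theorem webFunctor_cap (v w : V k n) :
    PModS.lin (tensorHom k (eqToHom (webFunctor_strand k n 1).symm)
        (eqToHom (webFunctor_strand k n 1).symm) ≫
      ((webFunctor k n).μ (PWeb.strand k 1) (PWeb.strand k 1)).hom ≫
        (webFunctor k n).map (PWeb.cap k) ≫ (webFunctor k n).ε.inv)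
          (vIncl k n v ⊗ₜ[k] vIncl k n w) = form k n v w := by
  have e₂ := lin_tensorHom_eqToHom_symm (k := k) (n := n) 1 1
  refine (congrArg (fun y => capMap k n (webAppend k n (st 1) (st 1) y))
    (DFunLike.congr_fun e₂ (vIncl k n v ⊗ₜ[k] vIncl k n w))).trans ?_
  refine (congrArg (fun y => S.capForm k n (TensorProduct.map (strandIncl k n 1)
    (strandIncl k n 1) y)) ((webAppend k n (st 1) (st 1)).symm_apply_apply
      (TensorProduct.map (strandEquiv k n 1).toLinearMap (strandEquiv k n 1).toLinearMap
        (vIncl k n v ⊗ₜ[k] vIncl k n w)))).trans ?_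
  refine (congrArg (S.capForm k n) (DFunLike.congr_fun
    (map_strandIncl_comp_map (k := k) (n := n) 1 1) (vIncl k n v ⊗ₜ[k] vIncl k n w))).trans ?_
  refine (S.capForm_tmul (S.ι k n v) (S.ι k n w)).trans ?_
  rw [S.vProj_ι, S.vProj_ι]

theorem webFunctor_cup :
    PModS.lin ((webFunctor k n).ε.hom ≫ (webFunctor k n).map (PWeb.cup k) ≫
      ((webFunctor k n).μ (PWeb.strand k 1) (PWeb.strand k 1)).inv ≫
        tensorHom k (eqToHom (webFunctor_strand k n 1)) (eqToHom (webFunctor_strand k n 1)))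
          (1 : k) = cupElem k n := by
  have e₂ := lin_tensorHom_eqToHom (k := k) (n := n) 1 1
  refine (DFunLike.congr_fun e₂ _).trans ?_
  refine (congrArg _ ((webAppend k n (st 1) (st 1)).symm_apply_apply _)).trans ?_
  refine (DFunLike.congr_fun (map_symm_comp_map_strandProj (k := k) (n := n) 1 1) _).trans ?_
  refine (congrArg _ (one_smul k (S.cupVec k n))).trans ?_
  simp only [S.cupVec, cupElem, map_sum, map_smul, TensorProduct.map_tmul, symProj_one_ι]

end functor
end
end PWebs

theorem mainTheorem5 (k : Type u) [Field k] [NeZero (2 : k)] (n : ℕ) :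
    ∃ (G : MonoidalSuperfunctor k (PWeb k) (PModS k n))
      (hG : ∀ d : ℕ, G.obj (PWeb.strand k d) = PModS.sym k n d),
      G.ε.hom = eqToHom (hG 0).symm ∧
      (∀ a b : ℕ, PModS.lin (eqToHom (hG (a + b)).symm ≫ G.map (PWeb.split k a b) ≫
          (G.μ (PWeb.strand k a) (PWeb.strand k b)).inv ≫
            tensorHom k (eqToHom (hG a)) (eqToHom (hG b))) = spl k n a b) ∧
      (∀ a b : ℕ, PModS.lin (tensorHom k (eqToHom (hG a).symm) (eqToHom (hG b).symm) ≫
          (G.μ (PWeb.strand k a) (PWeb.strand k b)).hom ≫ G.map (PWeb.merge k a b) ≫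
            eqToHom (hG (a + b))) = mer k n a b) ∧
      (∀ v w : V k n, PModS.lin (tensorHom k (eqToHom (hG 1).symm) (eqToHom (hG 1).symm) ≫
          (G.μ (PWeb.strand k 1) (PWeb.strand k 1)).hom ≫ G.map (PWeb.cap k) ≫ G.ε.inv)
            (vIncl k n v ⊗ₜ[k] vIncl k n w) = form k n v w) ∧
      PModS.lin (G.ε.hom ≫ G.map (PWeb.cup k) ≫
          (G.μ (PWeb.strand k 1) (PWeb.strand k 1)).inv ≫
            tensorHom k (eqToHom (hG 1)) (eqToHom (hG 1))) (1 : k) = cupElem k n := by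
  exact ⟨webFunctor k n, webFunctor_strand k n, rfl, webFunctor_split, webFunctor_merge,
    webFunctor_cap, webFunctor_cup⟩
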